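/- **Document listing for two patterns.** Work in the word-RAM model with $w$-bit words: a program is a fixed finite program over registers and a random access memory, each load, store, arithmetic (addition, subtraction, multiplication, division, remainder) or bitwise operation on words, each comparison, each read of a pattern character and each output of a word costs one step, and space is the number of memory cells (words). The program does not depend on the documents or on $w$. There are a query program $P$ and constants $\kappa \in \mathbb{N}$, $C \in \mathbb{R}$ such that the following holds. Let $d_1,\dots,d_c$ be documents, that is, strings of total length $N=\sum_i |d_i|\ge 2$ over the alphabet of all $w$-bit words, where $w$ is such that $2^w\ge N^{\kappa}$ and $2^w>c$. Then the documents can be preprocessed into a memory image (data structure) occupying at most $C\,N\log_2 N$ words, workspace for queries included, such that for all patterns $p,q$ over the same alphabet (with $|p|,|q|<2^w$), the program $P$, run on this memory image with read access to $p$, $q$ and their lengths, lists each document that contains both $p$ and $q$ as substrings exactly once, lists no other document, restores the memory image, and halts after at most $$C\Bigl(|p|+|q|+\bigl(\sqrt{N\log_2 N\cdot\max(1,\mathrm{output})}+\mathrm{output}\bigr)\log_2^2 N\Bigr)$$ steps, where $\mathrm{output}$ is the number of documents that contain both $p$ and $q$. -/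

import Mathlib

/-! ## Word RAM

A word RAM with `w`-bit words, given by structured programs: finitely many named registers,
a random access memory, two read-only input arrays and a write-only output.  Every elementary
instruction and every evaluation of a test costs one step. -/

namespace WordRAM

/-- Arithmetic and bitwise instructions on words. -/
inductive BinOp
  | add | sub | mul | div | mod | band | bor | bxor | shl | shr

/-- Result of an instruction on `w`-bit words; arithmetic is modulo `2 ^ w`. -/
def BinOp.eval (w : ℕ) : BinOp → ℕ → ℕ → ℕ
  | .add, x, y => (x + y) % 2 ^ w
  | .sub, x, y => (x + (2 ^ w - y)) % 2 ^ w
  | .mul, x, y => (x * y) % 2 ^ w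
  | .div, x, y => x / y
  | .mod, x, y => x % y
  | .band, x, y => x &&& y
  | .bor, x, y => x ||| y
  | .bxor, x, y => x ^^^ y
  | .shl, x, y => (x * 2 ^ y) % 2 ^ w
  | .shr, x, y => x / 2 ^ y

/-- Comparison of the contents of two registers. -/
inductive Test
  | lt (a b : ℕ)
  | le (a b : ℕ)
  | eq (a b : ℕ)
  | ne (a b : ℕ)

/-- Truth of a comparison for the register contents `reg`. -/
def Test.Holds (reg : ℕ → ℕ) : Test → Prop
  | .lt a b => reg a < reg b
  | .le a b => reg a ≤ reg b
  | .eq a b => reg a = reg b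
  | .ne a b => reg a ≠ reg b

/-- Programs.  Letters `r`, `a`, `b` stand for names of registers. -/
inductive Prog
  /-- no operation -/
  | skip
  /-- `r := n` -/
  | const (r n : ℕ)
  /-- `r := a` -/
  | move (r a : ℕ)
  /-- `r := a ∘ b` -/
  | op (o : BinOp) (r a b : ℕ)
  /-- `r := memory[a]` -/
  | load (r a : ℕ)
  /-- `memory[a] := b` -/
  | store (a b : ℕ)
  /-- `r := p[a]`, where `p` is the first input array -/
  | readFst (r a : ℕ)
  /-- `r := q[a]`, where `q` is the second input array -/
  | readSnd (r a : ℕ)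
  /-- append the content of register `a` to the output -/
  | emit (a : ℕ)
  | seq (P Q : Prog)
  | ifThenElse (b : Test) (P Q : Prog)
  | whileDo (b : Test) (P : Prog)

/-- A configuration: registers, memory and the output written so far. -/
structure State where
  reg : ℕ → ℕ
  mem : ℕ → ℕ
  out : List ℕ

/-- Register `r` receives the value `v`. -/
def State.setReg (s : State) (r v : ℕ) : State :=
  { s with reg := Function.update s.reg r v }

/-- `Run w S p q P s t s'`: with `w`-bit words, a memory that consists of the `S` cells
`0, …, S - 1`, and the input arrays `p` and `q`, the program `P` started in `s` terminates in
`s'` after exactly `t` steps.  There is no run that accesses a memory cell or an array entry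
outside the range. -/
inductive Run (w S : ℕ) (p q : List ℕ) : Prog → State → ℕ → State → Prop
  | skip (s : State) : Run w S p q .skip s 1 s
  | const (s : State) (r n : ℕ) :
      Run w S p q (.const r n) s 1 (s.setReg r (n % 2 ^ w))
  | move (s : State) (r a : ℕ) :
      Run w S p q (.move r a) s 1 (s.setReg r (s.reg a))
  | op (s : State) (o : BinOp) (r a b : ℕ) :
      Run w S p q (.op o r a b) s 1 (s.setReg r (o.eval w (s.reg a) (s.reg b)))
  | load (s : State) (r a : ℕ) (h : s.reg a < S) :
      Run w S p q (.load r a) s 1 (s.setReg r (s.mem (s.reg a)))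
  | store (s : State) (a b : ℕ) (h : s.reg a < S) :
      Run w S p q (.store a b) s 1
        { s with mem := Function.update s.mem (s.reg a) (s.reg b) }
  | readFst (s : State) (r a : ℕ) (h : s.reg a < p.length) :
      Run w S p q (.readFst r a) s 1 (s.setReg r p[s.reg a])
  | readSnd (s : State) (r a : ℕ) (h : s.reg a < q.length) :
      Run w S p q (.readSnd r a) s 1 (s.setReg r q[s.reg a])
  | emit (s : State) (a : ℕ) :
      Run w S p q (.emit a) s 1 { s with out := s.out ++ [s.reg a] }
  | seq {P Q : Prog} {s s₁ s₂ : State} {t₁ t₂ : ℕ}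
      (h₁ : Run w S p q P s t₁ s₁) (h₂ : Run w S p q Q s₁ t₂ s₂) :
      Run w S p q (.seq P Q) s (t₁ + t₂) s₂
  | ifTrue {b : Test} {P Q : Prog} {s s₁ : State} {t : ℕ}
      (hb : b.Holds s.reg) (h : Run w S p q P s t s₁) :
      Run w S p q (.ifThenElse b P Q) s (t + 1) s₁
  | ifFalse {b : Test} {P Q : Prog} {s s₁ : State} {t : ℕ}
      (hb : ¬ b.Holds s.reg) (h : Run w S p q Q s t s₁) :
      Run w S p q (.ifThenElse b P Q) s (t + 1) s₁
  | whileTrue {b : Test} {P : Prog} {s s₁ s₂ : State} {t₁ t₂ : ℕ}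
      (hb : b.Holds s.reg) (h₁ : Run w S p q P s t₁ s₁)
      (h₂ : Run w S p q (.whileDo b P) s₁ t₂ s₂) :
      Run w S p q (.whileDo b P) s (t₁ + t₂ + 1) s₂
  | whileFalse {b : Test} {P : Prog} {s : State} (hb : ¬ b.Holds s.reg) :
      Run w S p q (.whileDo b P) s 1 s

/-- Start of a query: the memory is `M`, the output is empty, registers `0` and `1` hold the
lengths of the two input arrays, and all other registers hold `0`. -/
def start (M : ℕ → ℕ) (p q : List ℕ) : State where
  reg := Function.update (Function.update (fun _ => 0) 0 p.length) 1 q.length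
  mem := M
  out := []

end WordRAM

namespace DocumentListing

/-- The total length `∑ |dᵢ|` of a collection of documents. -/
def totalLength {c : ℕ} (docs : Fin c → List ℕ) : ℕ :=
  ∑ i, (docs i).length

open Classical in
/-- The set of (indices of) all documents that contain both patterns as substrings. -/
noncomputable def matching {c : ℕ} (docs : Fin c → List ℕ) (p q : List ℕ) : Finset (Fin c) :=
  Finset.univ.filter fun i => p <:+: docs i ∧ q <:+: docs i

/-- `Answers P w S M docs p q t`: with `w`-bit words and `S` memory cells, the program `P`
started on the memory image `M` and the patterns `p` and `q` halts after `t` steps, has listed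
each document that contains both patterns exactly once and nothing else, and leaves the memory
as it was, ready for the next query. -/
def Answers (P : WordRAM.Prog) (w S : ℕ) (M : ℕ → ℕ) {c : ℕ} (docs : Fin c → List ℕ)
    (p q : List ℕ) (t : ℕ) : Prop :=
  ∃ s : WordRAM.State,
    WordRAM.Run w S p q P (WordRAM.start M p q) t s ∧
    s.mem = M ∧
    s.out.Nodup ∧
    ∀ j : ℕ, j ∈ s.out ↔ ∃ i ∈ matching docs p q, (i : ℕ) = j

end DocumentListing

namespace WordRAM

/-! ## A small imperative language compiled to the word RAM -/

/-! The nonempty suffixes of all documents are put in the order given by a path-compressed ternary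
search tree. The suffixes with a given prefix are then consecutive, so each pattern becomes a range
of ranks. Pivots are medians, so a branch to the left or right halves the number of strings and a
middle branch consumes a character of the pattern; the search takes O(|p| + log N) steps
(`PT.exists_tree`). The search inspects only branching positions, and one comparison with a sample
string settles the answer for all strings below the node reached (`PT.find_cases`).

The documents are the leaves of a complete binary tree of height about log N. Each node stores the
sorted ranks below it, in total at most N(H + 1) of them (`sum_cnt_le`). A node with n ranks cuts
its list into blocks of length about √n and has a table which gives, for blocks j and j', the end of
the first block from j' on that shares a document with block j. The tables have O(n) entries per
node (`sum_bs_le`). Whether some document below the node occurs in both ranges is decided by two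
scans of O(√n) steps: pairs of full blocks are settled by the table, and a position outside the full
blocks by binary search in the list of its own leaf. A pair missed by both scans would have a member
both inside and outside the full blocks (`not_meet_of_clear`, `wp_nodeTest`).

A query traverses the tree in preorder and skips the subtree of a node without a hit. With k hits,
the visited nodes of one level have at most about k parents with hits, so by Cauchy–Schwarz their
square roots sum to O(√(kN)); the number of levels gives one logarithm and the binary searches the
other (`treeCost_le`). The factor log N under the root of the claimed bound is not needed for this.

The algorithm is written in a small language with natural number arithmetic, reasoned about by
weakest preconditions, and compiled with constant overhead (`Cmd.run_code`). The data structure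
exists by `exists_index`, and `Index.output` links a run to the matching documents. -/

/-- The data of a run: word length, number of entries per array, the two inputs, and read-only
arrays `A 0, …, A 31`, stored interleaved. -/
structure Ctx where
  w : ℕ
  L : ℕ
  p : List ℕ
  q : List ℕ
  A : ℕ → ℕ → ℕ

/-- The memory image holding the 32 arrays. -/
def Ctx.mem (Γ : Ctx) (a : ℕ) : ℕ := Γ.A (a % 32) (a / 32)

/-- The first or the second input. -/
def Ctx.inp (Γ : Ctx) (b : Bool) : List ℕ := if b then Γ.q else Γ.p

/-- Expressions over variables, arrays and inputs. -/
inductive Ex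
  | reg (r : ℕ)
  | lit (n : ℕ)
  | sum (a b : Ex)
  | dif (a b : Ex)
  | prd (a b : Ex)
  | quo (a b : Ex)
  | rem (a b : Ex)
  | arr (j : ℕ) (a : Ex)
  | inp (b : Bool) (a : Ex)

/-- Value of an expression, in natural number arithmetic. -/
def Ex.val (Γ : Ctx) (ρ : ℕ → ℕ) : Ex → ℕ
  | .reg r => ρ r
  | .lit n => n
  | .sum a b => a.val Γ ρ + b.val Γ ρ
  | .dif a b => a.val Γ ρ - b.val Γ ρ
  | .prd a b => a.val Γ ρ * b.val Γ ρ
  | .quo a b => a.val Γ ρ / b.val Γ ρ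
  | .rem a b => a.val Γ ρ % b.val Γ ρ
  | .arr j a => Γ.A j (a.val Γ ρ)
  | .inp b a => (Γ.inp b).getD (a.val Γ ρ) 0

/-- The evaluation neither overflows nor leaves the range of an array. -/
def Ex.Ok (Γ : Ctx) (ρ : ℕ → ℕ) : Ex → Prop
  | .reg _ => True
  | .lit n => n < 2 ^ Γ.w
  | .sum a b => a.Ok Γ ρ ∧ b.Ok Γ ρ ∧ a.val Γ ρ + b.val Γ ρ < 2 ^ Γ.w
  | .dif a b => a.Ok Γ ρ ∧ b.Ok Γ ρ ∧ b.val Γ ρ ≤ a.val Γ ρ ∧ a.val Γ ρ < 2 ^ Γ.w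
  | .prd a b => a.Ok Γ ρ ∧ b.Ok Γ ρ ∧ a.val Γ ρ * b.val Γ ρ < 2 ^ Γ.w
  | .quo a b => a.Ok Γ ρ ∧ b.Ok Γ ρ
  | .rem a b => a.Ok Γ ρ ∧ b.Ok Γ ρ
  | .arr j a => j < 32 ∧ a.Ok Γ ρ ∧ a.val Γ ρ < Γ.L
  | .inp b a => a.Ok Γ ρ ∧ a.val Γ ρ < (Γ.inp b).length

/-- Code that leaves the value of an expression in the `i`-th temporary register. -/
def Ex.code : Ex → ℕ → Prog
  | .reg r, i => .move (2 * i + 1) (2 * r)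
  | .lit n, i => .const (2 * i + 1) n
  | .sum a b, i => .seq (a.code i) (.seq (b.code (i + 1))
      (.op .add (2 * i + 1) (2 * i + 1) (2 * (i + 1) + 1)))
  | .dif a b, i => .seq (a.code i) (.seq (b.code (i + 1))
      (.op .sub (2 * i + 1) (2 * i + 1) (2 * (i + 1) + 1)))
  | .prd a b, i => .seq (a.code i) (.seq (b.code (i + 1))
      (.op .mul (2 * i + 1) (2 * i + 1) (2 * (i + 1) + 1)))
  | .quo a b, i => .seq (a.code i) (.seq (b.code (i + 1))
      (.op .div (2 * i + 1) (2 * i + 1) (2 * (i + 1) + 1)))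
  | .rem a b, i => .seq (a.code i) (.seq (b.code (i + 1))
      (.op .mod (2 * i + 1) (2 * i + 1) (2 * (i + 1) + 1)))
  | .arr j a, i => .seq (a.code i) (.seq (.const (2 * (i + 1) + 1) 32)
      (.seq (.op .mul (2 * i + 1) (2 * i + 1) (2 * (i + 1) + 1))
      (.seq (.const (2 * (i + 1) + 1) j)
      (.seq (.op .add (2 * i + 1) (2 * i + 1) (2 * (i + 1) + 1))
        (.load (2 * i + 1) (2 * i + 1))))))
  | .inp false a, i => .seq (a.code i) (.readFst (2 * i + 1) (2 * i + 1))
  | .inp true a, i => .seq (a.code i) (.readSnd (2 * i + 1) (2 * i + 1))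

/-- Running time of `Ex.code`. -/
def Ex.cost : Ex → ℕ
  | .reg _ => 1
  | .lit _ => 1
  | .sum a b => a.cost + (b.cost + 1)
  | .dif a b => a.cost + (b.cost + 1)
  | .prd a b => a.cost + (b.cost + 1)
  | .quo a b => a.cost + (b.cost + 1)
  | .rem a b => a.cost + (b.cost + 1)
  | .arr _ a => a.cost + 5
  | .inp _ a => a.cost + 1

/-- The state `s` represents the store `ρ` and the output `o`. -/
structure Rep (Γ : Ctx) (s : State) (ρ : ℕ → ℕ) (o : List ℕ) : Prop where
  mem : s.mem = Γ.mem
  out : s.out = o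
  reg : ∀ r, s.reg (2 * r) = ρ r

abbrev Ctx.Run (Γ : Ctx) := WordRAM.Run Γ.w (32 * Γ.L) Γ.p Γ.q

theorem Rep.setReg_odd {Γ : Ctx} {s : State} {ρ : ℕ → ℕ} {o : List ℕ} (h : Rep Γ s ρ o)
    (i v : ℕ) : Rep Γ (s.setReg (2 * i + 1) v) ρ o := by
  refine ⟨h.mem, h.out, fun r => ?_⟩
  have : 2 * r ≠ 2 * i + 1 := by omega
  simp [State.setReg, this, h.reg]

/-- The result of evaluating `e` to temporary register `i`. -/
structure EvalsTo (Γ : Ctx) (s s' : State) (ρ : ℕ → ℕ) (o : List ℕ) (i v : ℕ) : Prop where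
  rep : Rep Γ s' ρ o
  tmp : s'.reg (2 * i + 1) = v
  low : ∀ k < i, s'.reg (2 * k + 1) = s.reg (2 * k + 1)

/-- The second operand goes to temporary `i + 1`; by the clause `low` its evaluation leaves the
first operand in temporary `i` intact. -/
theorem Ex.run_bin {Γ : Ctx} {ρ : ℕ → ℕ} {o : List ℕ} {a b : Ex} (op : BinOp) {v : ℕ}
    (ha : ∀ i s, Rep Γ s ρ o →
      ∃ s', Γ.Run (a.code i) s a.cost s' ∧ EvalsTo Γ s s' ρ o i (a.val Γ ρ))
    (hb : ∀ i s, Rep Γ s ρ o →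
      ∃ s', Γ.Run (b.code i) s b.cost s' ∧ EvalsTo Γ s s' ρ o i (b.val Γ ρ))
    (hv : op.eval Γ.w (a.val Γ ρ) (b.val Γ ρ) = v) (i : ℕ) (s : State) (hs : Rep Γ s ρ o) :
    ∃ s', Γ.Run (.seq (a.code i) (.seq (b.code (i + 1))
      (.op op (2 * i + 1) (2 * i + 1) (2 * (i + 1) + 1)))) s (a.cost + (b.cost + 1)) s' ∧
      EvalsTo Γ s s' ρ o i v := by
  obtain ⟨s₁, r₁, e₁⟩ := ha i s hs
  obtain ⟨s₂, r₂, e₂⟩ := hb (i + 1) s₁ e₁.rep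
  refine ⟨_, .seq r₁ (.seq r₂ (.op _ _ _ _ _)), e₂.rep.setReg_odd _ _, ?_, fun k hk => ?_⟩
  · simp [State.setReg, e₂.tmp, e₂.low i (by omega), e₁.tmp, hv]
  · have : k ≠ i := by omega
    simp [State.setReg, this, e₂.low k (by omega), e₁.low k hk]

/-- Under `Ex.Ok` every intermediate result fits in a word, so arithmetic modulo `2 ^ w` agrees with
that of ℕ. The bound on `32 * Γ.L` does the same for the addresses `32 * a + j` of the interleaved
arrays. -/
theorem Ex.run_code {Γ : Ctx} (hL : 32 * Γ.L ≤ 2 ^ Γ.w) (h32 : 32 < 2 ^ Γ.w) {ρ : ℕ → ℕ}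
    {o : List ℕ} (e : Ex) (he : e.Ok Γ ρ) : ∀ (i : ℕ) (s : State), Rep Γ s ρ o →
      ∃ s', Γ.Run (e.code i) s e.cost s' ∧ EvalsTo Γ s s' ρ o i (e.val Γ ρ) := by
  induction e with
  | reg r =>
    intro i s hs
    refine ⟨_, .move _ _ _, hs.setReg_odd _ _, ?_, fun k hk => ?_⟩
    · simp [State.setReg, hs.reg, Ex.val]
    · have : k ≠ i := by omega
      simp [State.setReg, this]
  | lit n =>
    intro i s hs
    refine ⟨_, .const _ _ _, hs.setReg_odd _ _, ?_, fun k hk => ?_⟩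
    · simp [State.setReg, Ex.val, Nat.mod_eq_of_lt (show n < 2 ^ Γ.w from he)]
    · have : k ≠ i := by omega
      simp [State.setReg, this]
  | sum a b iha ihb =>
    exact Ex.run_bin .add (iha he.1) (ihb he.2.1) (Nat.mod_eq_of_lt he.2.2)
  | dif a b iha ihb =>
    refine Ex.run_bin .sub (iha he.1) (ihb he.2.1) ?_
    have h := he.2.2
    simp only [BinOp.eval, Ex.val]
    rw [show a.val Γ ρ + (2 ^ Γ.w - b.val Γ ρ) = (a.val Γ ρ - b.val Γ ρ) + 2 ^ Γ.w by omega,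
      Nat.add_mod_right, Nat.mod_eq_of_lt (by omega)]
  | prd a b iha ihb =>
    exact Ex.run_bin .mul (iha he.1) (ihb he.2.1) (Nat.mod_eq_of_lt he.2.2)
  | quo a b iha ihb => exact Ex.run_bin .div (iha he.1) (ihb he.2) rfl
  | rem a b iha ihb => exact Ex.run_bin .mod (iha he.1) (ihb he.2) rfl
  | arr j a iha =>
    intro i s hs
    obtain ⟨hj, ha, hl⟩ := he
    obtain ⟨s₁, r₁, e₁⟩ := iha ha i s hs
    have e1 : 32 % 2 ^ Γ.w = 32 := Nat.mod_eq_of_lt h32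
    have e2 : j % 2 ^ Γ.w = j := Nat.mod_eq_of_lt (by omega)
    have e3 : a.val Γ ρ * 32 % 2 ^ Γ.w = a.val Γ ρ * 32 := Nat.mod_eq_of_lt (by omega)
    have e4 : (a.val Γ ρ * 32 + j) % 2 ^ Γ.w = a.val Γ ρ * 32 + j := Nat.mod_eq_of_lt (by omega)
    refine ⟨_, .seq r₁ (.seq (.const _ _ _) (.seq (.op _ _ _ _ _) (.seq (.const _ _ _)
      (.seq (.op _ _ _ _ _) (.load _ _ _ ?_))))),
      (((((e₁.rep.setReg_odd _ _).setReg_odd _ _).setReg_odd _ _).setReg_odd _ _).setReg_odd _ _),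
      ?_, fun k hk => ?_⟩
    · simp [State.setReg, BinOp.eval, e₁.tmp, e1, e2, e3, e4]; omega
    · have : (a.val Γ ρ * 32 + j) / 32 = a.val Γ ρ := by omega
      have : (a.val Γ ρ * 32 + j) % 32 = j := by omega
      simp [State.setReg, BinOp.eval, e₁.tmp, e₁.rep.mem, Ctx.mem, Ex.val, *]
    · have h1 : k ≠ i := by omega
      have h2 : k ≠ i + 1 := by omega
      simp [State.setReg, h1, h2, e₁.low k hk]
  | inp b a iha =>
    intro i s hs
    obtain ⟨ha, hl⟩ := he
    obtain ⟨s₁, r₁, e₁⟩ := iha ha i s hs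
    cases b
    · have hl' : a.val Γ ρ < Γ.p.length := by simpa [Ctx.inp] using hl
      refine ⟨_, .seq r₁ (.readFst _ _ _ (by rw [e₁.tmp]; exact hl')), e₁.rep.setReg_odd _ _, ?_,
        fun k hk => ?_⟩
      · simp [State.setReg, e₁.tmp, Ex.val, Ctx.inp, hl']
      · have : k ≠ i := by omega
        simp [State.setReg, this, e₁.low k hk]
    · have hl' : a.val Γ ρ < Γ.q.length := by simpa [Ctx.inp] using hl
      refine ⟨_, .seq r₁ (.readSnd _ _ _ (by rw [e₁.tmp]; exact hl')), e₁.rep.setReg_odd _ _, ?_,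
        fun k hk => ?_⟩
      · simp [State.setReg, e₁.tmp, Ex.val, Ctx.inp, hl']
      · have : k ≠ i := by omega
        simp [State.setReg, this, e₁.low k hk]

/-- Conditions. -/
inductive Cond
  | lt (a b : Ex)
  | le (a b : Ex)
  | eq (a b : Ex)

def Cond.Holds (Γ : Ctx) (ρ : ℕ → ℕ) : Cond → Prop
  | .lt a b => a.val Γ ρ < b.val Γ ρ
  | .le a b => a.val Γ ρ ≤ b.val Γ ρ
  | .eq a b => a.val Γ ρ = b.val Γ ρ

def Cond.Ok (Γ : Ctx) (ρ : ℕ → ℕ) : Cond → Prop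
  | .lt a b => a.Ok Γ ρ ∧ b.Ok Γ ρ
  | .le a b => a.Ok Γ ρ ∧ b.Ok Γ ρ
  | .eq a b => a.Ok Γ ρ ∧ b.Ok Γ ρ

/-- Code that evaluates both sides of a condition. -/
def Cond.code : Cond → Prog
  | .lt a b => .seq (a.code 0) (b.code 1)
  | .le a b => .seq (a.code 0) (b.code 1)
  | .eq a b => .seq (a.code 0) (b.code 1)

/-- Registers 1 and 3 are the temporaries 0 and 1, where `Cond.code` leaves the two sides. -/
def Cond.test : Cond → Test
  | .lt _ _ => .lt 1 3
  | .le _ _ => .le 1 3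
  | .eq _ _ => .eq 1 3

def Cond.cost : Cond → ℕ
  | .lt a b => a.cost + b.cost
  | .le a b => a.cost + b.cost
  | .eq a b => a.cost + b.cost

theorem Cond.run_code {Γ : Ctx} (hL : 32 * Γ.L ≤ 2 ^ Γ.w) (h32 : 32 < 2 ^ Γ.w) {ρ : ℕ → ℕ}
    {o : List ℕ} (c : Cond) (hc : c.Ok Γ ρ) (s : State) (hs : Rep Γ s ρ o) :
    ∃ s', Γ.Run c.code s c.cost s' ∧ Rep Γ s' ρ o ∧ (c.test.Holds s'.reg ↔ c.Holds Γ ρ) := by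
  have key : ∀ a b : Ex, a.Ok Γ ρ → b.Ok Γ ρ → ∃ s', Γ.Run (.seq (a.code 0) (b.code 1)) s
      (a.cost + b.cost) s' ∧ Rep Γ s' ρ o ∧ s'.reg 1 = a.val Γ ρ ∧ s'.reg 3 = b.val Γ ρ := by
    intro a b ha hb
    obtain ⟨s₁, r₁, e₁⟩ := a.run_code hL h32 ha 0 s hs
    obtain ⟨s₂, r₂, e₂⟩ := b.run_code hL h32 hb 1 s₁ e₁.rep
    exact ⟨s₂, .seq r₁ r₂, e₂.rep, (e₂.low 0 (by omega)).trans e₁.tmp, e₂.tmp⟩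
  cases c with
  | lt a b =>
    obtain ⟨s', r, h, h1, h2⟩ := key a b hc.1 hc.2
    exact ⟨s', r, h, by simp [Cond.test, Test.Holds, Cond.Holds, h1, h2]⟩
  | le a b =>
    obtain ⟨s', r, h, h1, h2⟩ := key a b hc.1 hc.2
    exact ⟨s', r, h, by simp [Cond.test, Test.Holds, Cond.Holds, h1, h2]⟩
  | eq a b =>
    obtain ⟨s', r, h, h1, h2⟩ := key a b hc.1 hc.2
    exact ⟨s', r, h, by simp [Cond.test, Test.Holds, Cond.Holds, h1, h2]⟩

/-- Commands. -/
inductive Cmd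
  | skip
  | set (r : ℕ) (e : Ex)
  | emit (e : Ex)
  | seq (c d : Cmd)
  | ite (b : Cond) (c d : Cmd)
  | loop (b : Cond) (c : Cmd)

/-- A sequence of commands. -/
def Cmd.block : List Cmd → Cmd
  | [] => .skip
  | [c] => c
  | c :: d :: l => .seq c (Cmd.block (d :: l))

/-- Variable `r` lives in register `2 * r`, and odd registers are temporaries. The machine tests
registers only, so a loop evaluates its condition once before and again at the end of each round. -/
def Cmd.code : Cmd → Prog
  | .skip => .skip
  | .set r e => .seq (e.code 0) (.move (2 * r) 1)
  | .emit e => .seq (e.code 0) (.emit 1)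
  | .seq c d => .seq c.code d.code
  | .ite b c d => .seq b.code (.ifThenElse b.test c.code d.code)
  | .loop b c => .seq b.code (.whileDo b.test (.seq c.code b.code))

/-- Big-step semantics of commands with unit costs. -/
inductive Ev (Γ : Ctx) : Cmd → (ℕ → ℕ) → List ℕ → ℕ → (ℕ → ℕ) → List ℕ → Prop
  | skip {ρ o} : Ev Γ .skip ρ o 1 ρ o
  | set {ρ o} {r : ℕ} {e : Ex} (h : e.Ok Γ ρ) :
      Ev Γ (.set r e) ρ o 1 (Function.update ρ r (e.val Γ ρ)) o
  | emit {ρ o} {e : Ex} (h : e.Ok Γ ρ) : Ev Γ (.emit e) ρ o 1 ρ (o ++ [e.val Γ ρ])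
  | seq {c d ρ o n ρ₁ o₁ m ρ₂ o₂} (h₁ : Ev Γ c ρ o n ρ₁ o₁) (h₂ : Ev Γ d ρ₁ o₁ m ρ₂ o₂) :
      Ev Γ (.seq c d) ρ o (n + m) ρ₂ o₂
  | iteTrue {b c d ρ o n ρ₁ o₁} (hb : b.Ok Γ ρ) (ht : b.Holds Γ ρ) (h : Ev Γ c ρ o n ρ₁ o₁) :
      Ev Γ (.ite b c d) ρ o (n + 1) ρ₁ o₁
  | iteFalse {b c d ρ o n ρ₁ o₁} (hb : b.Ok Γ ρ) (ht : ¬ b.Holds Γ ρ) (h : Ev Γ d ρ o n ρ₁ o₁) :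
      Ev Γ (.ite b c d) ρ o (n + 1) ρ₁ o₁
  | loopTrue {b c ρ o n ρ₁ o₁ m ρ₂ o₂} (hb : b.Ok Γ ρ) (ht : b.Holds Γ ρ)
      (h₁ : Ev Γ c ρ o n ρ₁ o₁) (h₂ : Ev Γ (.loop b c) ρ₁ o₁ m ρ₂ o₂) :
      Ev Γ (.loop b c) ρ o (n + m + 1) ρ₂ o₂
  | loopFalse {b c ρ o} (hb : b.Ok Γ ρ) (ht : ¬ b.Holds Γ ρ) : Ev Γ (.loop b c) ρ o 1 ρ o

/-- A bound for the number of steps per unit cost. -/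
def Cmd.factor : Cmd → ℕ
  | .skip => 1
  | .set _ e => e.cost + 1
  | .emit e => e.cost + 1
  | .seq c d => c.factor + d.factor
  | .ite b c d => b.cost + 1 + c.factor + d.factor
  | .loop b c => b.cost + 1 + c.factor

theorem Cmd.run_code {Γ : Ctx} (hL : 32 * Γ.L ≤ 2 ^ Γ.w) (h32 : 32 < 2 ^ Γ.w) {K : ℕ} {c : Cmd}
    {ρ : ℕ → ℕ} {o : List ℕ} {n : ℕ} {ρ' : ℕ → ℕ} {o' : List ℕ} (h : Ev Γ c ρ o n ρ' o')
    (hK : c.factor ≤ K) (s : State) (hs : Rep Γ s ρ o) :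
    ∃ t s', Γ.Run c.code s t s' ∧ Rep Γ s' ρ' o' ∧ t ≤ K * n := by
  induction h generalizing s with
  | skip => exact ⟨1, s, .skip s, hs, by simpa [Cmd.factor] using hK⟩
  | @set ρ o r e h =>
    obtain ⟨s₁, r₁, e₁⟩ := e.run_code hL h32 h 0 s hs
    refine ⟨_, _, .seq r₁ (.move _ _ _), ⟨e₁.rep.mem, e₁.rep.out, fun k => ?_⟩, ?_⟩
    · have := e₁.tmp
      simp only [Nat.mul_zero, Nat.zero_add] at this
      by_cases hk : k = r
      · subst hk; simp [State.setReg, this]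
      · simp [State.setReg, hk, e₁.rep.reg]
    · simpa [Cmd.factor] using hK
  | @emit ρ o e h =>
    obtain ⟨s₁, r₁, e₁⟩ := e.run_code hL h32 h 0 s hs
    refine ⟨_, _, .seq r₁ (.emit _ _), ⟨e₁.rep.mem, ?_, e₁.rep.reg⟩, ?_⟩
    · have := e₁.tmp
      simp only [Nat.mul_zero, Nat.zero_add] at this
      simp [this, e₁.rep.out]
    · simpa [Cmd.factor] using hK
  | seq _ _ ih₁ ih₂ =>
    simp only [Cmd.factor] at hK
    obtain ⟨t₁, s₁, r₁, h₁, b₁⟩ := ih₁ (by omega) s hs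
    obtain ⟨t₂, s₂, r₂, h₂, b₂⟩ := ih₂ (by omega) s₁ h₁
    exact ⟨_, s₂, .seq r₁ r₂, h₂, by rw [Nat.mul_add]; omega⟩
  | @iteTrue b _ _ _ _ _ _ _ hb ht _ ih =>
    simp only [Cmd.factor] at hK
    obtain ⟨s₀, r₀, h₀, e₀⟩ := b.run_code hL h32 hb s hs
    obtain ⟨t₁, s₁, r₁, h₁, b₁⟩ := ih (by omega) s₀ h₀
    exact ⟨_, s₁, .seq r₀ (.ifTrue (e₀.2 ht) r₁), h₁, by rw [Nat.mul_add]; omega⟩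
  | @iteFalse b _ _ _ _ _ _ _ hb ht _ ih =>
    simp only [Cmd.factor] at hK
    obtain ⟨s₀, r₀, h₀, e₀⟩ := b.run_code hL h32 hb s hs
    obtain ⟨t₁, s₁, r₁, h₁, b₁⟩ := ih (by omega) s₀ h₀
    exact ⟨_, s₁, .seq r₀ (.ifFalse (fun h => ht (e₀.1 h)) r₁), h₁, by rw [Nat.mul_add]; omega⟩
  | @loopTrue b c _ _ _ _ _ _ _ _ hb ht _ _ ih₁ ih₂ =>
    have hK' := hK
    simp only [Cmd.factor] at hK
    obtain ⟨s₀, r₀, h₀, e₀⟩ := b.run_code hL h32 hb s hs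
    obtain ⟨t₁, s₁, r₁, h₁, b₁⟩ := ih₁ (by omega) s₀ h₀
    obtain ⟨t₂, s₂, r₂, h₂, b₂⟩ := ih₂ hK' s₁ h₁
    -- The induction hypothesis gives a run of the condition code followed by the loop. It is split
    -- so that the condition code can be counted as the end of the preceding round.
    cases r₂ with
    | seq r₃ r₄ =>
      exact ⟨_, s₂, .seq r₀ (.whileTrue (e₀.2 ht) (.seq r₁ r₃) r₄), h₂, by
        rw [Nat.mul_add, Nat.mul_add]; omega⟩
  | @loopFalse b c _ _ hb ht =>
    simp only [Cmd.factor] at hK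
    obtain ⟨s₀, r₀, h₀, e₀⟩ := b.run_code hL h32 hb s hs
    exact ⟨_, s₀, .seq r₀ (.whileFalse (fun h => ht (e₀.1 h))), h₀, by omega⟩

/-! ### Weakest preconditions -/

/-- The command terminates, and the final store, output and cost satisfy `Q`. -/
def Wp (Γ : Ctx) (c : Cmd) (ρ : ℕ → ℕ) (o : List ℕ) (Q : (ℕ → ℕ) → List ℕ → ℕ → Prop) : Prop :=
  ∃ n ρ' o', Ev Γ c ρ o n ρ' o' ∧ Q ρ' o' n

section
variable {Γ : Ctx} {ρ : ℕ → ℕ} {o : List ℕ} {Q : (ℕ → ℕ) → List ℕ → ℕ → Prop}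

theorem Wp.mono {c : Cmd} {Q' : (ℕ → ℕ) → List ℕ → ℕ → Prop} (h : Wp Γ c ρ o Q)
    (hQ : ∀ ρ' o' n, Q ρ' o' n → Q' ρ' o' n) : Wp Γ c ρ o Q' := by
  obtain ⟨n, ρ', o', h, hq⟩ := h
  exact ⟨n, ρ', o', h, hQ _ _ _ hq⟩

theorem wp_skip : Wp Γ .skip ρ o Q ↔ Q ρ o 1 :=
  ⟨fun ⟨_, _, _, h, hq⟩ => by cases h; exact hq, fun h => ⟨_, _, _, .skip, h⟩⟩

theorem wp_set {r : ℕ} {e : Ex} :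
    Wp Γ (.set r e) ρ o Q ↔ e.Ok Γ ρ ∧ Q (Function.update ρ r (e.val Γ ρ)) o 1 :=
  ⟨fun ⟨_, _, _, h, hq⟩ => by cases h with | set h => exact ⟨h, hq⟩,
    fun h => ⟨_, _, _, .set h.1, h.2⟩⟩

theorem wp_emit {e : Ex} :
    Wp Γ (.emit e) ρ o Q ↔ e.Ok Γ ρ ∧ Q ρ (o ++ [e.val Γ ρ]) 1 :=
  ⟨fun ⟨_, _, _, h, hq⟩ => by cases h with | emit h => exact ⟨h, hq⟩,
    fun h => ⟨_, _, _, .emit h.1, h.2⟩⟩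

theorem wp_seq {c d : Cmd} : Wp Γ (.seq c d) ρ o Q ↔
    Wp Γ c ρ o fun ρ₁ o₁ n => Wp Γ d ρ₁ o₁ fun ρ₂ o₂ m => Q ρ₂ o₂ (n + m) :=
  ⟨fun ⟨_, _, _, h, hq⟩ => by
    cases h with | seq h₁ h₂ => exact ⟨_, _, _, h₁, _, _, _, h₂, hq⟩,
    fun ⟨_, _, _, h₁, _, _, _, h₂, hq⟩ => ⟨_, _, _, .seq h₁ h₂, hq⟩⟩

theorem wp_block_cons {c d : Cmd} {l : List Cmd} :
    Wp Γ (.block (c :: d :: l)) ρ o Q ↔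
    Wp Γ c ρ o fun ρ₁ o₁ n => Wp Γ (.block (d :: l)) ρ₁ o₁ fun ρ₂ o₂ m => Q ρ₂ o₂ (n + m) :=
  wp_seq

theorem wp_block_singleton {c : Cmd} : Wp Γ (.block [c]) ρ o Q ↔ Wp Γ c ρ o Q := Iff.rfl

theorem wp_ite {b : Cond} {c d : Cmd} : Wp Γ (.ite b c d) ρ o Q ↔
    b.Ok Γ ρ ∧ (b.Holds Γ ρ → Wp Γ c ρ o fun ρ' o' n => Q ρ' o' (n + 1)) ∧
      (¬ b.Holds Γ ρ → Wp Γ d ρ o fun ρ' o' n => Q ρ' o' (n + 1)) := by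
  constructor
  · rintro ⟨_, _, _, h, hq⟩
    cases h with
    | iteTrue hb ht h => exact ⟨hb, fun _ => ⟨_, _, _, h, hq⟩, fun h => absurd ht h⟩
    | iteFalse hb ht h => exact ⟨hb, fun h => absurd h ht, fun _ => ⟨_, _, _, h, hq⟩⟩
  · rintro ⟨hb, h₁, h₂⟩
    by_cases ht : b.Holds Γ ρ
    · obtain ⟨_, _, _, h, hq⟩ := h₁ ht
      exact ⟨_, _, _, .iteTrue hb ht h, hq⟩
    · obtain ⟨_, _, _, h, hq⟩ := h₂ ht
      exact ⟨_, _, _, .iteFalse hb ht h, hq⟩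

theorem wp_loop_true {b : Cond} {c : Cmd} (hb : b.Ok Γ ρ) (ht : b.Holds Γ ρ)
    (h : Wp Γ c ρ o fun ρ₁ o₁ n => Wp Γ (.loop b c) ρ₁ o₁ fun ρ₂ o₂ m => Q ρ₂ o₂ (n + m + 1)) :
    Wp Γ (.loop b c) ρ o Q := by
  obtain ⟨_, _, _, h₁, _, _, _, h₂, hq⟩ := h
  exact ⟨_, _, _, .loopTrue hb ht h₁ h₂, hq⟩

theorem wp_loop_false {b : Cond} {c : Cmd} (hb : b.Ok Γ ρ) (ht : ¬ b.Holds Γ ρ) (h : Q ρ o 1) :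
    Wp Γ (.loop b c) ρ o Q := ⟨_, _, _, .loopFalse hb ht, h⟩

/-- Loops with an invariant `I` and a bound `φ` for the remaining cost. -/
theorem wp_loop {b : Cond} {c : Cmd} (I : (ℕ → ℕ) → List ℕ → Prop) (φ : (ℕ → ℕ) → ℕ)
    (hI : I ρ o) (hok : ∀ ρ o, I ρ o → b.Ok Γ ρ)
    (hstep : ∀ ρ o, I ρ o → b.Holds Γ ρ →
      Wp Γ c ρ o fun ρ' o' n => I ρ' o' ∧ n + 1 + φ ρ' ≤ φ ρ) :
    Wp Γ (.loop b c) ρ o fun ρ' o' n => I ρ' o' ∧ ¬ b.Holds Γ ρ' ∧ n ≤ φ ρ + 1 := by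
  induction hn : φ ρ using Nat.strong_induction_on generalizing ρ o with
  | _ k ih =>
    subst hn
    by_cases ht : b.Holds Γ ρ
    · refine wp_loop_true (hok _ _ hI) ht ((hstep _ _ hI ht).mono ?_)
      rintro ρ₁ o₁ n ⟨hI₁, hn⟩
      refine (ih (φ ρ₁) (by omega) hI₁ rfl).mono ?_
      rintro ρ₂ o₂ m ⟨hI₂, hf, hm⟩
      exact ⟨hI₂, hf, by omega⟩
    · exact wp_loop_false (hok _ _ hI) ht ⟨hI, ht, by omega⟩

end

end WordRAM

namespace DocumentListing

/-! ## Blind ternary search trees -/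

/-- A path-compressed ternary search tree over a list of strings: all strings below a node agree
on their first `d` characters and the `d`-th character is compared with the pivot `c`; `pre` holds
the strings of length at most `d` and `x` is some string below the node. -/
inductive PT (β : Type)
  | nil
  | node (d c : ℕ) (x : β) (pre : List β) (lt eq gt : PT β)

variable {β : Type}

def PT.ids : PT β → List β
  | .nil => []
  | .node _ _ _ pre lt eq gt => pre ++ (lt.ids ++ (eq.ids ++ gt.ids))

def PT.size : PT β → ℕ
  | .nil => 1
  | .node _ _ _ _ lt eq gt => 1 + lt.size + eq.size + gt.size

/-- The node reached by searching for `p`, with the number of strings before it. -/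
def PT.find (p : List ℕ) : PT β → ℕ → PT β × ℕ
  | .nil, lo => (.nil, lo)
  | .node d c x pre lt eq gt, lo =>
    if p.length ≤ d then (.node d c x pre lt eq gt, lo)
    else if p.getD d 0 < c then lt.find p (lo + pre.length)
    else if p.getD d 0 = c then eq.find p (lo + pre.length + lt.ids.length)
    else gt.find p (lo + pre.length + lt.ids.length + eq.ids.length)

/-- The length of the search path. -/
def PT.steps (p : List ℕ) : PT β → ℕ
  | .nil => 0
  | .node d c _ _ lt eq gt =>
    if p.length ≤ d then 0
    else if p.getD d 0 < c then lt.steps p + 1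
    else if p.getD d 0 = c then eq.steps p + 1
    else gt.steps p + 1

/-- Well-formed trees for strings `str` over the alphabet of numbers below `W`. -/
def PT.Valid (str : β → List ℕ) (W : ℕ) : PT β → Prop
  | .nil => True
  | .node d c x pre lt eq gt =>
    (x ∈ pre ++ (lt.ids ++ (eq.ids ++ gt.ids)) ∧ d ≤ (str x).length ∧ c < W) ∧
    (∀ y ∈ pre ++ (lt.ids ++ (eq.ids ++ gt.ids)), (str y).take d = (str x).take d) ∧
    (∀ y ∈ pre, (str y).length ≤ d) ∧
    (∀ y ∈ lt.ids, (str y).getD d 0 < c) ∧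
    (∀ y ∈ eq.ids, (str y).getD d 0 = c) ∧
    (∀ y ∈ gt.ids, c < (str y).getD d 0) ∧
    lt.Valid str W ∧ eq.Valid str W ∧ gt.Valid str W

theorem isPrefix_iff_of_take_eq {p s t : List ℕ} {d : ℕ} (hp : p.length ≤ d)
    (h : s.take d = t.take d) : p <+: s ↔ p <+: t := by
  have key : ∀ u : List ℕ, p <+: u ↔ p <+: u.take d := fun u => by
    rw [List.prefix_take_iff]; simp [hp]
  rw [key s, key t, h]

/-- A string that extends `p` has the same character as `p` at every branching depth below
`p.length`, so it takes the same branches. -/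
theorem PT.mem_find {str : β → List ℕ} {W : ℕ} {p : List ℕ} (t : PT β) (lo : ℕ)
    (hv : t.Valid str W) {x : β} (hx : x ∈ t.ids) (hp : p <+: str x) :
    x ∈ (t.find p lo).1.ids := by
  induction t generalizing lo with
  | nil => simpa [PT.find] using hx
  | node d c z pre lt eq gt ih₁ ih₂ ih₃ =>
    obtain ⟨-, -, h0, h1, h2, h3, v1, v2, v3⟩ := hv
    by_cases hd : p.length ≤ d
    · simpa [PT.find, hd] using hx
    · have hlen := hp.length_le
      have hg : (str x).getD d 0 = p.getD d 0 := by
        obtain ⟨u, hu⟩ := hp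
        rw [← hu, List.getD_append _ _ _ _ (by omega)]
      simp only [PT.ids, List.mem_append] at hx
      simp only [PT.find, hd, if_false]
      rw [← hg]
      rcases hx with hx | hx | hx | hx
      · exact absurd (h0 x hx) (by omega)
      · have := h1 x hx
        rw [if_pos this]; exact ih₁ _ v1 hx
      · have := h2 x hx
        rw [if_neg (by omega), if_pos this]; exact ih₂ _ v2 hx
      · have := h3 x hx
        rw [if_neg (by omega), if_neg (by omega)]; exact ih₃ _ v3 hx

/-- Each subtree contributes a contiguous segment to the list of all strings; this is what turns a
pattern into a range of ranks. -/
theorem PT.find_slice (p : List ℕ) (t : PT β) (lo : ℕ) :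
    ∃ u v, t.ids = u ++ ((t.find p lo).1.ids ++ v) ∧ (t.find p lo).2 = lo + u.length := by
  induction t generalizing lo with
  | nil => exact ⟨[], [], by simp [PT.find]⟩
  | node d c z pre lt eq gt ih₁ ih₂ ih₃ =>
    simp only [PT.find]
    split_ifs
    · exact ⟨[], [], by simp⟩
    · obtain ⟨u, v, h, h'⟩ := ih₁ (lo + pre.length)
      refine ⟨pre ++ u, v ++ (eq.ids ++ gt.ids), ?_, ?_⟩
      · rw [PT.ids]; conv_lhs => rw [h]
        simp
      · rw [h']; simp; omega
    · obtain ⟨u, v, h, h'⟩ := ih₂ (lo + pre.length + lt.ids.length)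
      refine ⟨pre ++ (lt.ids ++ u), v ++ gt.ids, ?_, ?_⟩
      · rw [PT.ids]; conv_lhs => rw [h]
        simp
      · rw [h']; simp; omega
    · obtain ⟨u, v, h, h'⟩ := ih₃ (lo + pre.length + lt.ids.length + eq.ids.length)
      refine ⟨pre ++ (lt.ids ++ (eq.ids ++ u)), v, ?_, ?_⟩
      · rw [PT.ids]; conv_lhs => rw [h]
        simp
      · rw [h']; simp; omega

/-- The node reached is empty, or its depth is at least the length of the pattern. -/
theorem PT.find_cases {str : β → List ℕ} {W : ℕ} {p : List ℕ} (t : PT β) (lo : ℕ)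
    (hv : t.Valid str W) : (t.find p lo).1 = .nil ∨ ∃ d c x pre lt eq gt,
      (t.find p lo).1 = .node d c x pre lt eq gt ∧ p.length ≤ d ∧
      x ∈ (t.find p lo).1.ids ∧
      ∀ y ∈ (t.find p lo).1.ids, (p <+: str y ↔ p <+: str x) := by
  induction t generalizing lo with
  | nil => exact .inl rfl
  | node d c z pre lt eq gt ih₁ ih₂ ih₃ =>
    obtain ⟨h, h', -, -, -, -, v1, v2, v3⟩ := hv
    simp only [PT.find]
    split_ifs with hd
    · exact .inr ⟨d, c, z, pre, lt, eq, gt, rfl, hd, h.1,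
        fun y hy => isPrefix_iff_of_take_eq hd (h' y hy)⟩
    · exact ih₁ _ v1
    · exact ih₂ _ v2
    · exact ih₃ _ v3

/-- `Nat.size` serves as the logarithmic potential, both for binary search and for the left and
right branches of the search tree. -/
theorem size_half {a b : ℕ} (h : 2 * a ≤ b) (hb : 0 < b) : Nat.size a + 1 ≤ Nat.size b := by
  have h1 : Nat.size a ≤ Nat.size b - 1 := by
    rw [Nat.size_le]
    have h2 : b < 2 ^ Nat.size b := Nat.lt_size_self b
    have h3 : 0 < Nat.size b := Nat.size_pos.2 hb
    have h4 : 2 ^ Nat.size b = 2 * 2 ^ (Nat.size b - 1) := by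
      rw [← pow_succ']; congr 1; omega
    omega
  have h3 : 0 < Nat.size b := Nat.size_pos.2 hb
  omega

/-- A pivot such that at most half of the keys lie strictly on either side. -/
theorem exists_pivot (f : β → ℕ) (W : ℕ) (hW : 0 < W) (Y : List β) (hf : ∀ y ∈ Y, f y < W) :
    ∃ c < W, 2 * (Y.filter fun y => f y < c).length ≤ Y.length ∧
      2 * (Y.filter fun y => c < f y).length ≤ Y.length := by
  classical
  -- The pivot is the median: the least value such that at least half of the keys do not exceed it.
  -- By minimality fewer than half of the keys lie below a positive pivot.
  have hex : ∃ c, Y.length ≤ 2 * (Y.filter fun y => f y ≤ c).length := by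
    refine ⟨W - 1, ?_⟩
    rw [List.filter_eq_self.2 (fun y hy => by have := hf y hy; simp; omega)]
    omega
  have hle : Nat.find hex ≤ W - 1 := by
    refine Nat.find_min' hex ?_
    rw [List.filter_eq_self.2 (fun y hy => by have := hf y hy; simp; omega)]
    omega
  have hmin : ∀ m < Nat.find hex, 2 * (Y.filter fun y => f y ≤ m).length < Y.length :=
    fun m hm => not_le.1 (Nat.find_min hex hm)
  have hspec := Nat.find_spec hex
  generalize Nat.find hex = c at hle hmin hspec
  refine ⟨c, by omega, ?_, ?_⟩
  · by_cases h0 : c = 0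
    · simp [h0]
    · have := hmin (c - 1) (by omega)
      have e : (Y.filter fun y => f y < c) = Y.filter fun y => f y ≤ c - 1 := by
        congr 1; funext y; congr 1; apply propext; omega
      rw [e]; omega
  · have h2 := (List.filter_append_perm (fun y => decide (f y ≤ c)) Y).length_eq
    have e : (Y.filter fun y => decide (c < f y)) = Y.filter fun y => !decide (f y ≤ c) := by
      congr 1; funext y
      by_cases h : f y ≤ c
      · simp [h]
      · simp [h, not_le.1 h]
    rw [List.length_append] at h2
    rw [e]; omega

/-- Every list of strings has a search tree of linear size in which searches are fast. -/
theorem PT.exists_tree (str : β → List ℕ) (W : ℕ) (hW : 0 < W) (hstr : ∀ x, ∀ a ∈ str x, a < W)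
    (n : ℕ) : ∀ (X : List β) (e : ℕ), X.length ≤ n →
      (∀ x ∈ X, ∀ y ∈ X, (str x).take e = (str y).take e) →
      ∃ t : PT β, t.Valid str W ∧ t.ids.Perm X ∧ t.size ≤ 6 * X.length + 1 ∧
        (X ≠ [] → t.size + 2 ≤ 6 * X.length) ∧
        ∀ p : List ℕ, t.steps p ≤ (p.length - e) + Nat.size X.length := by
  classical
  induction n with
  | zero =>
    intro X e hX _
    obtain rfl : X = [] := List.length_eq_zero_iff.1 (by omega)
    exact ⟨.nil, trivial, List.Perm.refl _, by simp [PT.size], by simp, by simp [PT.steps]⟩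
  | succ n ih =>
    intro X e hX he
    rcases X with _ | ⟨x, X'⟩
    · exact ⟨.nil, trivial, List.Perm.refl _, by simp [PT.size], by simp, by simp [PT.steps]⟩
    set X := x :: X' with hXdef
    have hxX : x ∈ X := by simp [hXdef]
    have hpos : 0 < X.length := List.length_pos_of_mem hxX
    have hspos : 0 < Nat.size X.length := Nat.size_pos.2 hpos
    by_cases hall : ∀ k : ℕ, ∀ y ∈ X, (str y)[k]? = (str x)[k]?
    · have hs : ∀ y ∈ X, str y = str x := fun y hy => List.ext_getElem? fun k => hall k y hy
      -- All strings coincide. With their length as depth they all go into `pre`, and the pivot 0 is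
      -- arbitrary.
      refine ⟨.node (str x).length 0 x X .nil .nil .nil, ?_, ?_, ?_, ?_, ?_⟩
      · simp only [PT.Valid, PT.ids, List.append_nil]
        exact ⟨⟨hxX, le_rfl, hW⟩, fun y hy => by rw [hs y hy], fun y hy => by rw [hs y hy],
          by simp, by simp, by simp, trivial, trivial, trivial⟩
      · simp [PT.ids]
      · simp only [PT.size]; omega
      · intro; simp only [PT.size]; omega
      · intro p
        simp only [PT.steps]
        split_ifs <;> omega
    · have hex : ∃ k : ℕ, ¬ ∀ y ∈ X, (str y)[k]? = (str x)[k]? := by simpa using hall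
      -- Path compression: the node branches at the first position where two of the strings differ.
      set d := Nat.find hex with hd
      have hdn := Nat.find_spec hex
      have hdlt : ∀ k < d, ∀ y ∈ X, (str y)[k]? = (str x)[k]? := fun k hk =>
        not_not.1 (Nat.find_min hex hk)
      have htake : ∀ y ∈ X, (str y).take d = (str x).take d := by
        intro y hy
        refine List.ext_getElem? fun k => ?_
        by_cases hk : k < d
        · simpa [List.getElem?_take, hk] using hdlt k hk y hy
        · simp [hk]
      have hed : e ≤ d := by
        by_contra hlt
        apply hdn
        intro y hy
        have := congrArg (fun l => l[d]?) (he y hy x hxX)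
        simp only [List.getElem?_take, show d < e by omega, if_true] at this
        exact this
      let f : β → ℕ := fun y => (str y).getD d 0
      set pre := X.filter (fun y => decide ((str y).length ≤ d)) with hpre
      set Y := X.filter (fun y => !decide ((str y).length ≤ d)) with hY
      have hYmem : ∀ y ∈ Y, y ∈ X ∧ d < (str y).length := fun y hy => by
        simpa [hY] using hy
      obtain ⟨c, hcW, hc1, hc2⟩ := exists_pivot f W hW Y (fun y hy => by
        have := (hYmem y hy).2
        simp only [f, List.getD_eq_getElem _ _ this]
        exact hstr y _ (List.getElem_mem _))
      set lt := Y.filter (fun y => decide (f y < c)) with hlt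
      set Z := Y.filter (fun y => !decide (f y < c)) with hZ
      set eq := Z.filter (fun y => decide (f y = c)) with heq
      set gt := Z.filter (fun y => !decide (f y = c)) with hgt
      have hgt' : gt = Y.filter (fun y => decide (c < f y)) := by
        rw [hgt, hZ, List.filter_filter]
        congr 1; funext y
        rcases lt_trichotomy (f y) c with h | h | h
        · simp [h, h.le]
        · simp [h]
        · simp [h, h.le, h.ne']
      have perm1 : (pre ++ Y).Perm X := List.filter_append_perm _ X
      have perm2 : (lt ++ Z).Perm Y := List.filter_append_perm _ Y
      have perm3 : (eq ++ gt).Perm Z := List.filter_append_perm _ Z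
      have l1 := perm1.length_eq
      have l2 := perm2.length_eq
      have l3 := perm3.length_eq
      rw [List.length_append] at l1 l2 l3
      rw [← hgt'] at hc2
      have subY : ∀ y ∈ Y, y ∈ X := fun y hy => (hYmem y hy).1
      have sublt : ∀ y ∈ lt, y ∈ Y := fun y hy => List.mem_of_mem_filter hy
      have subZ : ∀ y ∈ Z, y ∈ Y := fun y hy => List.mem_of_mem_filter hy
      have subeq : ∀ y ∈ eq, y ∈ Z := fun y hy => List.mem_of_mem_filter hy
      have subgt : ∀ y ∈ gt, y ∈ Z := fun y hy => List.mem_of_mem_filter hy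
      have feq : ∀ y ∈ eq, f y = c := fun y hy => by simpa using List.of_mem_filter hy
      have flt : ∀ y ∈ lt, f y < c := fun y hy => by simpa using List.of_mem_filter hy
      have fgt : ∀ y ∈ gt, c < f y := fun y hy => by
        rw [hgt'] at hy; simpa using List.of_mem_filter hy
      -- Otherwise all strings would have the character `c` at position `d`, against the choice of
      -- `d`.
      have heqlt : eq.length < X.length := by
        by_contra hge
        apply hdn
        have hnil : pre = [] := List.length_eq_zero_iff.1 (by omega)
        have hltnil : lt = [] := List.length_eq_zero_iff.1 (by omega)
        have hgtnil : gt = [] := List.length_eq_zero_iff.1 (by omega)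
        have key : ∀ y ∈ X, (str y)[d]? = some c := by
          intro y hy
          have h1 : y ∈ Y := by
            have := perm1.mem_iff.2 hy
            simpa [hnil] using this
          have h2 : y ∈ Z := by
            have := perm2.mem_iff.2 h1
            simpa [hltnil] using this
          have h3 : y ∈ eq := by
            have := perm3.mem_iff.2 h2
            simpa [hgtnil] using this
          have h4 := feq y h3
          have h5 := (hYmem y h1).2
          simp only [f, List.getD_eq_getElem _ _ h5] at h4
          rw [List.getElem?_eq_getElem h5, h4]
        intro y hy
        rw [key y hy, key x hxX]
      have hprelt : pre.length < X.length := by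
        by_contra hge
        apply hdn
        have hnil : Y = [] := List.length_eq_zero_iff.1 (by omega)
        have key : ∀ y ∈ X, (str y)[d]? = none := by
          intro y hy
          have h1 : y ∈ pre := by
            have := perm1.mem_iff.2 hy
            simpa [hnil] using this
          have : (str y).length ≤ d := by simpa using List.of_mem_filter h1
          simpa using this
        intro y hy
        rw [key y hy, key x hxX]
      -- The outer branches keep `e` and are paid for by halving. The middle branch may raise `e` to
      -- `d + 1`, as its strings agree at position `d` too, and is paid for by a character of the
      -- pattern.
      obtain ⟨t1, v1, p1, s1, s1', st1⟩ := ih lt e (by omega)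
        (fun y hy z hz => he y (subY y (sublt y hy)) z (subY z (sublt z hz)))
      obtain ⟨t3, v3, p3, s3, s3', st3⟩ := ih gt e (by omega)
        (fun y hy z hz => he y (subY y (subZ y (subgt y hy))) z (subY z (subZ z (subgt z hz))))
      obtain ⟨t2, v2, p2, s2, s2', st2⟩ := ih eq (d + 1) (by omega) (by
        intro y hy z hz
        have hy1 := hYmem y (subZ y (subeq y hy))
        have hz1 := hYmem z (subZ z (subeq z hz))
        rw [List.take_add_one, List.take_add_one, htake y hy1.1, htake z hz1.1]
        have e1 := feq y hy
        have e2 := feq z hz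
        simp only [f, List.getD_eq_getElem _ _ hy1.2] at e1
        simp only [f, List.getD_eq_getElem _ _ hz1.2] at e2
        rw [List.getElem?_eq_getElem hy1.2, List.getElem?_eq_getElem hz1.2, e1, e2])
      have permX : (pre ++ (t1.ids ++ (t2.ids ++ t3.ids))).Perm X := by
        refine (List.Perm.append_left pre ?_).trans perm1
        refine (p1.append ?_).trans perm2
        exact (p2.append p3).trans perm3
      have hxd : d ≤ (str x).length := by
        by_contra hlt
        apply hdn
        have key : ∀ y ∈ X, (str y)[d]? = none := by
          intro y hy
          have h1 := congrArg List.length (htake y hy)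
          rw [List.length_take, List.length_take] at h1
          simp; omega
        intro y hy
        rw [key y hy, key x hxX]
      refine ⟨.node d c x pre t1 t2 t3, ?_, permX, ?_, ?_, ?_⟩
      · refine ⟨⟨permX.mem_iff.2 hxX, hxd, hcW⟩, fun y hy => htake y (permX.mem_iff.1 hy), ?_,
          fun y hy => flt y (p1.mem_iff.1 hy), fun y hy => feq y (p2.mem_iff.1 hy),
          fun y hy => fgt y (p3.mem_iff.1 hy), v1, v2, v3⟩
        intro y hy
        simpa using List.of_mem_filter hy
      -- A nonempty list yields size at most `6 * length - 2`, an empty one size 1. The reserve of 2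
      -- per nonempty subtree and the fact that each part is strictly smaller than `X` pay for the
      -- node and its empty subtrees.
      all_goals
        have z1 : lt.length = 0 ∨ t1.size + 2 ≤ 6 * lt.length := by
          by_cases h : lt = []
          · left; rw [h]; rfl
          · right; exact s1' h
        have z2 : eq.length = 0 ∨ t2.size + 2 ≤ 6 * eq.length := by
          by_cases h : eq = []
          · left; rw [h]; rfl
          · right; exact s2' h
        have z3 : gt.length = 0 ∨ t3.size + 2 ≤ 6 * gt.length := by
          by_cases h : gt = []
          · left; rw [h]; rfl
          · right; exact s3' h
      · simp only [PT.size]; omega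
      · intro _; simp only [PT.size]; omega
      · intro p
        simp only [PT.steps]
        have q1 := st1 p
        have q2 := st2 p
        have q3 := st3 p
        have g1 := size_half (show 2 * lt.length ≤ X.length by omega) hpos
        have g3 := size_half (show 2 * gt.length ≤ X.length by omega) hpos
        have g2 := Nat.size_le_size heqlt.le
        split_ifs <;> omega

/-- The strings below the node reached are those with prefix `p`, or there is no such string. -/
theorem PT.find_range {str : β → List ℕ} {W : ℕ} {p : List ℕ} (t : PT β) (hv : t.Valid str W)
    (hnd : t.ids.Nodup) (i : ℕ) (hi : i < t.ids.length)
    (hne : ∃ y ∈ (t.find p 0).1.ids, p <+: str y) :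
    (t.find p 0).2 ≤ i ∧ i < (t.find p 0).2 + (t.find p 0).1.ids.length ↔
      p <+: str t.ids[i] := by
  have hmem : p <+: str t.ids[i] ↔ t.ids[i] ∈ (t.find p 0).1.ids := by
    refine ⟨fun h => PT.mem_find t 0 hv (List.getElem_mem _) h, fun h => ?_⟩
    obtain ⟨y, hy, hpy⟩ := hne
    rcases PT.find_cases (p := p) t 0 hv with h0 | ⟨d, c, x, pre, lt, eq, gt, -, -, -, hall⟩
    · rw [h0] at hy; simp [PT.ids] at hy
    · exact (hall _ h).2 ((hall _ hy).1 hpy)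
  rw [hmem]
  obtain ⟨u, v, h, h'⟩ := PT.find_slice p t 0
  rw [h']
  generalize (t.find p 0).1.ids = m at *
  generalize t.ids = l at *
  subst h
  constructor
  · rintro ⟨h1, h2⟩
    rw [List.getElem_append_right (by omega), List.getElem_append_left (by omega)]
    exact List.getElem_mem _
  · intro hx
    obtain ⟨k, hk, hk'⟩ := List.getElem_of_mem hx
    have : (u ++ (m ++ v))[u.length + k]'(by simp; omega) = (u ++ (m ++ v))[i] := by
      rw [← hk', List.getElem_append_right (by omega)]
      simp [List.getElem_append_left, hk]
    have := (List.Nodup.getElem_inj_iff hnd).1 this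
    omega

theorem PT.find_nil_range {str : β → List ℕ} {W : ℕ} {p : List ℕ} (t : PT β)
    (hv : t.Valid str W) (i : ℕ) (hi : i < t.ids.length)
    (hne : ¬ ∃ y ∈ (t.find p 0).1.ids, p <+: str y) : ¬ p <+: str t.ids[i] := fun h =>
  hne ⟨_, PT.mem_find t 0 hv (List.getElem_mem _) h, h⟩

end DocumentListing

namespace WordRAM
open Cmd DocumentListing

/-! ## Programs -/

/-- Number of entries smaller than register 102 in the sorted segment of array 0 that starts at
register 100 and has the length in register 101; the result is in register 103. -/
def lowerBound : Cmd := block [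
  .set 103 (.lit 0),
  .set 104 (.reg 101),
  .loop (.lt (.reg 103) (.reg 104)) (block [
    .set 105 (.quo (.sum (.reg 103) (.reg 104)) (.lit 2)),
    .ite (.lt (.arr 0 (.sum (.reg 100) (.reg 105))) (.reg 102))
      (.set 103 (.sum (.reg 105) (.lit 1)))
      (.set 104 (.reg 105))])]

/-- Sortedness enters only through `hlt`: the entries below the key are exactly the first `k`. The
loop keeps `k` between registers 103 and 104, and `Nat.size` of the gap drops in each round. -/
theorem wp_lowerBound {Γ : Ctx} {ρ : ℕ → ℕ} {o : List ℕ} (hL : 32 * Γ.L ≤ 2 ^ Γ.w)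
    (h32 : 32 < 2 ^ Γ.w) {k : ℕ} (hk : k ≤ ρ 101) (hr : ρ 100 + ρ 101 ≤ Γ.L)
    (hlt : ∀ i < ρ 101, Γ.A 0 (ρ 100 + i) < ρ 102 ↔ i < k) :
    Wp Γ lowerBound ρ o fun ρ' o' n => o' = o ∧ ρ' 103 = k ∧ (∀ j < 103, ρ' j = ρ j) ∧
      n ≤ 4 * Nat.size (ρ 101) + 3 := by
  simp only [lowerBound, wp_block_cons, wp_block_singleton, wp_set, Ex.Ok, Ex.val]
  refine ⟨by omega, trivial, ?_⟩
  refine (wp_loop (fun ρ' o' => o' = o ∧ (∀ j < 103, ρ' j = ρ j) ∧ ρ' 103 ≤ k ∧ k ≤ ρ' 104 ∧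
    ρ' 104 ≤ ρ 101) (fun ρ' => 4 * Nat.size (ρ' 104 - ρ' 103)) ?_ ?_ ?_).mono ?_
  · refine ⟨rfl, fun j hj => ?_, ?_, ?_, ?_⟩
    · simp [show j ≠ 103 by omega, show j ≠ 104 by omega]
    all_goals simp [hk]
  · intro ρ' o' _; simp [Cond.Ok, Ex.Ok]
  · rintro ρ' o' ⟨rfl, hf, h1, h2, h3⟩ hc
    simp only [Cond.Holds, Ex.val] at hc
    simp only [wp_block_cons, wp_block_singleton, wp_set, wp_ite, Ex.Ok, Ex.val, Cond.Ok,
      Cond.Holds]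
    have hd := Nat.div_mul_le_self (ρ' 103 + ρ' 104) 2
    have hm := hlt ((ρ' 103 + ρ' 104) / 2) (by omega)
    simp only [Function.update_apply]
    simp [hf]
    have hw : Γ.w ≠ 0 := fun h => by simp [h] at h32
    refine ⟨⟨by omega, by omega⟩, ⟨by omega, by omega⟩, ?_, ?_⟩
    · intro hA
      rw [hm] at hA
      refine ⟨⟨hw, by omega⟩, ⟨?_, by omega, by omega, by omega⟩, ?_⟩
      · intro j hj
        simp [show j ≠ 103 by omega, show j ≠ 105 by omega, hf j hj]
      · have := size_half (a := ρ' 104 - ((ρ' 103 + ρ' 104) / 2 + 1)) (b := ρ' 104 - ρ' 103)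
          (by omega) (by omega)
        omega
    · intro hA
      rw [← not_lt, hm] at hA
      refine ⟨⟨?_, by omega, by omega⟩, ?_⟩
      · intro j hj
        simp [show j ≠ 104 by omega, show j ≠ 105 by omega, hf j hj]
      · have := size_half (a := (ρ' 103 + ρ' 104) / 2 - ρ' 103) (b := ρ' 104 - ρ' 103)
          (by omega) (by omega)
        omega
  · rintro ρ' o' n ⟨⟨rfl, hf, h1, h2, h3⟩, hc, hn⟩
    simp only [Cond.Holds, Ex.val] at hc
    simp at hn
    exact ⟨rfl, by omega, hf, by omega⟩

end WordRAM

namespace DocumentListing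

/-! ## The document tree

A complete binary tree with `2 ^ H` leaves, numbered as a heap; `lf r` is the leaf of the document
to which the suffix of rank `r` belongs. -/

/-- Height of node `v`. -/
def ht (H v : ℕ) : ℕ := H - Nat.log 2 v

/-- Leaf `y` lies below node `v`. -/
def Under (H v y : ℕ) : Prop := y / 2 ^ ht H v = v

instance (H v y : ℕ) : Decidable (Under H v y) := by unfold Under; infer_instance

variable (H : ℕ) (lf : ℕ → ℕ)

/-- Number of suffixes of rank less than `x` below node `v`. -/
def cnt (v x : ℕ) : ℕ := Nat.count (fun r => Under H v (lf r)) x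

/-- The `i`-th rank below node `v`. -/
noncomputable def rk (v i : ℕ) : ℕ := Nat.nth (fun r => Under H v (lf r)) i

/-- Block size at a node with `n` suffixes. -/
def bs (n : ℕ) : ℕ := Nat.sqrt n + 1

/-- Blocks `j` and `e` of a node with `n` suffixes have a document in common. -/
def Share (v n j e : ℕ) : Prop :=
  ∃ x y, x / bs n = j ∧ y / bs n = e ∧ x < n ∧ y < n ∧ lf (rk H lf v x) = lf (rk H lf v y)

/-- The block that contains `x` lies within `[a, b)`. -/
def Full (B a b x : ℕ) : Prop := a ≤ x / B * B ∧ x / B * B + B ≤ b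

variable {H lf}

/-- Side condition of the `Nat.nth` lemmas, since `Nat.nth` takes a default value beyond the last
element of a finite set. -/
theorem rk_card {v i N : ℕ} (h : i < cnt H lf v N)
    (hf : (Set.ofPred fun r => Under H v (lf r)).Finite) : i < hf.toFinset.card :=
  lt_of_lt_of_le h (Nat.count_le_card hf N)

theorem rk_lt {v i x : ℕ} (h : i < cnt H lf v x) : rk H lf v i < x :=
  Nat.nth_lt_of_lt_count h

theorem under_rk {v i N : ℕ} (h : i < cnt H lf v N) : Under H v (lf (rk H lf v i)) :=
  Nat.nth_mem i (rk_card h)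

/-- Counting and enumerating are adjoint. This is the sortedness that binary search in the list of a
node needs. -/
theorem rk_lt_iff {v i N x : ℕ} (h : i < cnt H lf v N) : rk H lf v i < x ↔ i < cnt H lf v x := by
  refine ⟨fun hx => ?_, rk_lt⟩
  have h1 := Nat.count_nth_succ (p := fun r => Under H v (lf r)) (rk_card h)
  have h2 : Nat.count (fun r => Under H v (lf r)) (rk H lf v i + 1) ≤ cnt H lf v x :=
    Nat.count_monotone _ hx
  rw [rk] at h2
  omega

theorem cnt_mono {v x y : ℕ} (h : x ≤ y) : cnt H lf v x ≤ cnt H lf v y := Nat.count_monotone _ h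

theorem cnt_le {v x : ℕ} : cnt H lf v x ≤ x := Nat.count_le _

theorem rk_cnt {v x : ℕ} (h : Under H v (lf x)) : rk H lf v (cnt H lf v x) = x :=
  Nat.nth_count (p := fun r => Under H v (lf r)) h

theorem cnt_lt_cnt {v x r : ℕ} (h : Under H v (lf x)) (hr : x < r) :
    cnt H lf v x < cnt H lf v r := Nat.count_strict_mono h hr

/-- Positions in the list of `v` between `cnt v l` and `cnt v r` are ranks in `[l, r)`. -/
theorem exists_rk_iff {v l r N : ℕ} (hr : r ≤ N) (g : ℕ → Prop) :
    (∃ i, cnt H lf v l ≤ i ∧ i < cnt H lf v r ∧ g (rk H lf v i)) ↔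
      ∃ x, l ≤ x ∧ x < r ∧ Under H v (lf x) ∧ g x := by
  constructor
  · rintro ⟨i, h1, h2, h3⟩
    have hN := lt_of_lt_of_le h2 (cnt_mono hr)
    refine ⟨_, ?_, rk_lt h2, under_rk hN, h3⟩
    by_contra hlt
    have := (rk_lt_iff hN).1 (not_le.1 hlt)
    omega
  · rintro ⟨x, h1, h2, h3, h4⟩
    exact ⟨_, cnt_mono h1, cnt_lt_cnt h3 h2, by rwa [rk_cnt h3]⟩

theorem cnt_lt_cnt_iff {v l r : ℕ} :
    cnt H lf v l < cnt H lf v r ↔ ∃ x, l ≤ x ∧ x < r ∧ Under H v (lf x) := by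
  have := exists_rk_iff (H := H) (lf := lf) (v := v) (l := l) (le_refl r) (fun _ => True)
  simp only [and_true] at this
  rw [← this]
  exact ⟨fun h => ⟨_, le_rfl, h⟩, fun ⟨i, h1, h2⟩ => by omega⟩

theorem ht_leaf {y : ℕ} (h : 2 ^ H ≤ y) : ht H y = 0 := by
  have := Nat.le_log_of_pow_le (by norm_num) h
  unfold ht; omega

theorem under_leaf {y z : ℕ} (h : 2 ^ H ≤ y) : Under H y z ↔ z = y := by
  simp [Under, ht_leaf h]

theorem bs_pos (n : ℕ) : 0 < bs n := Nat.succ_pos _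

/-- The `+ 1` in `bs` makes this strict, so every position lies in one of the blocks numbered below
`bs n`. -/
theorem lt_bs_sq (n : ℕ) : n < bs n * bs n := Nat.lt_succ_sqrt n

theorem bs_le (n : ℕ) : bs n ≤ n + 1 := by
  have := Nat.sqrt_le_self n
  unfold bs; omega

/-- Number of steps that a scan from `i` to `b` with block length `B` may still take. -/
def scanSteps (B b i : ℕ) : ℕ :=
  if b - i < B then b - i else (b - i) / B + B + (if i % B = 0 then 0 else B - i % B)

theorem scanSteps_self {B : ℕ} (hB : 0 < B) (b : ℕ) : scanSteps B b b = 0 := by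
  simp [scanSteps, hB]

theorem scanSteps_pos {B b i : ℕ} (hB : 0 < B) (h : i < b) : 1 ≤ scanSteps B b i := by
  unfold scanSteps
  generalize (b - i) / B = q
  split_ifs <;> omega

theorem scanSteps_block {B b i : ℕ} (hB : 0 < B) (h : i + B ≤ b) :
    scanSteps B b (i + B) + 1 ≤ scanSteps B b i := by
  have h1 : (b - i) / B = (b - (i + B)) / B + 1 := by
    rw [← Nat.add_div_right _ hB]; congr 1; omega
  unfold scanSteps
  rw [if_neg (show ¬ b - i < B by omega), Nat.add_mod_right, h1]
  generalize (b - (i + B)) / B = q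
  generalize (if i % B = 0 then 0 else B - i % B) = m
  split_ifs <;> omega

/-- A single step happens before the next block boundary, where the distance to it shrinks, or in
the last stretch shorter than a block. Hence only O(B) of them occur. -/
theorem scanSteps_single {B b i : ℕ} (hB : 0 < B) (hi : i < b) (h : ¬ (i % B = 0 ∧ i + B ≤ b)) :
    scanSteps B b (i + 1) + 1 ≤ scanSteps B b i := by
  have hlt := Nat.mod_lt i hB
  have hmod : (i + 1) % B = if i % B + 1 = B then 0 else i % B + 1 := by
    rw [← Nat.mod_add_mod]
    split_ifs with h0
    · rw [h0, Nat.mod_self]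
    · exact Nat.mod_eq_of_lt (by omega)
  have hdiv : (b - (i + 1)) / B ≤ (b - i) / B := Nat.div_le_div_right (by omega)
  unfold scanSteps
  rw [hmod]
  generalize (b - (i + 1)) / B = q' at *
  generalize (b - i) / B = q at *
  by_cases h1 : b - i < B
  · rw [if_pos h1, if_pos (by omega)]; omega
  · rw [if_neg h1]
    have h2 : i % B ≠ 0 := fun h0 => h ⟨h0, by omega⟩
    rw [if_neg h2]
    split_ifs <;> omega

theorem scanSteps_le {B b i n : ℕ} (hb : b ≤ n) (hn : n < B * B) : scanSteps B b i ≤ 3 * B := by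
  have h1 : (b - i) / B < B := Nat.div_lt_of_lt_mul (by omega)
  unfold scanSteps
  generalize (b - i) / B = q at *
  split_ifs <;> omega

/-- Next node in preorder after the subtree of `v`; `0` after the last one. -/
def skipNode (v : ℕ) : ℕ :=
  if v ≤ 1 then 0 else if v % 2 = 0 then v + 1 else skipNode (v / 2)
decreasing_by omega

end DocumentListing

/-! ### Arrays of the document tree and ranges at a node -/

namespace WordRAM
open Cmd DocumentListing

/-- The arrays hold the document tree for `N` suffixes. -/
structure TreeOk (Γ : Ctx) (N H : ℕ) (lf : ℕ → ℕ) : Prop where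
  h32 : 32 < 2 ^ Γ.w
  hL : 32 * Γ.L ≤ 2 ^ Γ.w
  N_le : N ≤ Γ.L
  H_le : 2 ^ (H + 1) ≤ Γ.L
  two_le : 2 ≤ Γ.L
  lf_mem : ∀ r < N, 2 ^ H ≤ lf r ∧ lf r < 2 ^ (H + 1)
  off : ∀ v, 1 ≤ v → v < 2 ^ (H + 1) → Γ.A 1 v + cnt H lf v N ≤ Γ.L
  rank : ∀ v, 1 ≤ v → v < 2 ^ (H + 1) → ∀ i < cnt H lf v N, Γ.A 0 (Γ.A 1 v + i) = rk H lf v i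
  len : ∀ v, 1 ≤ v → v < 2 ^ (H + 1) → Γ.A 2 v = cnt H lf v N
  bsz : ∀ v, 1 ≤ v → v < 2 ^ (H + 1) → Γ.A 3 v = bs (cnt H lf v N)
  toff : ∀ v, 1 ≤ v → v < 2 ^ (H + 1) → Γ.A 4 v + (bs (cnt H lf v N) + 1) ^ 2 ≤ Γ.L
  tab : ∀ v, 1 ≤ v → v < 2 ^ (H + 1) → ∀ j j' b, j < bs (cnt H lf v N) + 1 →
    j' < bs (cnt H lf v N) + 1 → b ≤ cnt H lf v N →
    (Γ.A 5 (Γ.A 4 v + (j * (bs (cnt H lf v N) + 1) + j')) ≤ b ↔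
      ∃ e, j' ≤ e ∧ e * bs (cnt H lf v N) + bs (cnt H lf v N) ≤ b ∧
        Share H lf v (cnt H lf v N) j e)
  leaf : ∀ r < N, Γ.A 6 r = lf r
  skip : ∀ v, 1 ≤ v → v < 2 ^ (H + 1) → Γ.A 7 v = skipNode v
  cst : Γ.A 9 1 = 2 ^ H

variable {Γ : Ctx} {N H : ℕ} {lf : ℕ → ℕ} {ρ : ℕ → ℕ} {o : List ℕ}

theorem TreeOk.w_ne (T : TreeOk Γ N H lf) : Γ.w ≠ 0 := fun h => by
  have := T.h32
  simp [h] at this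

/-- The range of positions in the list of node 80 of the ranks between registers 81 and 82; the
result is in registers 83 and 84. -/
def countRange : Cmd := block [
  .set 100 (.arr 1 (.reg 80)),
  .set 101 (.arr 2 (.reg 80)),
  .set 102 (.reg 81),
  lowerBound,
  .set 83 (.reg 103),
  .set 102 (.reg 82),
  lowerBound,
  .set 84 (.reg 103)]

theorem wp_countRange (T : TreeOk Γ N H lf) (h1 : 1 ≤ ρ 80) (h2 : ρ 80 < 2 ^ (H + 1))
    (hl : ρ 81 ≤ N) (hr : ρ 82 ≤ N) :
    Wp Γ countRange ρ o fun ρ' o' n => o' = o ∧ ρ' 83 = cnt H lf (ρ 80) (ρ 81) ∧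
      ρ' 84 = cnt H lf (ρ 80) (ρ 82) ∧ (∀ j < 83, ρ' j = ρ j) ∧ n ≤ 8 * Nat.size N + 12 := by
  have hw := T.w_ne
  have hH := T.H_le
  have e1 := T.len _ h1 h2
  have e2 := T.off _ h1 h2
  have e3 : Nat.size (cnt H lf (ρ 80) N) ≤ Nat.size N := Nat.size_le_size cnt_le
  simp only [countRange, wp_block_cons, wp_block_singleton, wp_set, Ex.Ok, Ex.val]
  refine ⟨⟨by norm_num, trivial, by omega⟩, ⟨by norm_num, trivial, by simp; omega⟩, trivial, ?_⟩
  refine (wp_lowerBound T.hL T.h32 (k := cnt H lf (ρ 80) (ρ 81)) ?_ ?_ ?_).mono ?_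
  · simpa [e1] using cnt_mono hl
  · simpa [e1] using e2
  · simp only [Function.update_apply]
    simp [e1]
    intro i hi
    rw [T.rank _ h1 h2 i hi, rk_lt_iff hi]
  rintro ρ₁ o₁ n₁ ⟨rfl, r₁, f₁, b₁⟩
  simp [e1] at b₁
  refine ⟨trivial, trivial, ?_⟩
  refine (wp_lowerBound T.hL T.h32 (k := cnt H lf (ρ 80) (ρ 82)) ?_ ?_ ?_).mono ?_
  · simpa [f₁, e1] using cnt_mono hr
  · simpa [f₁, e1] using e2
  · simp only [Function.update_apply]
    simp [f₁, e1]
    intro i hi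
    rw [T.rank _ h1 h2 i hi, rk_lt_iff hi]
  rintro ρ₂ o₂ n₂ ⟨rfl, r₂, f₂, b₂⟩
  simp [f₁, e1] at b₂
  refine ⟨trivial, rfl, ?_, ?_, ?_, ?_⟩
  · simp [f₂, r₁]
  · simp [r₂]
  · intro j hj
    rw [Function.update_of_ne (by omega), f₂ j (by omega), Function.update_of_ne (by omega),
      Function.update_of_ne (by omega), f₁ j (by omega), Function.update_of_ne (by omega),
      Function.update_of_ne (by omega), Function.update_of_ne (by omega)]
  · omega

end WordRAM

/-! ### Deciding whether a node has a document in both ranges -/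

namespace DocumentListing

/-- Some document occurs both at a position in `[a, b)` and at one in `[a', b')`. -/
def Meet (H : ℕ) (lf : ℕ → ℕ) (v a b a' b' : ℕ) : Prop :=
  ∃ x, a ≤ x ∧ x < b ∧ ∃ y, a' ≤ y ∧ y < b' ∧ lf (rk H lf v x) = lf (rk H lf v y)

/-- What a scan of the positions from `i` to `k` without success tells. -/
def Clear (H : ℕ) (lf : ℕ → ℕ) (v B a b a' b' i k : ℕ) : Prop :=
  ∀ x, i ≤ x → x < k → ∀ y, a' ≤ y → y < b' → lf (rk H lf v x) = lf (rk H lf v y) →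
    Full B a b x ∧ ¬ Full B a' b' y

theorem le_of_eq_div {B x e : ℕ} (hB : 0 < B) (h : x / B = e) : e * B ≤ x ∧ x < e * B + B := by
  subst h
  have h1 := Nat.div_add_mod x B
  have h2 := Nat.mod_lt x hB
  rw [Nat.mul_comm] at h1
  omega

/-- `(a' + bs n - 1) / bs n` is the first block that starts at or after `a'`. If no full block of
the second range from there on shares a document with the current block, then a partner of a
position in it can only lie in a partial block. -/
theorem clear_block {H : ℕ} {lf : ℕ → ℕ} {v n a b a' b' i : ℕ} (ha : a ≤ i) (hn : b ≤ n)
    (hn' : b' ≤ n) (hi : i % bs n = 0) (hb : i + bs n ≤ b)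
    (h : ¬ ∃ e, (a' + bs n - 1) / bs n ≤ e ∧ e * bs n + bs n ≤ b' ∧ Share H lf v n (i / bs n) e) :
    Clear H lf v (bs n) a b a' b' i (i + bs n) := by
  intro x h1 h2 y h3 h4 h5
  have hB := bs_pos n
  have hi' : i / bs n * bs n = i := Nat.div_mul_cancel (Nat.dvd_of_mod_eq_zero hi)
  have hx : x / bs n = i / bs n := by
    apply Nat.div_eq_of_lt_le
    · rw [hi']; omega
    · rw [Nat.add_mul, hi']; omega
  refine ⟨⟨by rw [hx]; omega, by rw [hx]; omega⟩, fun hf => h ⟨y / bs n, ?_, hf.2, ?_⟩⟩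
  · rw [Nat.div_le_iff_le_mul_add_pred hB, Nat.mul_comm]
    have := hf.1
    omega
  · exact ⟨x, y, hx, rfl, by omega, by omega, h5⟩

/-- There are no false alarms: both blocks lie entirely inside their ranges, so whichever positions
witness the table entry belong to the ranges. -/
theorem meet_block {H : ℕ} {lf : ℕ → ℕ} {v n a b a' b' i : ℕ} (ha : a ≤ i)
    (hi : i % bs n = 0) (hb : i + bs n ≤ b)
    (h : ∃ e, (a' + bs n - 1) / bs n ≤ e ∧ e * bs n + bs n ≤ b' ∧ Share H lf v n (i / bs n) e) :
    Meet H lf v a b a' b' := by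
  obtain ⟨e, h1, h2, x, y, hx, hy, -, -, h5⟩ := h
  have hB := bs_pos n
  have hi' : i / bs n * bs n = i := Nat.div_mul_cancel (Nat.dvd_of_mod_eq_zero hi)
  rw [Nat.div_le_iff_le_mul_add_pred hB, Nat.mul_comm] at h1
  have h3 := le_of_eq_div hB hx
  have h4 := le_of_eq_div hB hy
  exact ⟨x, by omega, by omega, y, by omega, by omega, h5⟩

end DocumentListing

namespace WordRAM
open Cmd DocumentListing

variable {Γ : Ctx} {N H : ℕ} {lf : ℕ → ℕ} {ρ : ℕ → ℕ} {o : List ℕ}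

/-- Step of `scan` at a full block. -/
def scanBlock : Cmd :=
  .ite (.le (.arr 5 (.sum (.arr 4 (.reg 6)) (.sum
      (.prd (.quo (.reg 66) (.reg 55)) (.sum (.reg 55) (.lit 1)))
      (.quo (.dif (.sum (.reg 62) (.reg 55)) (.lit 1)) (.reg 55))))) (.reg 63))
    (block [.set 50 (.lit 1), .set 66 (.reg 61)])
    (.set 66 (.sum (.reg 66) (.reg 55)))

/-- Step of `scan` at a single position. -/
def scanSingle : Cmd := block [
  .set 80 (.arr 6 (.arr 0 (.sum (.arr 1 (.reg 6)) (.reg 66)))),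
  .set 81 (.reg 64),
  .set 82 (.reg 65),
  countRange,
  .ite (.lt (.reg 83) (.reg 84))
    (block [.set 50 (.lit 1), .set 66 (.reg 61)])
    (.set 66 (.sum (.reg 66) (.lit 1)))]

/-- Register 67 holds the conjunction of "at a block boundary" and "the block fits", as conditions
have no connectives. -/
def scanStep : Cmd := block [
  .set 67 (.lit 0),
  .ite (.eq (.rem (.reg 66) (.reg 55)) (.lit 0))
    (.ite (.le (.sum (.reg 66) (.reg 55)) (.reg 61)) (.set 67 (.lit 1)) .skip) .skip,
  .ite (.eq (.reg 67) (.lit 1)) scanBlock scanSingle]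

/-- Search for a document in the positions `[60, 61)` and `[62, 63)` of node 6. -/
def scan : Cmd := block [
  .set 66 (.reg 60),
  .loop (.lt (.reg 66) (.reg 61)) scanStep]

/-- Register contents before a scan of node 6. -/
structure ScanPre (N H : ℕ) (lf : ℕ → ℕ) (ρ : ℕ → ℕ) : Prop where
  pos : 1 ≤ ρ 6
  lt : ρ 6 < 2 ^ (H + 1)
  bsz : ρ 55 = bs (cnt H lf (ρ 6) N)
  l_le : ρ 64 ≤ N
  r_le : ρ 65 ≤ N
  b_le : ρ 61 ≤ cnt H lf (ρ 6) N
  a'_eq : ρ 62 = cnt H lf (ρ 6) (ρ 64)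
  b'_eq : ρ 63 = cnt H lf (ρ 6) (ρ 65)

/-- Effect of a step of a scan. -/
def ScanPost (H : ℕ) (lf : ℕ → ℕ) (D a : ℕ) (ρ : ℕ → ℕ) (o : List ℕ) (ρ' : ℕ → ℕ) (o' : List ℕ)
    (n : ℕ) : Prop :=
  o' = o ∧ (∀ j < 66, j ≠ 50 → ρ' j = ρ j) ∧ n ≤ D ∧
    ((ρ' 50 = 1 ∧ ρ' 66 = ρ 61 ∧ Meet H lf (ρ 6) a (ρ 61) (ρ 62) (ρ 63)) ∨
      (ρ' 50 = ρ 50 ∧ ρ 66 ≤ ρ' 66 ∧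
        scanSteps (ρ 55) (ρ 61) (ρ' 66) + 1 ≤ scanSteps (ρ 55) (ρ 61) (ρ 66) ∧
        Clear H lf (ρ 6) (ρ 55) a (ρ 61) (ρ 62) (ρ 63) (ρ 66) (ρ' 66)))

theorem wp_scanBlock (T : TreeOk Γ N H lf) (S : ScanPre N H lf ρ) {a : ℕ} (ha : a ≤ ρ 66)
    (hi : ρ 66 % ρ 55 = 0) (hib : ρ 66 + ρ 55 ≤ ρ 61) :
    Wp Γ scanBlock ρ o (ScanPost H lf 3 a ρ o) := by
  have hw := T.w_ne
  have hL := T.hL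
  have hNL := T.N_le
  have h2L := T.two_le
  have hHL := T.H_le
  obtain ⟨h1, h2, hB, hl, hr, hb, ha', hb'⟩ := S
  have hnN : cnt H lf (ρ 6) N ≤ N := cnt_le
  have htoff := T.toff _ h1 h2
  have htab := T.tab _ h1 h2
  have ha'n : ρ 62 ≤ cnt H lf (ρ 6) N := ha' ▸ cnt_mono hl
  have hb'n : ρ 63 ≤ cnt H lf (ρ 6) N := hb' ▸ cnt_mono hr
  have hBp : 0 < bs (cnt H lf (ρ 6) N) := bs_pos _
  have hBle : bs (cnt H lf (ρ 6) N) ≤ N + 1 := (bs_le _).trans (by omega)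
  have hBsq : cnt H lf (ρ 6) N < bs (cnt H lf (ρ 6) N) * bs (cnt H lf (ρ 6) N) := lt_bs_sq _
  rw [hB] at hi hib
  have cb := @clear_block H lf (ρ 6) (cnt H lf (ρ 6) N) a (ρ 61) (ρ 62) (ρ 63) (ρ 66) ha hb hb'n
    hi hib
  have mb := @meet_block H lf (ρ 6) (cnt H lf (ρ 6) N) a (ρ 61) (ρ 62) (ρ 63) (ρ 66) ha hi hib
  have hst := scanSteps_block hBp hib
  simp only [scanBlock, wp_ite, wp_block_cons, wp_block_singleton, wp_set, Ex.Ok, Ex.val,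
    Cond.Ok, Cond.Holds, hB, ScanPost]
  generalize bs (cnt H lf (ρ 6) N) = B at *
  have hj : ρ 66 / B < B := Nat.div_lt_of_lt_mul (by omega)
  -- Rounding up can give `B` itself, hence tables with `B + 1` rows and columns.
  have hj' : (ρ 62 + B - 1) / B < B + 1 := by
    rw [Nat.div_lt_iff_lt_mul hBp, Nat.add_mul]; omega
  have hidx : ρ 66 / B * (B + 1) + (ρ 62 + B - 1) / B < (B + 1) ^ 2 := by nlinarith
  have hsum : ρ 66 / B * (B + 1) ≤ ρ 66 / B * (B + 1) + (ρ 62 + B - 1) / B := Nat.le_add_right _ _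
  have htb := htab (ρ 66 / B) ((ρ 62 + B - 1) / B) (ρ 63) (by omega) hj' hb'n
  rw [htb]
  generalize ρ 66 / B = j at *
  generalize (ρ 62 + B - 1) / B = j' at *
  generalize j * (B + 1) = m at *
  refine ⟨?_, fun h => ?_, fun h => ?_⟩
  · and_intros <;> first | trivial | omega
  · refine ⟨by omega, trivial, trivial, ?_, by omega, .inl ⟨by simp, by simp, mb h⟩⟩
    intro j hj hj'
    rw [Function.update_of_ne (by omega), Function.update_of_ne hj']
  · refine ⟨by and_intros <;> first | trivial | omega, trivial, ?_, by omega,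
      .inr ⟨by simp, by simp, by simpa using hst, by simpa using cb h⟩⟩
    intro j hj hj'
    rw [Function.update_of_ne (by omega)]

/-- The leaf of the document at this position is itself a node whose list holds just the ranks of
that document. It has a rank in the other range exactly if the two counts at the leaf differ. -/
theorem wp_scanSingle (T : TreeOk Γ N H lf) (S : ScanPre N H lf ρ) {a : ℕ} (ha : a ≤ ρ 66)
    (hi : ρ 66 < ρ 61) (hib : ¬ (ρ 66 % ρ 55 = 0 ∧ ρ 66 + ρ 55 ≤ ρ 61)) :
    Wp Γ scanSingle ρ o (ScanPost H lf (8 * Nat.size N + 20) a ρ o) := by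
  have hw := T.w_ne
  have hL := T.hL
  have hNL := T.N_le
  have h2L := T.two_le
  have hHL := T.H_le
  obtain ⟨h1, h2, hB, hl, hr, hb, ha', hb'⟩ := S
  have hnN : cnt H lf (ρ 6) N ≤ N := cnt_le
  have hin : ρ 66 < cnt H lf (ρ 6) N := by omega
  have hoff := T.off _ h1 h2
  have hrk := T.rank _ h1 h2 _ hin
  have hrkN : rk H lf (ρ 6) (ρ 66) < N := rk_lt hin
  have hlf := T.lf_mem _ hrkN
  have hleaf := T.leaf _ hrkN
  have hst := scanSteps_single (B := ρ 55) (hB ▸ bs_pos _) hi hib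
  have h2H : 1 ≤ 2 ^ H := Nat.one_le_two_pow
  simp only [scanSingle, wp_block_cons, wp_block_singleton, wp_set, Ex.Ok, Ex.val, hrk, hleaf]
  refine ⟨by and_intros <;> first | trivial | omega, trivial, trivial, ?_⟩
  refine (wp_countRange T ?_ ?_ ?_ ?_).mono ?_
  · simp; omega
  · simpa using hlf.2
  · simpa using hl
  · simpa using hr
  rintro ρ₁ o₁ n₁ ⟨rfl, r1, r2, f, hn⟩
  simp only [Function.update_apply] at r1 r2
  simp at r1 r2
  have hiff : ρ₁ 83 < ρ₁ 84 ↔ ∃ y, ρ 62 ≤ y ∧ y < ρ 63 ∧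
      lf (rk H lf (ρ 6) (ρ 66)) = lf (rk H lf (ρ 6) y) := by
    rw [r1, r2, cnt_lt_cnt_iff, ha', hb',
      exists_rk_iff hr fun x => lf (rk H lf (ρ 6) (ρ 66)) = lf x]
    constructor
    · rintro ⟨x, h3, h4, h5⟩
      rw [under_leaf hlf.1] at h5
      exact ⟨x, h3, h4, by rw [h5]; exact under_rk hin, h5.symm⟩
    · rintro ⟨x, h3, h4, -, h5⟩
      exact ⟨x, h3, h4, (under_leaf hlf.1).2 h5.symm⟩
  have fr : ∀ j < 80, ρ₁ j = ρ j := by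
    intro j hj
    rw [f j (by omega), Function.update_of_ne (by omega), Function.update_of_ne (by omega),
      Function.update_of_ne (by omega)]
  simp only [wp_ite, wp_block_cons, wp_block_singleton, wp_set, Ex.Ok, Ex.val, Cond.Ok,
    Cond.Holds, hiff]
  refine ⟨⟨trivial, trivial⟩, fun h => ?_, fun h => ?_⟩
  · obtain ⟨y, hy⟩ := h
    refine ⟨by omega, trivial, rfl, ?_, by omega, .inl ⟨by simp, by simp [fr],
      ρ 66, ha, hi, y, hy⟩⟩
    intro j hj hj'
    rw [Function.update_of_ne (by omega), Function.update_of_ne hj', fr j (by omega)]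
  · refine ⟨⟨trivial, by omega, by rw [fr 66 (by omega)]; omega⟩, rfl, ?_, by omega,
      .inr ⟨by simp [fr], by simp [fr], by simpa [fr] using hst, ?_⟩⟩
    · intro j hj hj'
      rw [Function.update_of_ne (by omega), fr j (by omega)]
    · simp only [Function.update_self, fr 66 (by omega)]
      intro x h3 h4 y h5 h6 h7
      obtain rfl : x = ρ 66 := by omega
      exact absurd ⟨y, h5, h6, h7⟩ h

theorem wp_scanStep (T : TreeOk Γ N H lf) (S : ScanPre N H lf ρ) {a : ℕ} (ha : a ≤ ρ 66)
    (hi : ρ 66 < ρ 61) :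
    Wp Γ scanStep ρ o (ScanPost H lf (8 * Nat.size N + 29) a ρ o) := by
  have hw := T.w_ne
  have hL := T.hL
  have hNL := T.N_le
  have h2L := T.two_le
  have hnN : cnt H lf (ρ 6) N ≤ N := cnt_le
  have hBle : ρ 55 ≤ N + 1 := S.bsz ▸ (bs_le _).trans (by omega)
  have hb := S.b_le
  have S' : ∀ v, ScanPre N H lf (Function.update ρ 67 v) := fun v => by
    obtain ⟨h1, h2, h3, h4, h5, h6, h7, h8⟩ := S
    constructor <;> simpa
  have post : ∀ v D o' ρ' n, ScanPost H lf D a (Function.update ρ 67 v) o ρ' o' n →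
      ∀ m, m ≤ 9 → D ≤ 8 * Nat.size N + 20 → 
        ScanPost H lf (8 * Nat.size N + 29) a ρ o ρ' o' (n + m) := by
    rintro v D o' ρ' n ⟨h1, h2, h3, h4⟩ m hm hD
    refine ⟨h1, fun j hj hj' => (h2 j hj hj').trans (Function.update_of_ne (by omega) _ _),
      by omega, by simpa using h4⟩
  simp only [scanStep, wp_ite, wp_block_cons, wp_block_singleton, wp_set, wp_skip, Ex.Ok, Ex.val,
    Cond.Ok, Cond.Holds]
  have single : ¬ (ρ 66 % ρ 55 = 0 ∧ ρ 66 + ρ 55 ≤ ρ 61) → ∀ m ≤ 9,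
      Wp Γ scanSingle (Function.update ρ 67 0) o fun ρ' o' n =>
        ScanPost H lf (8 * Nat.size N + 29) a ρ o ρ' o' (n + m) := by
    intro hneg m hm
    refine (wp_scanSingle T (S' 0) (a := a) (by simpa) (by simpa) (by simpa using hneg)).mono ?_
    intro ρ' o' n h
    exact post _ _ _ _ _ h m hm le_rfl
  have blk : ρ 66 % ρ 55 = 0 → ρ 66 + ρ 55 ≤ ρ 61 → ∀ m ≤ 9,
      Wp Γ scanBlock (Function.update ρ 67 1) o fun ρ' o' n =>
        ScanPost H lf (8 * Nat.size N + 29) a ρ o ρ' o' (n + m) := by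
    intro h3 h4 m hm
    refine (wp_scanBlock T (S' 1) (a := a) (by simpa) (by simpa) (by simpa)).mono ?_
    intro ρ' o' n h
    exact post _ _ _ _ _ h m hm (by omega)
  simp [hw]
  refine ⟨fun h3 => ⟨by omega, fun h4 => ?_, fun h4 => ?_⟩, fun h3 => ?_⟩
  · refine (blk h3 h4 5 (by omega)).mono fun _ _ n h => ?_
    rwa [show 1 + (3 + (n + 1)) = n + 5 by omega]
  · refine (single (fun h => by omega) 5 (by omega)).mono fun _ _ n h => ?_
    rwa [show 1 + (3 + (n + 1)) = n + 5 by omega]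
  · refine (single (fun h => h3 h.1) 4 (by omega)).mono fun _ _ n h => ?_
    rwa [show 1 + (2 + (n + 1)) = n + 4 by omega]

/-- Each round lowers `scanSteps`, which starts at no more than `3 * bs`. A block costs a table
lookup and a single position two binary searches. -/
theorem wp_scan (T : TreeOk Γ N H lf) (S : ScanPre N H lf ρ) :
    Wp Γ scan ρ o fun ρ' o' n => o' = o ∧ (∀ j < 66, j ≠ 50 → ρ' j = ρ j) ∧
      ((ρ' 50 = 1 ∧ Meet H lf (ρ 6) (ρ 60) (ρ 61) (ρ 62) (ρ 63)) ∨
        (ρ' 50 = ρ 50 ∧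
          Clear H lf (ρ 6) (ρ 55) (ρ 60) (ρ 61) (ρ 62) (ρ 63) (ρ 60) (ρ 61))) ∧
      n ≤ (8 * Nat.size N + 30) * (3 * bs (cnt H lf (ρ 6) N)) + 2 := by
  have hBp : 0 < ρ 55 := S.bsz ▸ bs_pos _
  have hBsq : cnt H lf (ρ 6) N < ρ 55 * ρ 55 := S.bsz ▸ lt_bs_sq _
  simp only [scan, wp_block_cons, wp_block_singleton, wp_set, Ex.Ok, Ex.val]
  refine ⟨trivial, (wp_loop (fun ρ' o' => o' = o ∧ (∀ j < 66, j ≠ 50 → ρ' j = ρ j) ∧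
    ρ 60 ≤ ρ' 66 ∧
      ((ρ' 50 = 1 ∧ ρ' 66 = ρ 61 ∧ Meet H lf (ρ 6) (ρ 60) (ρ 61) (ρ 62) (ρ 63)) ∨
        (ρ' 50 = ρ 50 ∧
          Clear H lf (ρ 6) (ρ 55) (ρ 60) (ρ 61) (ρ 62) (ρ 63) (ρ 60) (ρ' 66))))
    (fun ρ' => (8 * Nat.size N + 30) * scanSteps (ρ 55) (ρ 61) (ρ' 66)) ?_ ?_ ?_).mono ?_⟩
  · refine ⟨rfl, fun j hj _ => Function.update_of_ne (by omega) _ _, by simp, .inr ⟨by simp, ?_⟩⟩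
    intro x h1 h2
    simp at h2
    omega
  · intro ρ' o' _; simp [Cond.Ok, Ex.Ok]
  · rintro ρ' o' ⟨rfl, hf, hi, hcase⟩ hc
    simp only [Cond.Holds, Ex.val] at hc
    have f6 := hf 6 (by omega) (by omega)
    have f55 := hf 55 (by omega) (by omega)
    have f61 := hf 61 (by omega) (by omega)
    have f62 := hf 62 (by omega) (by omega)
    have f63 := hf 63 (by omega) (by omega)
    have S' : ScanPre N H lf ρ' := by
      obtain ⟨h1, h2, h3, h4, h5, h6, h7, h8⟩ := S
      constructor <;> simpa [hf]
    obtain ⟨h50, hinv⟩ : ρ' 50 = ρ 50 ∧ _ := by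
      -- After a success register 66 has been moved to the end of the range, so the loop condition
      -- excludes that case.
      rcases hcase with h | h
      · omega
      · exact h
    refine (wp_scanStep T S' hi hc).mono ?_
    rintro ρ₁ o₁ n ⟨rfl, hf', hn, h⟩
    rw [f6, f55, f61, f62, f63] at h
    have hpos := scanSteps_pos hBp (f61 ▸ hc)
    refine ⟨⟨rfl, fun j hj hj' => (hf' j hj hj').trans (hf j hj hj'), ?_⟩, ?_⟩
    · rcases h with ⟨h1, h2, h3⟩ | ⟨h1, h2, -, h3⟩
      · exact ⟨by omega, .inl ⟨h1, h2, h3⟩⟩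
      · refine ⟨by omega, .inr ⟨by omega, fun x hx hx' => ?_⟩⟩
        by_cases hxi : x < ρ' 66
        · exact hinv x hx hxi
        · exact h3 x (by omega) hx'
    · have : scanSteps (ρ 55) (ρ 61) (ρ₁ 66) + 1 ≤ scanSteps (ρ 55) (ρ 61) (ρ' 66) := by
        rcases h with ⟨h1, h2, h3⟩ | ⟨h1, -, h2, h3⟩
        · rw [h2, scanSteps_self hBp]; omega
        · exact h2
      have := Nat.mul_le_mul_left (8 * Nat.size N + 30) this
      rw [Nat.mul_add] at this
      omega
  · rintro ρ' o' n ⟨⟨rfl, hf, hi, hcase⟩, hc, hn⟩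
    simp only [Cond.Holds, Ex.val] at hc
    rw [hf 61 (by omega) (by omega)] at hc
    refine ⟨rfl, hf, ?_, ?_⟩
    · rcases hcase with ⟨h, -, h'⟩ | ⟨h, h'⟩
      · exact .inl ⟨h, h'⟩
      · exact .inr ⟨h, fun x hx hx' => h' x hx (by omega)⟩
    · have := scanSteps_le (B := ρ 55) (i := ρ 60) S.b_le hBsq
      have h3 := Nat.mul_le_mul_left (8 * Nat.size N + 30) this
      simp at hn
      rw [← S.bsz]
      omega

/-- Set register 50 if some document below node 6 has ranks in both `[2, 3)` and `[4, 5)`. -/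
def nodeTest : Cmd := block [
  .set 80 (.reg 6), .set 81 (.reg 2), .set 82 (.reg 3), countRange,
  .set 51 (.reg 83), .set 52 (.reg 84),
  .set 81 (.reg 4), .set 82 (.reg 5), countRange,
  .set 50 (.lit 0), .set 55 (.arr 3 (.reg 6)),
  .set 60 (.reg 51), .set 61 (.reg 52), .set 62 (.reg 83), .set 63 (.reg 84),
  .set 64 (.reg 4), .set 65 (.reg 5), scan,
  .set 51 (.reg 60), .set 52 (.reg 61),
  .set 60 (.reg 62), .set 61 (.reg 63), .set 62 (.reg 51), .set 63 (.reg 52),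
  .set 64 (.reg 2), .set 65 (.reg 3), scan]

end WordRAM

namespace DocumentListing

/-- The document with leaf `y` has ranks in both `[l, r)` and `[l', r')`. -/
def Hit (lf : ℕ → ℕ) (l r l' r' y : ℕ) : Prop :=
  (∃ x, l ≤ x ∧ x < r ∧ lf x = y) ∧ ∃ x, l' ≤ x ∧ x < r' ∧ lf x = y

theorem meet_iff {H N : ℕ} {lf : ℕ → ℕ} {v l r l' r' : ℕ} (hr : r ≤ N) (hr' : r' ≤ N) :
    Meet H lf v (cnt H lf v l) (cnt H lf v r) (cnt H lf v l') (cnt H lf v r') ↔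
      ∃ y, Under H v y ∧ Hit lf l r l' r' y := by
  unfold Meet
  rw [exists_rk_iff hr fun x => ∃ y, cnt H lf v l' ≤ y ∧ y < cnt H lf v r' ∧
    lf x = lf (rk H lf v y)]
  constructor
  · rintro ⟨x, h1, h2, h3, h4⟩
    rw [exists_rk_iff hr' fun y => lf x = lf y] at h4
    obtain ⟨y, h5, h6, -, h8⟩ := h4
    exact ⟨lf x, h3, ⟨x, h1, h2, rfl⟩, y, h5, h6, h8.symm⟩
  · rintro ⟨y, h1, ⟨x, h2, h3, rfl⟩, x', h4, h5, h6⟩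
    refine ⟨x, h2, h3, h1, ?_⟩
    rw [exists_rk_iff hr' fun y => lf x = lf y]
    exact ⟨x', h4, h5, by rwa [h6], h6.symm⟩

theorem Meet.symm {H : ℕ} {lf : ℕ → ℕ} {v a b a' b' : ℕ} (h : Meet H lf v a b a' b') :
    Meet H lf v a' b' a b := by
  obtain ⟨x, h1, h2, y, h3, h4, h5⟩ := h
  exact ⟨y, h3, h4, x, h1, h2, h5.symm⟩

/-- For a common document at `x` and `y`, the first scan says that `y` is not in a full block of its
range, and the second one, with the roles exchanged, says that it is. -/
theorem not_meet_of_clear {H : ℕ} {lf : ℕ → ℕ} {v B a b a' b' : ℕ}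
    (h : Clear H lf v B a b a' b' a b) (h' : Clear H lf v B a' b' a b a' b') :
    ¬ Meet H lf v a b a' b' := fun ⟨x, h1, h2, y, h3, h4, h5⟩ =>
  (h x h1 h2 y h3 h4 h5).2 (h' y h3 h4 x h1 h2 h5.symm).1

end DocumentListing

namespace WordRAM
open Cmd DocumentListing

variable {Γ : Ctx} {N H : ℕ} {lf : ℕ → ℕ} {ρ : ℕ → ℕ} {o : List ℕ}

theorem wp_nodeTest (T : TreeOk Γ N H lf) (h1 : 1 ≤ ρ 6) (h2 : ρ 6 < 2 ^ (H + 1))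
    (hl : ρ 2 ≤ N) (hr : ρ 3 ≤ N) (hl' : ρ 4 ≤ N) (hr' : ρ 5 ≤ N) :
    Wp Γ nodeTest ρ o fun ρ' o' n => o' = o ∧ (∀ j < 50, ρ' j = ρ j) ∧
      (ρ' 50 = 1 ↔ ∃ y, Under H (ρ 6) y ∧ Hit lf (ρ 2) (ρ 3) (ρ 4) (ρ 5) y) ∧
      n ≤ (8 * Nat.size N + 30) * (9 * bs (cnt H lf (ρ 6) N)) := by
  have hw := T.w_ne
  have hHL := T.H_le
  have hbs := T.bsz _ h1 h2
  simp only [nodeTest, wp_block_cons, wp_block_singleton, wp_set, Ex.Ok, Ex.val, true_and]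
  refine (wp_countRange T (by simpa) (by simpa) (by simpa) (by simpa)).mono ?_
  rintro ρ₁ o₁ n₁ ⟨rfl, ra, rb, f₁, hn₁⟩
  refine (wp_countRange T (by simpa [f₁]) (by simpa [f₁]) (by simpa [f₁]) (by simpa [f₁])).mono ?_
  rintro ρ₂ o₂ n₂ ⟨rfl, ra', rb', f₂, hn₂⟩
  simp [f₁] at ra rb ra' rb' f₂
  have g₂ : ∀ j < 50, ρ₂ j = ρ j := fun j hj => by
    rw [f₂ j (by omega)]
    simp (disch := omega) only [Function.update_of_ne]
    rw [f₁ j (by omega)]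
    simp (disch := omega) only [Function.update_of_ne]
  have c51 : ρ₂ 51 = cnt H lf (ρ 6) (ρ 2) := by rw [f₂ _ (by omega)]; simp [ra]
  have c52 : ρ₂ 52 = cnt H lf (ρ 6) (ρ 3) := by rw [f₂ _ (by omega)]; simp [rb]
  refine ⟨Nat.two_pow_pos _, ⟨by norm_num, by simp [g₂]; omega⟩, ?_⟩
  refine (wp_scan T ?_).mono ?_
  · constructor <;> simp [*]
    exact cnt_mono hr
  rintro ρ₃ o₃ n₃ ⟨rfl, f₃, hc₃, hn₃⟩
  simp [g₂, c51, c52, ra', rb', hbs] at hc₃ hn₃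
  refine (wp_scan T ?_).mono ?_
  · constructor <;> simp [*]
    exact cnt_mono hr'
  rintro ρ₄ o₄ n₄ ⟨rfl, f₄, hc₄, hn₄⟩
  simp [f₃, g₂, c51, c52, ra', rb', hbs] at hc₄ hn₄
  refine ⟨rfl, ?_, ?_, ?_⟩
  · intro j hj
    rw [f₄ j (by omega) (by omega)]
    simp (disch := omega) only [Function.update_of_ne]
    rw [f₃ j (by omega) (by omega)]
    simp (disch := omega) only [Function.update_of_ne]
    exact g₂ j hj
  · rw [← meet_iff hr hr']
    -- A scan without success leaves register 50 unchanged, so a success of the first scan survives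
    -- the second.
    rcases hc₄ with ⟨h50, hm⟩ | ⟨h50, hc⟩
    · exact ⟨fun _ => hm.symm, fun _ => h50⟩
    · rcases hc₃ with ⟨h50', hm'⟩ | ⟨h50', hc'⟩
      · exact ⟨fun _ => hm', fun _ => by rw [h50, h50']⟩
      · exact ⟨fun h => by omega, fun h => absurd h (not_meet_of_clear hc' hc)⟩
  · have e1 : 3 * (8 * Nat.size N + 30) ≤
        (8 * Nat.size N + 30) * (3 * bs (cnt H lf (ρ 6) N)) := by
      have := Nat.mul_le_mul_left (3 * (8 * Nat.size N + 30)) (bs_pos (cnt H lf (ρ 6) N))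
      linarith
    have e2 : (8 * Nat.size N + 30) * (9 * bs (cnt H lf (ρ 6) N)) =
        3 * ((8 * Nat.size N + 30) * (3 * bs (cnt H lf (ρ 6) N))) := by ring
    rw [e2]
    clear e2
    generalize (8 * Nat.size N + 30) * (3 * bs (cnt H lf (ρ 6) N)) = X at hn₃ hn₄ e1 ⊢
    linarith

end WordRAM

/-! ### Pruned preorder traversal and its cost -/

namespace DocumentListing

theorem skipNode_even {v : ℕ} (h : 1 ≤ v) : skipNode (2 * v) = 2 * v + 1 := by
  rw [skipNode, if_neg (by omega), if_pos (by omega)]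

theorem skipNode_odd {v : ℕ} (h : 1 ≤ v) : skipNode (2 * v + 1) = skipNode v := by
  rw [skipNode, if_neg (by omega), if_neg (by omega)]
  congr 1; omega

theorem log_two_mul {v : ℕ} (h : 1 ≤ v) : Nat.log 2 (2 * v) = Nat.log 2 v + 1 := by
  rw [Nat.mul_comm, Nat.log_mul_base (by norm_num) (by omega)]

theorem log_two_mul_add_one {v : ℕ} (h : 1 ≤ v) :
    Nat.log 2 (2 * v + 1) = Nat.log 2 v + 1 := by
  rw [Nat.log_of_one_lt_of_le (by norm_num) (by omega),
    show (2 * v + 1) / 2 = v by omega]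

theorem under_iff {H v j y : ℕ} (h : Nat.log 2 v + j = H) : Under H v y ↔ y / 2 ^ j = v := by
  rw [Under, ht, show H - Nat.log 2 v = j by omega]

theorem under_iff_mem {H v j y : ℕ} (h : Nat.log 2 v + j = H) :
    Under H v y ↔ y ∈ List.range' (v * 2 ^ j) (2 ^ j) := by
  rw [under_iff h, List.mem_range'_1, Nat.div_eq_iff (Nat.two_pow_pos j)]
  have := Nat.two_pow_pos j
  omega

theorem range'_split (v j : ℕ) : List.range' (v * 2 ^ (j + 1)) (2 ^ (j + 1)) =
    List.range' (2 * v * 2 ^ j) (2 ^ j) ++ List.range' ((2 * v + 1) * 2 ^ j) (2 ^ j) := by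
  rw [show (2 * v + 1) * 2 ^ j = 2 * v * 2 ^ j + 2 ^ j by ring, List.range'_append_1]
  congr 1 <;> ring

open Classical in
/-- The leaves below `v`, a node of height `j`, that satisfy `K`. -/
noncomputable def hits (K : ℕ → Prop) (j v : ℕ) : List ℕ :=
  (List.range' (v * 2 ^ j) (2 ^ j)).filter (fun y => decide (K y))

theorem hits_succ (K : ℕ → Prop) (j v : ℕ) :
    hits K (j + 1) v = hits K j (2 * v) ++ hits K j (2 * v + 1) := by
  rw [hits, range'_split, List.filter_append, hits, hits]

theorem mem_hits {K : ℕ → Prop} {H j v y : ℕ} (h : Nat.log 2 v + j = H) :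
    y ∈ hits K j v ↔ Under H v y ∧ K y := by
  simp [hits, under_iff_mem h]

theorem hits_nodup (K : ℕ → Prop) (j v : ℕ) : (hits K j v).Nodup :=
  List.Nodup.filter _ (List.nodup_range' ..)

open Classical in
/-- Bound for the cost of visiting the nodes below `v`, when visiting `u` costs `c u`. -/
noncomputable def treeCost (K : ℕ → Prop) (H : ℕ) (c : ℕ → ℕ) : ℕ → ℕ → ℕ
  | 0, v => c v
  | j + 1, v => c v + if ∃ y, Under H v y ∧ K y then
      treeCost K H c j (2 * v) + treeCost K H c j (2 * v + 1) else 0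

theorem under_two_mul {H v j y : ℕ} (h1 : 1 ≤ v) (h : Nat.log 2 v + (j + 1) = H) :
    Under H v y ↔ Under H (2 * v) y ∨ Under H (2 * v + 1) y := by
  rw [under_iff h, under_iff (j := j) (by rw [log_two_mul h1]; omega),
    under_iff (j := j) (by rw [log_two_mul_add_one h1]; omega), pow_succ, ← Nat.div_div_eq_div_mul]
  omega

/-- Each suffix below an inner node is below exactly one child, so weights add up along the tree. -/
theorem cnt_two_mul {H v j : ℕ} {lf : ℕ → ℕ} (h1 : 1 ≤ v) (h : Nat.log 2 v + (j + 1) = H) (N : ℕ) :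
    cnt H lf v N = cnt H lf (2 * v) N + cnt H lf (2 * v + 1) N := by
  have hu := fun y => under_two_mul (y := y) h1 h
  have hd : ∀ y, ¬ (Under H (2 * v) y ∧ Under H (2 * v + 1) y) := by
    intro y
    rw [under_iff (j := j) (by rw [log_two_mul h1]; omega),
      under_iff (j := j) (by rw [log_two_mul_add_one h1]; omega)]
    omega
  induction N with
  | zero => simp [cnt]
  | succ N ih =>
    simp only [cnt, Nat.count_succ] at ih ⊢
    rw [ih]
    have h2 := hu (lf N)
    have h3 := hd (lf N)
    by_cases h4 : Under H (2 * v) (lf N) <;> by_cases h5 : Under H (2 * v + 1) (lf N) <;>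
      simp_all <;> omega

theorem sqrt_add_sqrt_le {a b : ℝ} (ha : 0 ≤ a) (hb : 0 ≤ b) :
    √a + √b ≤ √(2 * (a + b)) := by
  apply Real.le_sqrt_of_sq_le
  nlinarith [Real.sq_sqrt ha, Real.sq_sqrt hb, sq_nonneg (√a - √b)]

/-- Cauchy–Schwarz for two summands. It lets the bounds of two children merge into that of their
parent without loss. -/
theorem sqrt_mul_add_le {k₁ k₂ m₁ m₂ : ℝ} (h1 : 0 ≤ k₁) (h2 : 0 ≤ k₂) (h3 : 0 ≤ m₁)
    (h4 : 0 ≤ m₂) : √(k₁ * m₁) + √(k₂ * m₂) ≤ √((k₁ + k₂) * (m₁ + m₂)) := by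
  apply Real.le_sqrt_of_sq_le
  rw [Real.sqrt_mul h1, Real.sqrt_mul h2]
  nlinarith [Real.sq_sqrt h1, Real.sq_sqrt h2, Real.sq_sqrt h3, Real.sq_sqrt h4,
    sq_nonneg (√k₁ * √m₂ - √k₂ * √m₁)]

/-- The weight `n + 2 ^ j` at height `j` absorbs the `+ 1` in `bs` and is still additive over
children, while at the root it stays linear in `N`. -/
theorem bs_le_sqrt (n j : ℕ) : (bs n : ℝ) ≤ 2 * √((n : ℝ) + 2 ^ j) := by
  have h1 : (Nat.sqrt n : ℝ) ≤ √((n : ℝ) + 2 ^ j) :=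
    Real.nat_sqrt_le_real_sqrt.trans (Real.sqrt_le_sqrt (by simp))
  have h2 : 1 ≤ √((n : ℝ) + 2 ^ j) := by
    rw [Real.one_le_sqrt]
    have : (1 : ℝ) ≤ 2 ^ j := one_le_pow₀ (by norm_num)
    have : (0 : ℝ) ≤ n := by positivity
    linarith
  rw [bs]; push_cast; linarith

/-- The square root bound for the search in the document tree. -/
theorem treeCost_le {K : ℕ → Prop} {H N D : ℕ} {lf : ℕ → ℕ} (j : ℕ) : ∀ v, 1 ≤ v →
    Nat.log 2 v + j = H → (treeCost K H (fun v => D * bs (cnt H lf v N)) j v : ℝ) ≤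
      2 * D * (√((cnt H lf v N : ℝ) + 2 ^ j) +
        2 * j * √(((hits K j v).length : ℝ) * ((cnt H lf v N : ℝ) + 2 ^ j))) := by
  have hD : (0 : ℝ) ≤ D := by positivity
  induction j with
  | zero =>
    intro v _ _
    have := bs_le_sqrt (cnt H lf v N) 0
    simp only [treeCost]
    push_cast
    have := mul_le_mul_of_nonneg_left this hD
    simp only [mul_zero, zero_mul, add_zero]
    linarith
  | succ j ih =>
    intro v h1 h
    have e0 := mul_le_mul_of_nonneg_left (bs_le_sqrt (cnt H lf v N) (j + 1)) hD
    simp only [treeCost]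
    split_ifs with hex
    · have e1 := ih (2 * v) (by omega) (by rw [log_two_mul h1]; omega)
      have e2 := ih (2 * v + 1) (by omega) (by rw [log_two_mul_add_one h1]; omega)
      have hk : (1 : ℝ) ≤ (hits K (j + 1) v).length := by
        obtain ⟨y, hy⟩ := hex
        have := List.length_pos_of_mem ((mem_hits h).2 hy)
        exact_mod_cast this
      have hm : (cnt H lf v N : ℝ) + 2 ^ (j + 1) = ((cnt H lf (2 * v) N : ℝ) + 2 ^ j) +
          ((cnt H lf (2 * v + 1) N : ℝ) + 2 ^ j) := by
        rw [cnt_two_mul h1 h]; push_cast; ring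
      have hk2 : ((hits K (j + 1) v).length : ℝ) =
          (hits K j (2 * v)).length + (hits K j (2 * v + 1)).length := by
        rw [hits_succ]; simp
      push_cast
      rw [hm] at e0 ⊢
      have p1 : (0 : ℝ) ≤ (cnt H lf (2 * v) N : ℝ) + 2 ^ j := by positivity
      have p2 : (0 : ℝ) ≤ (cnt H lf (2 * v + 1) N : ℝ) + 2 ^ j := by positivity
      generalize (cnt H lf (2 * v) N : ℝ) + 2 ^ j = m₁ at *
      generalize (cnt H lf (2 * v + 1) N : ℝ) + 2 ^ j = m₂ at *
      rw [hk2] at hk ⊢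
      have q1 : (0 : ℝ) ≤ (hits K j (2 * v)).length := by positivity
      have q2 : (0 : ℝ) ≤ (hits K j (2 * v + 1)).length := by positivity
      generalize ((hits K j (2 * v)).length : ℝ) = k₁ at *
      generalize ((hits K j (2 * v + 1)).length : ℝ) = k₂ at *
      have s1 := sqrt_add_sqrt_le p1 p2
      have s2 := sqrt_mul_add_le q1 q2 p1 p2
      -- The children's own visits form the increment of one level. The node has a hit, so `k₁ + k₂
      -- ≥ 1` and the increment is charged to `√(k * m)`.
      have s3 : √(2 * (m₁ + m₂)) ≤ 2 * √((k₁ + k₂) * (m₁ + m₂)) := by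
        rw [show (2 : ℝ) * √((k₁ + k₂) * (m₁ + m₂)) = √(4 * ((k₁ + k₂) * (m₁ + m₂))) by
          rw [Real.sqrt_mul (by norm_num : (0:ℝ) ≤ 4), show √(4 : ℝ) = 2 by
            rw [show (4 : ℝ) = 2 ^ 2 by norm_num]; exact Real.sqrt_sq (by norm_num)]]
        apply Real.sqrt_le_sqrt
        nlinarith
      have s4 : √m₁ + 2 * j * √(k₁ * m₁) + (√m₂ + 2 * j * √(k₂ * m₂)) ≤
          2 * (j + 1) * √((k₁ + k₂) * (m₁ + m₂)) := by
        have hj : (0 : ℝ) ≤ 2 * j := by positivity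
        have := mul_le_mul_of_nonneg_left s2 hj
        linarith
      have s5 := mul_le_mul_of_nonneg_left s4 (show (0 : ℝ) ≤ 2 * D by positivity)
      linarith
    · push_cast
      have : (0 : ℝ) ≤ 2 * D * (2 * (j + 1) * √(((hits K (j + 1) v).length : ℝ) *
        ((cnt H lf v N : ℝ) + 2 ^ (j + 1)))) := by positivity
      linarith

end DocumentListing

namespace WordRAM
open Cmd DocumentListing

variable {Γ : Ctx} {N H : ℕ} {lf : ℕ → ℕ}

/-- Visit of node 6. -/
def visit : Cmd := block [
  nodeTest,
  .ite (.eq (.reg 50) (.lit 1))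
    (.ite (.le (.arr 9 (.lit 1)) (.reg 6))
      (block [.emit (.arr 8 (.reg 6)), .set 6 (.arr 7 (.reg 6))])
      (.set 6 (.sum (.reg 6) (.reg 6))))
    (.set 6 (.arr 7 (.reg 6)))]

/-- Preorder traversal of the nodes with a document to be reported. -/
def traverse : Cmd := .loop (.lt (.lit 0) (.reg 6)) visit

/-- The traversal is one loop without recursion, so the claim about a subtree is in continuation
form: if the loop behaves well when resumed after the subtree, it does so when started at its root.
This allows induction on the height. -/
theorem wp_traverse_sub (T : TreeOk Γ N H lf) {l r l' r' : ℕ} (hl : l ≤ N) (hr : r ≤ N)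
    (hl' : l' ≤ N) (hr' : r' ≤ N) (j : ℕ) :
    ∀ (v : ℕ) (_ : 1 ≤ v) (_ : Nat.log 2 v + j = H) (ρ : ℕ → ℕ) (o : List ℕ) (B : ℕ)
      (Q : List ℕ → Prop), ρ 6 = v → ρ 2 = l → ρ 3 = r → ρ 4 = l' → ρ 5 = r' →
      (∀ ρ' : ℕ → ℕ, ρ' 6 = skipNode v → ρ' 2 = l → ρ' 3 = r → ρ' 4 = l' → ρ' 5 = r' →
        Wp Γ traverse ρ' (o ++ (hits (Hit lf l r l' r') j v).map (Γ.A 8))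
          fun _ o' n => n ≤ B ∧ Q o') →
      Wp Γ traverse ρ o fun _ o' n => n ≤ B + treeCost (Hit lf l r l' r') H
        (fun v => (10 * (8 * Nat.size N + 30)) * bs (cnt H lf v N)) j v ∧ Q o' := by
  have hw := T.w_ne
  have hL := T.hL
  have hHL := T.H_le
  have h2L := T.two_le
  have hcst := T.cst
  -- the part of the argument common to all heights
  have common : ∀ (v j : ℕ) (_ : 1 ≤ v) (_ : Nat.log 2 v + j = H) (ρ : ℕ → ℕ) (o : List ℕ) (B : ℕ)
      (Q : List ℕ → Prop), ρ 6 = v → ρ 2 = l → ρ 3 = r → ρ 4 = l' → ρ 5 = r' →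
      ((¬ ∃ y, Under H v y ∧ Hit lf l r l' r' y) → ∀ ρ' : ℕ → ℕ, ρ' 6 = skipNode v →
        ρ' 2 = l → ρ' 3 = r → ρ' 4 = l' → ρ' 5 = r' →
        Wp Γ traverse ρ' o fun _ o' n => n ≤ B ∧ Q o') →
      ((∃ y, Under H v y ∧ Hit lf l r l' r' y) → 2 ^ H ≤ v → ∀ ρ' : ℕ → ℕ, ρ' 6 = skipNode v →
        ρ' 2 = l → ρ' 3 = r → ρ' 4 = l' → ρ' 5 = r' →
        Wp Γ traverse ρ' (o ++ [Γ.A 8 v]) fun _ o' n => n ≤ B ∧ Q o') →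
      ((∃ y, Under H v y ∧ Hit lf l r l' r' y) → v < 2 ^ H → ∀ ρ' : ℕ → ℕ, ρ' 6 = 2 * v →
        ρ' 2 = l → ρ' 3 = r → ρ' 4 = l' → ρ' 5 = r' →
        Wp Γ traverse ρ' o fun _ o' n => n ≤ B ∧ Q o') →
      Wp Γ traverse ρ o fun _ o' n => n ≤ B +
        (10 * (8 * Nat.size N + 30)) * bs (cnt H lf v N) ∧ Q o' := by
    intro v j h1 h ρ o B Q h6 h2 h3 h4 h5 c1 c2 c3
    have hv : v < 2 ^ (H + 1) := by
      rw [← Nat.log_lt_iff_lt_pow (by norm_num) (by omega)]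
      omega
    -- The node test takes nine of the ten shares; the tenth pays for the rest of the visit.
    have hcost : (8 * Nat.size N + 30) * (9 * bs (cnt H lf v N)) + 30 ≤
        (10 * (8 * Nat.size N + 30)) * bs (cnt H lf v N) := by
      have := bs_pos (cnt H lf v N)
      nlinarith
    have hsk := T.skip v h1 hv
    subst h6
    refine wp_loop_true (by simp [Cond.Ok, Ex.Ok]) (by simp [Cond.Holds, Ex.val]; omega) ?_
    simp only [visit, wp_block_cons, wp_block_singleton]
    refine (wp_nodeTest T h1 hv (by omega) (by omega) (by omega) (by omega)).mono ?_
    rintro ρ₁ o₁ n₁ ⟨rfl, f, hiff, hn⟩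
    have f6 : ρ₁ 6 = ρ 6 := f 6 (by omega)
    rw [h2, h3, h4, h5] at hiff
    simp only [wp_ite, wp_block_cons, wp_block_singleton, wp_set, wp_emit, Ex.Ok, Ex.val, Cond.Ok,
      Cond.Holds, hiff, hcst, f6, hsk]
    have fr : ∀ x, ∀ j < 6, (Function.update ρ₁ 6 x) j = ρ j := by
      intro x j hj
      rw [Function.update_of_ne (by omega), f j (by omega)]
    refine ⟨⟨trivial, Nat.one_lt_two_pow hw⟩, fun hex => ⟨?_, fun hle => ?_, fun hle => ?_⟩,
      fun hex => ⟨?_, ?_⟩⟩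
    · and_intros <;> first | trivial | omega
    · refine ⟨⟨by omega, trivial, by omega⟩, ⟨by omega, trivial, by omega⟩, ?_⟩
      refine (c2 hex hle (Function.update ρ₁ 6 (skipNode (ρ 6))) (by simp) ?_ ?_ ?_ ?_).mono ?_
      · rw [fr _ _ (by omega), h2]
      · rw [fr _ _ (by omega), h3]
      · rw [fr _ _ (by omega), h4]
      · rw [fr _ _ (by omega), h5]
      · rintro _ _ n ⟨hn', hq⟩
        exact ⟨by omega, hq⟩
    · refine ⟨⟨trivial, trivial, ?_⟩, ?_⟩
      · rw [pow_succ] at hHL; omega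
      refine (c3 hex (not_le.1 hle) (Function.update ρ₁ 6 (ρ 6 + ρ 6)) (by simp; omega)
        ?_ ?_ ?_ ?_).mono ?_
      · rw [fr _ _ (by omega), h2]
      · rw [fr _ _ (by omega), h3]
      · rw [fr _ _ (by omega), h4]
      · rw [fr _ _ (by omega), h5]
      · rintro _ _ n ⟨hn', hq⟩
        exact ⟨by omega, hq⟩
    · and_intros <;> first | trivial | omega
    · refine (c1 hex (Function.update ρ₁ 6 (skipNode (ρ 6))) (by simp) ?_ ?_ ?_ ?_).mono ?_
      · rw [fr _ _ (by omega), h2]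
      · rw [fr _ _ (by omega), h3]
      · rw [fr _ _ (by omega), h4]
      · rw [fr _ _ (by omega), h5]
      · rintro _ _ n ⟨hn', hq⟩
        exact ⟨by omega, hq⟩
  have nohit : ∀ v j, Nat.log 2 v + j = H → (¬ ∃ y, Under H v y ∧ Hit lf l r l' r' y) →
      hits (Hit lf l r l' r') j v = [] := by
    intro v j h hex
    rw [List.eq_nil_iff_forall_not_mem]
    intro y hy
    exact hex ⟨y, (mem_hits h).1 hy⟩
  induction j with
  | zero =>
    intro v h1 h ρ o B Q h6 h2 h3 h4 h5 c
    have hle : 2 ^ H ≤ v := by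
      have := Nat.pow_log_le_self 2 (show v ≠ 0 by omega)
      rwa [show Nat.log 2 v = H by omega] at this
    refine common v 0 h1 h ρ o B Q h6 h2 h3 h4 h5 (fun hex => ?_) (fun hex _ => ?_)
      (fun _ hlt => by omega)
    · rw [nohit v 0 h hex] at c
      simpa using c
    · obtain ⟨y, hy, hy'⟩ := hex
      rw [under_leaf hle] at hy
      subst hy
      have : hits (Hit lf l r l' r') 0 y = [y] := by simp [hits, hy']
      rw [this] at c
      simpa using c
  | succ j ih =>
    intro v h1 h ρ o B Q h6 h2 h3 h4 h5 c
    have hlt : v < 2 ^ H := by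
      rw [← Nat.log_lt_iff_lt_pow (by norm_num) (by omega)]
      omega
    by_cases hex : ∃ y, Under H v y ∧ Hit lf l r l' r' y
    · simp only [treeCost, if_pos hex]
      -- Regrouped in the order of use: the continuation after the left subtree already carries the
      -- cost of the right subtree.
      rw [show ∀ a b c d : ℕ, a + (b + (c + d)) = (a + d + c) + b by intros; omega]
      refine common v (j + 1) h1 h ρ o _ Q h6 h2 h3 h4 h5 (fun hn => absurd hex hn)
        (fun _ hle => by omega) (fun _ _ ρ' g6 g2 g3 g4 g5 => ?_)
      refine ih (2 * v) (by omega) (by rw [log_two_mul h1]; omega) ρ' o _ Q g6 g2 g3 g4 g5 ?_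
      intro ρ₂ k6 k2 k3 k4 k5
      rw [skipNode_even h1] at k6
      refine ih (2 * v + 1) (by omega) (by rw [log_two_mul_add_one h1]; omega) ρ₂ _ _ Q
        k6 k2 k3 k4 k5 ?_
      intro ρ₃ m6 m2 m3 m4 m5
      rw [skipNode_odd h1] at m6
      have := c ρ₃ m6 m2 m3 m4 m5
      rw [hits_succ] at this
      simpa using this
    · simp only [treeCost, if_neg hex, Nat.add_zero]
      refine common v (j + 1) h1 h ρ o B Q h6 h2 h3 h4 h5 (fun _ => ?_) (fun hn => absurd hn hex)
        (fun hn => absurd hn hex)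
      rw [nohit v _ h hex] at c
      simpa using c

theorem wp_traverse (T : TreeOk Γ N H lf) {ρ : ℕ → ℕ} {o : List ℕ} (h6 : ρ 6 = 1) (hl : ρ 2 ≤ N)
    (hr : ρ 3 ≤ N) (hl' : ρ 4 ≤ N) (hr' : ρ 5 ≤ N) :
    Wp Γ traverse ρ o fun _ o' n =>
      n ≤ 1 + treeCost (Hit lf (ρ 2) (ρ 3) (ρ 4) (ρ 5)) H
        (fun v => (10 * (8 * Nat.size N + 30)) * bs (cnt H lf v N)) H 1 ∧
      o' = o ++ (hits (Hit lf (ρ 2) (ρ 3) (ρ 4) (ρ 5)) H 1).map (Γ.A 8) := by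
  refine wp_traverse_sub T hl hr hl' hr' H 1 le_rfl (by simp) ρ o 1 _ h6 rfl rfl rfl rfl ?_
  intro ρ' g6 _ _ _ _
  rw [skipNode, if_pos le_rfl] at g6
  exact wp_loop_false (by simp [Cond.Ok, Ex.Ok]) (by simp [Cond.Holds, Ex.val, g6])
    ⟨le_rfl, rfl⟩

end WordRAM

/-! ### Locating a pattern in the search tree -/

namespace DocumentListing

theorem isPrefix_iff_getD {p s : List ℕ} :
    p <+: s ↔ p.length ≤ s.length ∧ ∀ i < p.length, s.getD i 0 = p.getD i 0 := by
  rw [List.prefix_iff_getElem]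
  constructor
  · rintro ⟨h, h'⟩
    refine ⟨h, fun i hi => ?_⟩
    rw [List.getD_eq_getElem _ _ hi, List.getD_eq_getElem _ _ (by omega), h' i hi]
  · rintro ⟨h, h'⟩
    refine ⟨h, fun i hi => ?_⟩
    have := h' i hi
    rw [List.getD_eq_getElem _ _ hi, List.getD_eq_getElem _ _ (by omega)] at this
    exact this.symm

end DocumentListing

namespace WordRAM
open Cmd DocumentListing

variable {β : Type}

/-- The string `s` is stored at the position of node `u`. -/
def Sample (Γ : Ctx) (u : ℕ) (s : List ℕ) : Prop :=
  Γ.A 18 u = s.length ∧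
    ∀ i < s.length, Γ.A 17 u + i < Γ.L ∧ Γ.A 19 (Γ.A 17 u + i) = s.getD i 0

/-- The arrays hold the search tree `t` at node `u`; there are `lo` strings before it. -/
def Repr (Γ : Ctx) (str : β → List ℕ) : ℕ → ℕ → PT β → Prop
  | u, _, .nil => u < Γ.L ∧ Γ.A 10 u = 2 ^ Γ.w - 1 ∧ Γ.A 15 u = 0 ∧ Γ.A 16 u = 0 ∧ Sample Γ u []
  | u, lo, .node d c x pre lt eq gt => u < Γ.L ∧ Γ.A 10 u = d ∧ Γ.A 11 u = c ∧ Γ.A 15 u = lo ∧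
      Γ.A 16 u = lo + (pre ++ (lt.ids ++ (eq.ids ++ gt.ids))).length ∧ Sample Γ u (str x) ∧
      Repr Γ str (Γ.A 12 u) (lo + pre.length) lt ∧
      Repr Γ str (Γ.A 13 u) (lo + pre.length + lt.ids.length) eq ∧
      Repr Γ str (Γ.A 14 u) (lo + pre.length + lt.ids.length + eq.ids.length) gt

/-- Walk down from node 71 along the input `b`, whose length is in register 70. -/
def descend (b : Bool) : Cmd :=
  .loop (.lt (.arr 10 (.reg 71)) (.reg 70)) (block [
    .set 72 (.inp b (.arr 10 (.reg 71))),
    .ite (.lt (.reg 72) (.arr 11 (.reg 71))) (.set 71 (.arr 12 (.reg 71)))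
      (.ite (.eq (.reg 72) (.arr 11 (.reg 71))) (.set 71 (.arr 13 (.reg 71)))
        (.set 71 (.arr 14 (.reg 71))))])

/-- Compare the input `b` with the sample of node 71; the range is put in registers 73 and 74. -/
def verify (b : Bool) : Cmd := block [
  .set 73 (.lit 0),
  .set 74 (.lit 0),
  .ite (.le (.reg 70) (.arr 18 (.reg 71))) (block [
    .set 75 (.lit 0),
    .set 76 (.lit 1),
    .loop (.lt (.reg 75) (.reg 70))
      (.ite (.eq (.arr 19 (.sum (.arr 17 (.reg 71)) (.reg 75))) (.inp b (.reg 75)))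
        (.set 75 (.sum (.reg 75) (.lit 1)))
        (block [.set 76 (.lit 0), .set 75 (.reg 70)])),
    .ite (.eq (.reg 76) (.lit 1))
      (block [.set 73 (.arr 15 (.reg 71)), .set 74 (.arr 16 (.reg 71))]) .skip]) .skip]

def locate (b : Bool) : Cmd := block [
  .set 70 (.reg (if b then 1 else 0)),
  .set 71 (.lit 0),
  descend b,
  verify b]

variable {Γ : Ctx} {str : β → List ℕ}

theorem wp_descend {b : Bool} (hp : (Γ.inp b).length < 2 ^ Γ.w) (t : PT β) :
    ∀ (u lo : ℕ) (ρ : ℕ → ℕ) (o : List ℕ), Repr Γ str u lo t → ρ 71 = u →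
      ρ 70 = (Γ.inp b).length →
      Wp Γ (descend b) ρ o fun ρ' o' n => o' = o ∧ (∀ j < 71, ρ' j = ρ j) ∧
        Repr Γ str (ρ' 71) (t.find (Γ.inp b) lo).2 (t.find (Γ.inp b) lo).1 ∧
        n ≤ 5 * t.steps (Γ.inp b) + 1 := by
  induction t with
  | nil =>
    intro u lo ρ o h h71 h70
    -- An empty tree stores the depth `2 ^ w - 1`, a sentinel that no pattern length exceeds, so the
    -- walk stops there.
    refine wp_loop_false ?_ ?_ ⟨rfl, fun _ _ => rfl, by rw [h71]; exact h, by simp [PT.steps]⟩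
    · simp [Cond.Ok, Ex.Ok, Ex.val, h71, h.1]
    · simp only [Cond.Holds, Ex.val, h71, h.2.1, h70]
      omega
  | node d c x pre lt eq gt ih₁ ih₂ ih₃ =>
    intro u lo ρ o h h71 h70
    have h' := h
    obtain ⟨hu, h10, h11, -, -, -, r1, r2, r3⟩ := h'
    have hok : (Cond.lt (.arr 10 (.reg 71)) (.reg 70)).Ok Γ ρ := by
      simp [Cond.Ok, Ex.Ok, Ex.val, h71, hu]
    by_cases hd : (Γ.inp b).length ≤ d
    · refine wp_loop_false hok ?_ ⟨rfl, fun _ _ => rfl, ?_, ?_⟩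
      · simp only [Cond.Holds, Ex.val, h71, h10, h70]
        omega
      · simpa [PT.find, hd, h71] using h
      · simp
    · refine wp_loop_true hok ?_ ?_
      · simp only [Cond.Holds, Ex.val, h71, h10, h70]
        omega
      have frame : ∀ y z : ℕ, ∀ j < 71,
          Function.update (Function.update ρ 72 y) 71 z j = ρ j := fun y z j hj => by
        rw [Function.update_of_ne (by omega), Function.update_of_ne (by omega)]
      have f70 : ∀ y z : ℕ, Function.update (Function.update ρ 72 y) 71 z 70 =
        (Γ.inp b).length := fun y z => by rw [frame _ _ _ (by omega), h70]
      simp only [wp_block_cons, wp_block_singleton, wp_set, wp_ite, Ex.Ok, Ex.val, Cond.Ok,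
        Cond.Holds, PT.find, PT.steps, if_neg hd]
      simp [h71, h10, h11, hu, not_le.1 hd]
      refine ⟨fun hc => ?_, fun hc => ⟨fun he => ?_, fun he => ?_⟩⟩
      · rw [if_pos hc, if_pos hc]
        refine (ih₁ _ _ _ o r1 (Function.update_self _ _ _) (f70 _ _)).mono ?_
        rintro ρ₁ o₁ n ⟨rfl, g1, g2, g3⟩
        exact ⟨rfl, fun j hj => (g1 j hj).trans (frame _ _ j hj), g2, by omega⟩
      · rw [if_neg (by omega), if_pos he, if_neg (by omega), if_pos he]
        refine (ih₂ _ _ _ o r2 (Function.update_self _ _ _) (f70 _ _)).mono ?_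
        rintro ρ₁ o₁ n ⟨rfl, g1, g2, g3⟩
        exact ⟨rfl, fun j hj => (g1 j hj).trans (frame _ _ j hj), g2, by omega⟩
      · rw [if_neg (by omega), if_neg he, if_neg (by omega), if_neg he]
        refine (ih₃ _ _ _ o r3 (Function.update_self _ _ _) (f70 _ _)).mono ?_
        rintro ρ₁ o₁ n ⟨rfl, g1, g2, g3⟩
        exact ⟨rfl, fun j hj => (g1 j hj).trans (frame _ _ j hj), g2, by omega⟩

-- The descent has skipped characters of the input, so its result is only a candidate. A direct
-- comparison with one sample string confirms it, or leaves the empty range `[0, 0)`.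
open Classical in
theorem wp_verify (hw : Γ.w ≠ 0) (hL : 32 * Γ.L ≤ 2 ^ Γ.w) {b : Bool} {s : List ℕ} {u : ℕ}
    {ρ : ℕ → ℕ} {o : List ℕ} (hp : (Γ.inp b).length < 2 ^ Γ.w) (hu : u < Γ.L) (hs : Sample Γ u s)
    (h71 : ρ 71 = u) (h70 : ρ 70 = (Γ.inp b).length) :
    Wp Γ (verify b) ρ o fun ρ' o' n => o' = o ∧ (∀ j < 70, ρ' j = ρ j) ∧
      ρ' 73 = (if Γ.inp b <+: s then Γ.A 15 u else 0) ∧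
      ρ' 74 = (if Γ.inp b <+: s then Γ.A 16 u else 0) ∧
      n ≤ 4 * (Γ.inp b).length + 12 := by
  obtain ⟨hlen, hs⟩ := hs
  simp only [verify, wp_block_cons, wp_block_singleton, wp_set, wp_ite, wp_skip, Ex.Ok, Ex.val,
    Cond.Ok, Cond.Holds]
  simp [h71, h70, hu, hw, hlen]
  refine ⟨fun hle => ?_, fun hlt => ?_⟩
  swap
  · have : ¬ Γ.inp b <+: s := fun h => by have := h.length_le; omega
    simp [this]
    intro j hj
    rw [Function.update_of_ne (by omega), Function.update_of_ne (by omega)]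
  refine (wp_loop (fun ρ' o' => o' = o ∧ (∀ j < 72, ρ' j = ρ j) ∧ ρ' 73 = 0 ∧ ρ' 74 = 0 ∧
    ρ' 75 ≤ (Γ.inp b).length ∧
      ((ρ' 76 = 1 ∧ ∀ i < ρ' 75, s.getD i 0 = (Γ.inp b).getD i 0) ∨
        (ρ' 76 = 0 ∧ ρ' 75 = (Γ.inp b).length ∧ ¬ Γ.inp b <+: s)))
    (fun ρ' => 4 * ((Γ.inp b).length - ρ' 75)) ?_ ?_ ?_).mono ?_
  · refine ⟨rfl, ?_, by simp, by simp, by simp, .inl ⟨by simp, by simp⟩⟩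
    intro j hj
    rw [Function.update_of_ne (by omega), Function.update_of_ne (by omega),
      Function.update_of_ne (by omega), Function.update_of_ne (by omega)]
  · intro ρ' o' _; simp [Cond.Ok, Ex.Ok]
  · rintro ρ' o' ⟨rfl, f, e73, e74, hi, hcase⟩ hc
    have f70 : ρ' 70 = (Γ.inp b).length := (f 70 (by omega)).trans h70
    have f71 : ρ' 71 = u := (f 71 (by omega)).trans h71
    simp only [Cond.Holds, Ex.val, f70] at hc
    obtain ⟨h76, hpre⟩ : ρ' 76 = 1 ∧ _ := by
      rcases hcase with h | h
      · exact h
      · omega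
    have hsi := hs (ρ' 75) (by omega)
    simp only [wp_block_cons, wp_block_singleton, wp_set, wp_ite, Ex.Ok, Ex.val, Cond.Ok,
      Cond.Holds, f71, hsi.2]
    refine ⟨by and_intros <;> first | trivial | omega, fun he => ?_, fun he => ?_⟩
    · refine ⟨by and_intros <;> first | trivial | omega, ⟨trivial, ?_, by simpa, by simpa,
        by simp; omega, .inl ⟨by simpa, ?_⟩⟩, by simp; omega⟩
      · intro j hj
        rw [Function.update_of_ne (by omega), f j hj]
      · simp only [Function.update_self]
        intro i hi'
        by_cases h : i = ρ' 75
        · rw [h]; exact he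
        · exact hpre i (by omega)
    · refine ⟨by positivity, trivial, ⟨trivial, ?_, by simpa, by simpa, by simp [f70],
        .inr ⟨by simp, by simp [f70], ?_⟩⟩, by simp [f70]; omega⟩
      · intro j hj
        rw [Function.update_of_ne (by omega), Function.update_of_ne (by omega), f j hj]
      · exact fun h => he ((isPrefix_iff_getD.1 h).2 _ hc)
  · rintro ρ' o' n ⟨⟨rfl, f, e73, e74, hi, hcase⟩, hc, hn⟩
    have f70 : ρ' 70 = (Γ.inp b).length := (f 70 (by omega)).trans h70
    have f71 : ρ' 71 = u := (f 71 (by omega)).trans h71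
    simp only [Cond.Holds, Ex.val, f70] at hc
    simp at hn
    have hiff : ρ' 76 = 1 ↔ Γ.inp b <+: s := by
      rcases hcase with ⟨h, h'⟩ | ⟨h, -, h'⟩
      · refine ⟨fun _ => isPrefix_iff_getD.2 ⟨hle, fun i hi' => h' i (by omega)⟩, fun _ => h⟩
      · exact ⟨fun h1 => by omega, fun h1 => absurd h1 h'⟩
    simp [hiff, f71, hu]
    refine ⟨fun h => ⟨?_, by simp [h], by simp [h], by omega⟩,
      fun h => ⟨?_, by simp [h, e73], by simp [h, e74], by omega⟩⟩
    · intro j hj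
      rw [Function.update_of_ne (by omega), Function.update_of_ne (by omega), f j (by omega)]
    · exact fun j hj => f j (by omega)

theorem Repr.sample {u lo : ℕ} {t : PT β} (h : Repr Γ str u lo t) : u < Γ.L ∧
    (t = .nil → Γ.A 15 u = 0 ∧ Γ.A 16 u = 0 ∧ Sample Γ u []) ∧
    ∀ d c x pre lt eq gt, t = .node d c x pre lt eq gt →
      Γ.A 15 u = lo ∧ Γ.A 16 u = lo + t.ids.length ∧ Sample Γ u (str x) := by
  cases t with
  | nil => exact ⟨h.1, fun _ => h.2.2, by simp⟩
  | node d c x pre lt eq gt =>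
    refine ⟨h.1, by simp, ?_⟩
    rintro _ _ _ _ _ _ _ ⟨⟩
    exact ⟨h.2.2.2.1, h.2.2.2.2.1, h.2.2.2.2.2.1⟩

/-- The node reached holds every string with the input as prefix, and its strings agree on whether
they have it. So the range is that of the whole node or empty, according to the sample. -/
theorem wp_locate {W : ℕ} (hw : Γ.w ≠ 0) (hL : 32 * Γ.L ≤ 2 ^ Γ.w) {b : Bool} {t : PT β}
    (hv : t.Valid str W) (hnd : t.ids.Nodup) (hR : Repr Γ str 0 0 t)
    {ρ : ℕ → ℕ} {o : List ℕ} (hp : (Γ.inp b).length < 2 ^ Γ.w)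
    (h0 : ρ (if b then 1 else 0) = (Γ.inp b).length) :
    Wp Γ (locate b) ρ o fun ρ' o' n => o' = o ∧ (∀ j < 70, ρ' j = ρ j) ∧
      ρ' 73 ≤ t.ids.length ∧ ρ' 74 ≤ t.ids.length ∧
      (∀ (i : ℕ) (hi : i < t.ids.length), ρ' 73 ≤ i ∧ i < ρ' 74 ↔ Γ.inp b <+: str t.ids[i]) ∧
      n ≤ 4 * (Γ.inp b).length + 5 * t.steps (Γ.inp b) + 15 := by
  classical
  simp only [locate, wp_block_cons, wp_block_singleton, wp_set, Ex.Ok, Ex.val]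
  refine ⟨trivial, by positivity, ?_⟩
  refine (wp_descend hp t 0 0 _ o hR (by simp) (by simp [h0])).mono ?_
  rintro ρ₁ o₁ n₁ ⟨rfl, f₁, hR₁, hn₁⟩
  have fr : ∀ j < 70, ρ₁ j = ρ j := fun j hj => by
    rw [f₁ j (by omega), Function.update_of_ne (by omega), Function.update_of_ne (by omega)]
  have f70 : ρ₁ 70 = (Γ.inp b).length := by rw [f₁ 70 (by omega)]; simp [h0]
  have hS := hR₁.sample
  have range := PT.find_range (p := Γ.inp b) t hv hnd
  have norange := PT.find_nil_range (p := Γ.inp b) t hv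
  obtain ⟨x, y, hxy, hlo⟩ := PT.find_slice (Γ.inp b) t 0
  have hlen : (t.find (Γ.inp b) 0).2 + (t.find (Γ.inp b) 0).1.ids.length ≤ t.ids.length := by
    conv_rhs => rw [hxy]
    rw [hlo]; simp
  rcases PT.find_cases (p := Γ.inp b) t 0 hv with hnil | ⟨d, c, z, pre, lt, eq, gt, hnode, -, hz, hall⟩
  · obtain ⟨e15, e16, hs⟩ := hS.2.1 hnil
    refine (wp_verify hw hL hp hS.1 hs rfl f70).mono ?_
    rintro ρ₂ o₂ n₂ ⟨rfl, f₂, r1, r2, hn₂⟩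
    rw [e15] at r1
    rw [e16] at r2
    simp at r1 r2
    refine ⟨rfl, fun j hj => (f₂ j hj).trans (fr j hj), by omega, by omega, ?_, by omega⟩
    intro i hi
    refine ⟨fun h => by omega, fun h => absurd h (norange i hi ?_)⟩
    rw [hnil]; simp [PT.ids]
  · obtain ⟨e15, e16, hs⟩ := hS.2.2 _ _ _ _ _ _ _ hnode
    refine (wp_verify hw hL hp hS.1 hs rfl f70).mono ?_
    rintro ρ₂ o₂ n₂ ⟨rfl, f₂, r1, r2, hn₂⟩
    rw [e15] at r1
    rw [e16] at r2
    refine ⟨rfl, fun j hj => (f₂ j hj).trans (fr j hj), ?_, ?_, ?_, by omega⟩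
    · rw [r1]; split_ifs <;> omega
    · rw [r2]; split_ifs <;> omega
    · intro i hi
      by_cases hpz : Γ.inp b <+: str z
      · rw [if_pos hpz] at r1 r2
        rw [r1, r2]
        exact range i hi ⟨z, hz, hpz⟩
      · rw [if_neg hpz] at r1 r2
        refine ⟨fun h => by omega, fun h => absurd h (norange i hi ?_)⟩
        rintro ⟨y, hy, hpy⟩
        exact hpz ((hall y hy).1 hpy)

end WordRAM

/-! ### The query program -/

namespace WordRAM
open Cmd DocumentListing

/-- List all documents. -/
def listAll : Cmd := block [
  .set 8 (.lit 0),
  .loop (.lt (.reg 8) (.arr 9 (.lit 0))) (block [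
    .emit (.reg 8),
    .set 8 (.sum (.reg 8) (.lit 1))])]

/-- List the documents that match both inputs, not both empty. -/
def listMatches : Cmd := block [
  locate false,
  .set 2 (.reg 73),
  .set 3 (.reg 74),
  locate true,
  .set 4 (.reg 73),
  .set 5 (.reg 74),
  .set 6 (.lit 1),
  traverse]

/-- The query algorithm; registers 0 and 1 hold the lengths of the inputs. -/
def query : Cmd := block [
  .set 7 (.lit 0),
  .ite (.eq (.reg 0) (.lit 0)) (.ite (.eq (.reg 1) (.lit 0)) (.set 7 (.lit 1)) .skip) .skip,
  .ite (.eq (.reg 7) (.lit 1)) listAll listMatches]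

variable {Γ : Ctx} {N H : ℕ} {lf : ℕ → ℕ} {ρ : ℕ → ℕ} {o : List ℕ} {β : Type}
  {str : β → List ℕ}

theorem wp_listAll (hw : Γ.w ≠ 0) (hL : 0 < Γ.L) {c : ℕ} (hc : Γ.A 9 0 = c) (hcw : c < 2 ^ Γ.w) :
    Wp Γ listAll ρ o fun _ o' n => o' = o ++ List.range c ∧ n ≤ 3 * c + 2 := by
  simp only [listAll, wp_block_cons, wp_block_singleton, wp_set, Ex.Ok, Ex.val]
  refine ⟨by positivity, (wp_loop (fun ρ' o' => ρ' 8 ≤ c ∧ o' = o ++ List.range (ρ' 8))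
    (fun ρ' => 3 * (c - ρ' 8)) ?_ ?_ ?_).mono ?_⟩
  · simp
  · intro ρ' o' _
    simp [Cond.Ok, Ex.Ok, Ex.val, hL]
  · rintro ρ' o' ⟨h, rfl⟩ hlt
    simp only [Cond.Holds, Ex.val, hc] at hlt
    simp only [wp_block_cons, wp_block_singleton, wp_set, wp_emit, Ex.Ok, Ex.val]
    refine ⟨trivial, ⟨trivial, Nat.one_lt_two_pow hw, by omega⟩, ⟨by simp; omega, ?_⟩,
      by simp; omega⟩
    simp [List.range_succ]
  · rintro ρ' o' n ⟨⟨h, rfl⟩, hge, hn⟩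
    simp only [Cond.Holds, Ex.val, hc] at hge
    simp at hn
    exact ⟨by rw [show ρ' 8 = c by omega], by omega⟩

theorem wp_listMatches (T : TreeOk Γ N H lf) {W : ℕ} {t : PT β} (hv : t.Valid str W)
    (hnd : t.ids.Nodup) (hlen : t.ids.length = N) (hR : Repr Γ str 0 0 t)
    (hp : Γ.p.length < 2 ^ Γ.w) (hq : Γ.q.length < 2 ^ Γ.w)
    (h0 : ρ 0 = Γ.p.length) (h1 : ρ 1 = Γ.q.length) :
    Wp Γ listMatches ρ o fun _ o' n => ∃ l r l' r',
      (∀ (i : ℕ) (hi : i < t.ids.length), l ≤ i ∧ i < r ↔ Γ.p <+: str t.ids[i]) ∧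
      (∀ (i : ℕ) (hi : i < t.ids.length), l' ≤ i ∧ i < r' ↔ Γ.q <+: str t.ids[i]) ∧
      r ≤ N ∧ r' ≤ N ∧
      o' = o ++ (hits (Hit lf l r l' r') H 1).map (Γ.A 8) ∧
      n ≤ 4 * Γ.p.length + 5 * t.steps Γ.p + 4 * Γ.q.length + 5 * t.steps Γ.q + 40 +
        treeCost (Hit lf l r l' r') H
          (fun v => (10 * (8 * Nat.size N + 30)) * bs (cnt H lf v N)) H 1 := by
  simp only [listMatches, wp_block_cons, wp_block_singleton, wp_set, Ex.Ok, Ex.val, true_and]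
  refine (wp_locate T.w_ne T.hL (b := false) hv hnd hR (by simpa [Ctx.inp])
    (by simpa [Ctx.inp])).mono ?_
  rintro ρ₁ o₁ n₁ ⟨rfl, f₁, a₁, b₁, c₁, hn₁⟩
  refine (wp_locate T.w_ne T.hL (b := true) hv hnd hR (by simpa [Ctx.inp])
    (by simpa [Ctx.inp, f₁])).mono ?_
  rintro ρ₂ o₂ n₂ ⟨rfl, f₂, a₂, b₂, c₂, hn₂⟩
  simp only [Ctx.inp, Bool.false_eq_true, if_false, if_true] at c₁ hn₁ c₂ hn₂
  have g2 : ρ₂ 2 = ρ₁ 73 := by rw [f₂ 2 (by omega)]; simp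
  have g3 : ρ₂ 3 = ρ₁ 74 := by rw [f₂ 3 (by omega)]; simp
  refine ⟨Nat.one_lt_two_pow T.w_ne, (wp_traverse T ?_ ?_ ?_ ?_ ?_).mono ?_⟩
  · simp
  · simp [g2]; omega
  · simp [g3]; omega
  · simp; omega
  · simp; omega
  rintro ρ₃ o₃ n₃ ⟨hn₃, ho⟩
  simp [g2, g3] at hn₃ ho
  refine ⟨_, _, _, _, c₁, c₂, by omega, by omega, ho, ?_⟩
  linarith

/-- Result of a query: all documents if both inputs are empty, and else the hits. -/
def QueryPost (Γ : Ctx) (N H : ℕ) (lf : ℕ → ℕ) (str : β → List ℕ) (t : PT β) (c : ℕ)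
    (out : List ℕ) (n : ℕ) : Prop :=
  ((Γ.p = [] ∧ Γ.q = []) ∧ out = List.range c ∧ n ≤ 3 * c + 10) ∨
    (¬ (Γ.p = [] ∧ Γ.q = []) ∧ ∃ l r l' r',
      (∀ (i : ℕ) (hi : i < t.ids.length), l ≤ i ∧ i < r ↔ Γ.p <+: str t.ids[i]) ∧
      (∀ (i : ℕ) (hi : i < t.ids.length), l' ≤ i ∧ i < r' ↔ Γ.q <+: str t.ids[i]) ∧
      r ≤ N ∧ r' ≤ N ∧
      out = (hits (Hit lf l r l' r') H 1).map (Γ.A 8) ∧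
      n ≤ 4 * Γ.p.length + 5 * t.steps Γ.p + 4 * Γ.q.length + 5 * t.steps Γ.q + 50 +
        treeCost (Hit lf l r l' r') H
          (fun v => (10 * (8 * Nat.size N + 30)) * bs (cnt H lf v N)) H 1)

theorem wp_query (T : TreeOk Γ N H lf) {W : ℕ} {t : PT β} (hv : t.Valid str W)
    (hnd : t.ids.Nodup) (hlen : t.ids.length = N) (hR : Repr Γ str 0 0 t)
    (hp : Γ.p.length < 2 ^ Γ.w) (hq : Γ.q.length < 2 ^ Γ.w)
    (h0 : ρ 0 = Γ.p.length) (h1 : ρ 1 = Γ.q.length) {c : ℕ} (hc : Γ.A 9 0 = c)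
    (hcw : c < 2 ^ Γ.w) :
    Wp Γ query ρ [] fun _ o' n => QueryPost Γ N H lf str t c o' n := by
  have hw := T.w_ne
  have hL : 0 < Γ.L := by have := T.two_le; omega
  -- Two empty patterns match empty documents as well. These have no suffix and no leaf, so this
  -- case is listed directly.
  by_cases h : Γ.p = [] ∧ Γ.q = []
  · simp only [query, wp_block_cons, wp_block_singleton, wp_set, wp_ite, wp_skip, Ex.Ok, Ex.val,
      Cond.Ok, Cond.Holds]
    simp [h0, h1, h.1, h.2, hw]
    refine (wp_listAll hw hL hc hcw).mono ?_
    rintro ρ' o' n ⟨rfl, hn⟩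
    exact .inl ⟨h, rfl, by omega⟩
  · have key : ∀ m ≤ 5, Wp Γ listMatches (Function.update ρ 7 0) [] fun _ o' n =>
        QueryPost Γ N H lf str t c o' (n + m) := fun m hm => by
      refine (wp_listMatches T hv hnd hlen hR hp hq (by simpa) (by simpa)).mono ?_
      rintro ρ' o' n ⟨l, r, l', r', e1, e2, e3, e4, e5, e6⟩
      exact .inr ⟨h, l, r, l', r', e1, e2, e3, e4, by simpa using e5, by linarith⟩
    simp only [query, wp_block_cons, wp_block_singleton, wp_set, wp_ite, wp_skip, Ex.Ok, Ex.val,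
      Cond.Ok, Cond.Holds]
    simp [h0, h1, hw]
    refine ⟨fun hp0 => ⟨fun hq0 => absurd ⟨hp0, hq0⟩ h, fun hq0 => ?_⟩, fun hp0 => ?_⟩
    · refine (key 5 le_rfl).mono fun _ _ n hn => ?_
      rwa [show 1 + (3 + (n + 1)) = n + 5 by omega]
    · refine (key 4 (by omega)).mono fun _ _ n hn => ?_
      rwa [show 1 + (2 + (n + 1)) = n + 4 by omega]

/-- The query program. -/
def queryProg : Prog := .seq (.move 2 1) query.code

theorem run_queryProg (Γ : Ctx) (hL : 32 * Γ.L ≤ 2 ^ Γ.w) (h32 : 32 < 2 ^ Γ.w)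
    {Q : List ℕ → ℕ → Prop}
    (h : ∀ ρ : ℕ → ℕ, ρ 0 = Γ.p.length → ρ 1 = Γ.q.length →
      Wp Γ query ρ [] fun _ o' n => Q o' n) :
    ∃ t n s, Γ.Run queryProg (start Γ.mem Γ.p Γ.q) t s ∧ s.mem = Γ.mem ∧ Q s.out n ∧
      t ≤ 1 + query.factor * n := by
  -- The second length arrives in register 1, a temporary, and is moved to register 2, the home of
  -- variable 1.
  set s₀ := (start Γ.mem Γ.p Γ.q).setReg 2 ((start Γ.mem Γ.p Γ.q).reg 1) with hs₀
  have hrep : Rep Γ s₀ (fun r => s₀.reg (2 * r)) [] := ⟨rfl, rfl, fun _ => rfl⟩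
  obtain ⟨n, ρ', o', hev, hq⟩ := h (fun r => s₀.reg (2 * r)) (by simp [hs₀, State.setReg, start])
    (by simp [hs₀, State.setReg, start])
  obtain ⟨t, s, hrun, hrep', ht⟩ := Cmd.run_code hL h32 hev le_rfl s₀ hrep
  refine ⟨_, n, s, .seq (.move _ _ _) hrun, hrep'.mem, ?_, by omega⟩
  rw [hrep'.out]
  exact hq

end WordRAM

namespace DocumentListing

/-! ## Existence of the data structure -/

/-- Concatenation of finite sequences. -/
theorem exists_flatten (sz : ℕ → ℕ) (f : ℕ → ℕ → ℕ) (m : ℕ) :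
    ∃ F : ℕ → ℕ, ∀ v < m, ∀ i < sz v, F ((∑ u ∈ Finset.range v, sz u) + i) = f v i := by
  induction m with
  | zero => exact ⟨fun _ => 0, by simp⟩
  | succ m ih =>
    obtain ⟨F, hF⟩ := ih
    refine ⟨fun k => if k < ∑ u ∈ Finset.range m, sz u then F k
      else f m (k - ∑ u ∈ Finset.range m, sz u), fun v hv i hi => ?_⟩
    rcases Nat.lt_succ_iff_lt_or_eq.1 hv with h | rfl
    · have h1 : (∑ u ∈ Finset.range v, sz u) + sz v ≤ ∑ u ∈ Finset.range m, sz u := by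
        rw [← Finset.sum_range_succ]
        exact Finset.sum_le_sum_of_subset (Finset.range_mono h)
      simp only
      rw [if_pos (by omega), hF v h i hi]
    · simp

/-- Double counting: a suffix lies below a node only if the node is `lf r / 2 ^ j` for some `j ≤ H`.
-/
theorem sum_cnt_le {H N : ℕ} (lf : ℕ → ℕ) (M : ℕ) :
    ∑ v ∈ Finset.range M, cnt H lf v N ≤ N * (H + 1) := by
  simp only [cnt, Nat.count_eq_card_filter_range, Finset.card_filter]
  rw [Finset.sum_comm]
  calc _ ≤ ∑ r ∈ Finset.range N, (H + 1) := by
        refine Finset.sum_le_sum fun r _ => ?_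
        rw [← Finset.card_filter]
        calc _ ≤ ((Finset.range (H + 1)).image fun j => lf r / 2 ^ j).card := by
              refine Finset.card_le_card fun v hv => ?_
              rw [Finset.mem_filter] at hv
              refine Finset.mem_image.2 ⟨ht H v, ?_, hv.2⟩
              rw [Finset.mem_range, ht]; omega
          _ ≤ _ := Finset.card_image_le.trans (by simp)
    _ = _ := by simp

/-- A table has `(√n + 2) ^ 2 ≤ 5 * n + 4` entries, so the tables take linear space on each level.
-/
theorem sum_bs_le {H N : ℕ} (lf : ℕ → ℕ) (M : ℕ) :
    ∑ v ∈ Finset.range M, (bs (cnt H lf v N) + 1) ^ 2 ≤ 5 * (N * (H + 1)) + 4 * M := by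
  calc _ ≤ ∑ v ∈ Finset.range M, (5 * cnt H lf v N + 4) := by
        refine Finset.sum_le_sum fun v _ => ?_
        have h1 := Nat.sqrt_le (cnt H lf v N)
        have h2 := Nat.sqrt_le_self (cnt H lf v N)
        rw [bs]
        nlinarith
    _ ≤ _ := by
        rw [Finset.sum_add_distrib, ← Finset.mul_sum]
        have := sum_cnt_le (H := H) (N := N) lf M
        simp; omega

theorem sum_add_le {sz : ℕ → ℕ} {v m : ℕ} (h : v < m) :
    (∑ u ∈ Finset.range v, sz u) + sz v ≤ ∑ u ∈ Finset.range m, sz u := by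
  rw [← Finset.sum_range_succ]
  exact Finset.sum_le_sum_of_subset (Finset.range_mono h)

theorem skipNode_le (v : ℕ) : skipNode v ≤ v + 1 := by
  induction v using Nat.strong_induction_on with
  | _ v ih =>
    rw [skipNode]
    split_ifs
    · omega
    · omega
    · have := ih (v / 2) (by omega); omega

open Classical in
/-- Table entry: end of the first block from `j'` on with a document of block `j`. -/
noncomputable def tabEntry (H : ℕ) (lf : ℕ → ℕ) (v n j j' : ℕ) : ℕ :=
  if h : ∃ e, j' ≤ e ∧ e * bs n + bs n ≤ n ∧ Share H lf v n j e then
    Nat.find h * bs n + bs n else n + 1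

theorem tabEntry_le (H : ℕ) (lf : ℕ → ℕ) (v n j j' : ℕ) : tabEntry H lf v n j j' ≤ n + 1 := by
  classical
  unfold tabEntry
  split_ifs with h
  · have := (Nat.find_spec h).2.1; omega
  · exact le_rfl

/-- Storing the end of the first suitable block answers the question for every bound `b` at once.
The default `n + 1` exceeds each admissible `b`. -/
theorem tabEntry_le_iff {H : ℕ} {lf : ℕ → ℕ} {v n j j' b : ℕ} (hb : b ≤ n) :
    tabEntry H lf v n j j' ≤ b ↔ ∃ e, j' ≤ e ∧ e * bs n + bs n ≤ b ∧ Share H lf v n j e := by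
  classical
  unfold tabEntry
  split_ifs with h
  · constructor
    · intro hle
      exact ⟨_, (Nat.find_spec h).1, hle, (Nat.find_spec h).2.2⟩
    · rintro ⟨e, h1, h2, h3⟩
      have := Nat.find_min' h ⟨h1, by omega, h3⟩
      have := Nat.mul_le_mul_right (bs n) this
      omega
  · refine ⟨fun h' => by omega, fun ⟨e, h1, h2, h3⟩ => absurd ⟨e, h1, by omega, h3⟩ h⟩

end DocumentListing

namespace WordRAM
open DocumentListing

/-- Arrays 10 to 18 of a node record. -/
def record (d c l e g lo hi tp len : ℕ) (j : ℕ) : ℕ :=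
  if j = 10 then d else if j = 11 then c else if j = 12 then l else if j = 13 then e
  else if j = 14 then g else if j = 15 then lo else if j = 16 then hi
  else if j = 17 then tp else if j = 18 then len else 0

theorem record_lt {d c l e g lo hi tp len j W : ℕ} (h0 : d < W) (h1 : c < W) (h2 : l < W)
    (h3 : e < W) (h4 : g < W) (h5 : lo < W) (h6 : hi < W) (h7 : tp < W) (h8 : len < W) :
    record d c l e g lo hi tp len j < W := by
  unfold record
  split_ifs <;> omega

/-- Nodes are laid out in preorder, each subtree filling an interval of length `size`. The cells `F`
are fixed before the context, so they can be combined with the other arrays later. -/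
theorem exists_repr {β : Type} {str : β → List ℕ} {w L : ℕ} (hL : L < 2 ^ w) (tp : β → ℕ)
    (htp : ∀ x, tp x < 2 ^ w) (hstr : ∀ x, (str x).length < 2 ^ w) (t : PT β) :
    ∀ base lo, t.Valid str (2 ^ w) → base + t.size ≤ L → lo + t.ids.length < 2 ^ w →
    ∃ F : ℕ → ℕ → ℕ, (∀ j u, F j u < 2 ^ w) ∧ ∀ Γ : Ctx, Γ.w = w → Γ.L = L →
      (∀ u, base ≤ u → u < base + t.size → ∀ j, 10 ≤ j → j ≤ 18 → Γ.A j u = F j u) →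
      (∀ x, ∀ i < (str x).length, tp x + i < L ∧ Γ.A 19 (tp x + i) = (str x).getD i 0) →
      Repr Γ str base lo t := by
  induction t with
  | nil =>
    intro base lo _ hb _
    have hW : 0 < 2 ^ w := by positivity
    refine ⟨fun j _ => record (2 ^ w - 1) 0 0 0 0 0 0 0 0 j, fun j u => ?_, ?_⟩
    · exact record_lt (by omega) hW hW hW hW hW hW hW hW
    · rintro Γ rfl rfl hA _
      simp only [PT.size] at hb hA
      have hA' := hA base le_rfl (by omega)
      refine ⟨by omega, ?_, ?_, ?_, ?_, by simp⟩ <;>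
        · rw [hA' _ (by omega) (by omega)]; simp [record]
  | node d c x pre lt eq gt ih₁ ih₂ ih₃ =>
    intro base lo hv hb hlo
    obtain ⟨⟨-, hd, hc⟩, -, -, -, -, -, v1, v2, v3⟩ := hv
    simp only [PT.size] at hb
    simp only [PT.ids, List.length_append] at hlo
    obtain ⟨F1, b1, r1⟩ := ih₁ (base + 1) (lo + pre.length) v1 (by omega) (by omega)
    obtain ⟨F2, b2, r2⟩ := ih₂ (base + 1 + lt.size) (lo + pre.length + lt.ids.length) v2
      (by omega) (by omega)
    obtain ⟨F3, b3, r3⟩ := ih₃ (base + 1 + lt.size + eq.size)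
      (lo + pre.length + lt.ids.length + eq.ids.length) v3 (by omega) (by omega)
    have hx := hstr x
    refine ⟨fun j u => if u = base then record d c (base + 1) (base + 1 + lt.size)
        (base + 1 + lt.size + eq.size) lo
        (lo + (pre ++ (lt.ids ++ (eq.ids ++ gt.ids))).length) (tp x) (str x).length j
      else if u < base + 1 + lt.size then F1 j u
      else if u < base + 1 + lt.size + eq.size then F2 j u else F3 j u, fun j u => ?_, ?_⟩
    · simp only
      split_ifs
      · refine record_lt (by omega) hc (by omega) (by omega) (by omega) (by omega) ?_ (htp x) hx
        simp only [List.length_append]; omega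
      · exact b1 _ _
      · exact b2 _ _
      · exact b3 _ _
    · rintro Γ rfl rfl hA htext
      simp only [PT.size] at hA
      have hA' := hA base le_rfl (by omega)
      have a12 : Γ.A 12 base = base + 1 := by rw [hA' _ (by omega) (by omega)]; simp [record]
      have a13 : Γ.A 13 base = base + 1 + lt.size := by
        rw [hA' _ (by omega) (by omega)]; simp [record]
      have a14 : Γ.A 14 base = base + 1 + lt.size + eq.size := by
        rw [hA' _ (by omega) (by omega)]; simp [record]
      have a17 : Γ.A 17 base = tp x := by
        rw [hA' _ (by omega) (by omega)]; simp [record]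
      refine ⟨by omega, ?_, ?_, ?_, ?_, ⟨?_, ?_⟩, ?_, ?_, ?_⟩
      · rw [hA' _ (by omega) (by omega)]; simp [record]
      · rw [hA' _ (by omega) (by omega)]; simp [record]
      · rw [hA' _ (by omega) (by omega)]; simp [record]
      · rw [hA' _ (by omega) (by omega)]; simp [record]
      · rw [hA' _ (by omega) (by omega)]; simp [record]
      · rw [a17]; exact htext x
      · rw [a12]
        refine r1 Γ rfl rfl (fun u h1 h2 j h3 h4 => ?_) htext
        rw [hA u (by omega) (by omega) j h3 h4, if_neg (by omega), if_pos (by omega)]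
      · rw [a13]
        refine r2 Γ rfl rfl (fun u h1 h2 j h3 h4 => ?_) htext
        rw [hA u (by omega) (by omega) j h3 h4, if_neg (by omega), if_neg (by omega),
          if_pos (by omega)]
      · rw [a14]
        refine r3 Γ rfl rfl (fun u h1 h2 j h3 h4 => ?_) htext
        rw [hA u (by omega) (by omega) j h3 h4, if_neg (by omega), if_neg (by omega),
          if_neg (by omega)]

/-- The arrays of the document tree. -/
theorem exists_treeOk {w N H L c : ℕ} {lf : ℕ → ℕ} (hN : 2 ≤ N) (hH : 2 ^ H ≤ 2 * N)
    (hL : L = 40 * (N * (H + 1))) (hw : 32 * L ≤ 2 ^ w) (hc : c < 2 ^ w)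
    (hlf : ∀ r < N, 2 ^ H ≤ lf r ∧ lf r < 2 ^ (H + 1)) (docId : ℕ → ℕ) (G : ℕ → ℕ → ℕ) :
    ∃ A : ℕ → ℕ → ℕ, (∀ j a, A j a < 2 ^ w) ∧ (∀ p q, TreeOk ⟨w, L, p, q, A⟩ N H lf) ∧
      A 9 0 = c ∧ (∀ y, A 8 y = docId y % 2 ^ w) ∧
      ∀ j, 10 ≤ j → ∀ u, A j u = G j u % 2 ^ w := by
  have hNH : N ≤ N * (H + 1) := Nat.le_mul_of_pos_right _ (by omega)
  have hM : 2 ^ (H + 1) ≤ 4 * N := by rw [pow_succ]; omega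
  have s1 := sum_cnt_le (H := H) (N := N) lf (2 ^ (H + 1))
  -- With `2 ^ (H + 1) ≤ 4 * N` the tables need at most `21 * (N * (H + 1))` cells, within the
  -- common array length `L`.
  have s2 := sum_bs_le (H := H) (N := N) lf (2 ^ (H + 1))
  have hcn : ∀ v, cnt H lf v N ≤ N := fun v => cnt_le
  obtain ⟨R, hR⟩ := exists_flatten (fun v => cnt H lf v N) (rk H lf) (2 ^ (H + 1))
  obtain ⟨X, hX⟩ := exists_flatten (fun v => (bs (cnt H lf v N) + 1) ^ 2)
    (fun v k => tabEntry H lf v (cnt H lf v N) (k / (bs (cnt H lf v N) + 1))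
      (k % (bs (cnt H lf v N) + 1))) (2 ^ (H + 1))
  -- Entries are reduced modulo `2 ^ w` to make every cell a word; those that are ever read are
  -- small enough to be unaffected.
  let raw : ℕ → ℕ → ℕ := fun j a =>
    if j = 0 then R a else if j = 1 then ∑ u ∈ Finset.range a, cnt H lf u N
    else if j = 2 then cnt H lf a N else if j = 3 then bs (cnt H lf a N)
    else if j = 4 then ∑ u ∈ Finset.range a, (bs (cnt H lf u N) + 1) ^ 2
    else if j = 5 then X a else if j = 6 then lf a else if j = 7 then skipNode a
    else if j = 8 then docId a else if j = 9 then (if a = 0 then c else 2 ^ H) else G j a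
  refine ⟨fun j a => raw j a % 2 ^ w, fun j a => Nat.mod_lt _ (by positivity), fun p q => ?_,
    ?_, fun y => by simp [raw], fun j hj u => ?_⟩
  · have a1 : ∀ v < 2 ^ (H + 1), raw 1 v % 2 ^ w = ∑ u ∈ Finset.range v, cnt H lf u N :=
      fun v hv => by
        have := sum_add_le (sz := fun v => cnt H lf v N) hv
        exact Nat.mod_eq_of_lt (by simp only [raw]; simp; omega)
    have a4 : ∀ v < 2 ^ (H + 1), raw 4 v % 2 ^ w =
        ∑ u ∈ Finset.range v, (bs (cnt H lf u N) + 1) ^ 2 :=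
      fun v hv => by
        have := sum_add_le (sz := fun v => (bs (cnt H lf v N) + 1) ^ 2) hv
        exact Nat.mod_eq_of_lt (by simp only [raw]; simp; omega)
    constructor
    · show 32 < 2 ^ w
      omega
    · exact hw
    · show N ≤ L
      omega
    · show 2 ^ (H + 1) ≤ L
      omega
    · show 2 ≤ L
      omega
    · exact hlf
    · intro v h1 h2
      show raw 1 v % 2 ^ w + _ ≤ L
      rw [a1 v h2]
      have := sum_add_le (sz := fun v => cnt H lf v N) h2
      omega
    · intro v h1 h2 i hi
      show raw 0 (raw 1 v % 2 ^ w + i) % 2 ^ w = _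
      rw [a1 v h2]
      have := rk_lt hi
      have e : raw 0 (∑ u ∈ Finset.range v, cnt H lf u N + i) = rk H lf v i := by
        simp only [raw, if_true]
        exact hR v h2 i hi
      rw [e, Nat.mod_eq_of_lt (by omega)]
    · intro v h1 h2
      have := hcn v
      exact Nat.mod_eq_of_lt (by simp only [raw]; simp; omega)
    · intro v h1 h2
      have := hcn v
      have := bs_le (cnt H lf v N)
      exact Nat.mod_eq_of_lt (by simp only [raw]; simp; omega)
    · intro v h1 h2
      show raw 4 v % 2 ^ w + _ ≤ L
      rw [a4 v h2]
      have := sum_add_le (sz := fun v => (bs (cnt H lf v N) + 1) ^ 2) h2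
      omega
    · intro v h1 h2 j j' b hj hj' hb
      show raw 5 (raw 4 v % 2 ^ w + _) % 2 ^ w ≤ b ↔ _
      rw [a4 v h2, ← tabEntry_le_iff hb]
      have hk : j * (bs (cnt H lf v N) + 1) + j' < (bs (cnt H lf v N) + 1) ^ 2 := by
        rw [pow_two]
        calc _ < j * (bs (cnt H lf v N) + 1) + 1 * (bs (cnt H lf v N) + 1) := by omega
          _ = (j + 1) * (bs (cnt H lf v N) + 1) := by ring
          _ ≤ _ := Nat.mul_le_mul_right _ hj
      have e := hX v h2 _ hk
      -- Quotient and remainder by `bs + 1` recover row and column from the flattened index.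
      rw [Nat.mul_comm j, Nat.mul_add_div (by omega), Nat.mul_add_mod, Nat.mod_eq_of_lt hj',
        Nat.div_eq_of_lt hj'] at e
      change _ = tabEntry H lf v (cnt H lf v N) j j' at e
      have e' : raw 5 (∑ u ∈ Finset.range v, (bs (cnt H lf u N) + 1) ^ 2 +
          (j * (bs (cnt H lf v N) + 1) + j')) = tabEntry H lf v (cnt H lf v N) j j' := by
        rw [← e, Nat.mul_comm j]; simp [raw]
      have := tabEntry_le H lf v (cnt H lf v N) j j'
      have := hcn v
      rw [e', Nat.mod_eq_of_lt (by omega)]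
    · intro r hr
      have := hlf r hr
      exact Nat.mod_eq_of_lt (by simp only [raw]; simp; omega)
    · intro v h1 h2
      have := skipNode_le v
      exact Nat.mod_eq_of_lt (by simp only [raw]; simp; omega)
    · show raw 9 1 % 2 ^ w = _
      have : raw 9 1 = 2 ^ H := by simp [raw]
      rw [this, Nat.mod_eq_of_lt (by omega)]
  · show raw 9 0 % 2 ^ w = c
    have : raw 9 0 = c := by simp [raw]
    rw [this, Nat.mod_eq_of_lt hc]
  · show raw j u % 2 ^ w = _
    have : raw j u = G j u := by
      simp only [raw]
      repeat rw [if_neg (by omega)]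
    rw [this]

end WordRAM

/-! ### The index of a collection of documents -/

namespace DocumentListing
open WordRAM

variable {c : ℕ}

/-- The nonempty suffixes of the documents. -/
abbrev Suffix (docs : Fin c → List ℕ) : Type := Σ i : Fin c, Fin (docs i).length

def Suffix.str {docs : Fin c → List ℕ} (x : Suffix docs) : List ℕ := (docs x.1).drop x.2

/-- Length of document number `u`. -/
def docLength (docs : Fin c → List ℕ) (u : ℕ) : ℕ :=
  if h : u < c then (docs ⟨u, h⟩).length else 0

/-- Start of document number `u` in the concatenation of all documents. -/
def docStart (docs : Fin c → List ℕ) (u : ℕ) : ℕ := ∑ v ∈ Finset.range u, docLength docs v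

theorem docLength_coe (docs : Fin c → List ℕ) (i : Fin c) :
    docLength docs i = (docs i).length := by simp [docLength]

theorem docStart_add_le (docs : Fin c → List ℕ) (i : Fin c) :
    docStart docs i + (docs i).length ≤ totalLength docs := by
  have h := sum_add_le (sz := docLength docs) i.2
  rw [docLength_coe] at h
  refine h.trans (le_of_eq ?_)
  rw [Finset.sum_range, totalLength]
  exact Finset.sum_congr rfl fun i _ => docLength_coe docs i

/-- Nonempty documents start at distinct positions of the concatenation. So starting positions can
number the leaves, and the tree size depends on `N` even if `c` is much larger because of empty
documents. -/
theorem docStart_injOn (docs : Fin c → List ℕ) {i j : Fin c} (hi : docs i ≠ []) (hj : docs j ≠ [])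
    (h : docStart docs i = docStart docs j) : i = j := by
  have key : ∀ i j : Fin c, docs i ≠ [] → i < j → docStart docs i < docStart docs j := by
    intro i j hi hij
    have h1 := sum_add_le (sz := docLength docs) (show (i : ℕ) < j from hij)
    rw [docLength_coe] at h1
    have := List.length_pos_iff.2 hi
    unfold docStart
    omega
  rcases lt_trichotomy i j with h1 | h1 | h1
  · have := key i j hi h1; omega
  · exact h1
  · have := key j i hj h1; omega

/-- Nonemptiness matters for the empty pattern only, which must be a prefix of some nonempty suffix.
-/
theorem infix_iff_suffix (docs : Fin c → List ℕ) (i : Fin c) (hi : docs i ≠ []) (p : List ℕ) :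
    p <:+: docs i ↔ ∃ k : Fin (docs i).length, p <+: (docs i).drop k := by
  constructor
  · rintro ⟨s, t, h⟩
    by_cases hp : p = []
    · exact ⟨⟨0, List.length_pos_iff.2 hi⟩, by simp [hp]⟩
    · have hlen := congrArg List.length h
      have := List.length_pos_iff.2 hp
      simp only [List.length_append] at hlen
      refine ⟨⟨s.length, by omega⟩, t, ?_⟩
      show p ++ t = (docs i).drop s.length
      rw [← h, List.append_assoc, List.drop_left]
  · rintro ⟨k, h⟩
    exact h.isInfix.trans (List.drop_suffix _ _).isInfix

/-- The data structure for a collection of documents. -/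
structure Index (docs : Fin c → List ℕ) (w N L : ℕ) where
  A : ℕ → ℕ → ℕ
  t : PT (Suffix docs)
  lf : ℕ → ℕ
  leaf : Fin c → ℕ
  A_lt : ∀ j a, A j a < 2 ^ w
  valid : t.Valid Suffix.str (2 ^ w)
  nodup : t.ids.Nodup
  length : t.ids.length = N
  mem : ∀ x, x ∈ t.ids
  steps : ∀ p : List ℕ, t.steps p ≤ p.length + Nat.size N
  lf_eq : ∀ (i : ℕ) (hi : i < t.ids.length), lf i = leaf t.ids[i].1
  leaf_inj : ∀ i j, docs i ≠ [] → docs j ≠ [] → leaf i = leaf j → i = j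
  docId : ∀ i, docs i ≠ [] → A 8 (leaf i) = i
  count : A 9 0 = c
  tree : ∀ p q, TreeOk ⟨w, L, p, q, A⟩ N (Nat.size N) lf
  repr : ∀ p q, Repr ⟨w, L, p, q, A⟩ Suffix.str 0 0 t

theorem exists_index {w N : ℕ} (docs : Fin c → List ℕ) (hN : N = totalLength docs) (h2 : 2 ≤ N)
    (hw : 32 * (40 * (N * (Nat.size N + 1))) ≤ 2 ^ w) (hc : c < 2 ^ w)
    (hchar : ∀ i, ∀ x ∈ docs i, x < 2 ^ w) :
    Nonempty (Index docs w N (40 * (N * (Nat.size N + 1)))) := by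
  classical
  set H := Nat.size N with hH
  set L := 40 * (N * (H + 1)) with hL
  have hNH : N ≤ N * (H + 1) := Nat.le_mul_of_pos_right _ (by omega)
  -- Together with `N < 2 ^ H` this makes the tree large enough for all starting positions and still
  -- linear in size.
  have hH1 : 2 ^ H ≤ 2 * N := by
    have h3 : 0 < H := Nat.size_pos.2 (by omega)
    have : 2 ^ (H - 1) ≤ N := Nat.lt_size.1 (by omega)
    have h4 : 2 ^ H = 2 * 2 ^ (H - 1) := by
      rw [← pow_succ']; congr 1; omega
    omega
  have hH2 : N < 2 ^ H := Nat.lt_size_self N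
  have hW : 0 < 2 ^ w := by positivity
  have hstart : ∀ i : Fin c, docStart docs i + (docs i).length ≤ N := fun i => hN ▸ docStart_add_le docs i
  have hlen : ∀ x : Suffix docs, x.str.length = (docs x.1).length - x.2 := fun x => by
    simp [Suffix.str]
  obtain ⟨t, hv, hperm, hsize, -, hsteps⟩ := PT.exists_tree (Suffix.str (docs := docs)) (2 ^ w) hW
    (fun x a ha => hchar x.1 a (List.mem_of_mem_drop ha)) _ (Finset.univ.toList) 0 le_rfl
    (fun x _ y _ => by simp)
  have hcard : (Finset.univ : Finset (Suffix docs)).toList.length = N := by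
    rw [Finset.length_toList, Finset.card_univ, Fintype.card_sigma, hN, totalLength]
    simp
  rw [hcard] at hsize hsteps
  have hids : t.ids.length = N := hperm.length_eq.trans hcard
  obtain ⟨X, hX⟩ := exists_flatten (docLength docs)
    (fun u k => if h : u < c then (docs ⟨u, h⟩).getD k 0 else 0) c
  obtain ⟨F, hF, hrepr⟩ := exists_repr (str := Suffix.str (docs := docs)) (w := w) (L := L)
    (by omega) (fun x => docStart docs x.1 + x.2)
    (fun x => by have := hstart x.1; have := x.2.2; omega)
    (fun x => by have := hstart x.1; rw [hlen]; omega) t 0 0 hv (by omega) (by omega)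
  let lf : ℕ → ℕ := fun i => if h : i < t.ids.length then 2 ^ H + docStart docs t.ids[i].1 else 0
  have hlf : ∀ (i : ℕ) (hi : i < t.ids.length), lf i = 2 ^ H + docStart docs t.ids[i].1 :=
    fun i hi => by simp [lf, hi]
  have hne : ∀ x : Suffix docs, 0 < (docs x.1).length := fun x => by
    have := x.2.2; omega
  obtain ⟨A, hA, htree, h9, h8, hG⟩ := exists_treeOk (w := w) (N := N) (H := H) (L := L) (c := c)
    (lf := lf) h2 hH1 hL hw hc (fun r hr => by
      have := hstart (t.ids[r]'(by omega)).1
      have := hne (t.ids[r]'(by omega))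
      rw [hlf r (by omega), pow_succ]
      omega)
    (fun y => if h : ∃ i : Fin c, docs i ≠ [] ∧ y = 2 ^ H + docStart docs i then
      (h.choose : ℕ) else 0)
    (fun j => if j = 19 then X else F j)
  refine ⟨⟨A, t, lf, fun i => 2 ^ H + docStart docs i, hA, hv,
    hperm.nodup_iff.2 (Finset.nodup_toList _), hids, fun x => hperm.mem_iff.2 (by simp),
    fun p => by simpa using hsteps p, hlf, fun i j hi hj h => docStart_injOn docs hi hj (by omega),
    fun i hi => ?_, h9, htree, fun p q => ?_⟩⟩
  · rw [h8]
    have hex : ∃ j : Fin c, docs j ≠ [] ∧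
        2 ^ H + docStart docs i = 2 ^ H + docStart docs j := ⟨i, hi, rfl⟩
    rw [dif_pos hex]
    have := docStart_injOn docs hi hex.choose_spec.1 (by have := hex.choose_spec.2; omega)
    rw [← this, Nat.mod_eq_of_lt (by have := i.2; omega)]
  · refine hrepr _ rfl rfl (fun u _ _ j h10 h18 => ?_) (fun x i hi => ?_)
    · show A j u = F j u
      rw [hG j h10, if_neg (by omega), Nat.mod_eq_of_lt (hF j u)]
    · have h1 := hstart x.1
      rw [hlen] at hi
      refine ⟨by omega, ?_⟩
      show A 19 _ = _
      -- The sample of suffix `(i, k)` is read from the concatenated text at `docStart i + k`; no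
      -- suffix is stored separately.
      have h2 := hX x.1 x.1.2 (x.2 + i) (by rw [docLength_coe]; omega)
      simp only [Fin.is_lt, dif_pos, Fin.eta] at h2
      rw [hG 19 (by omega), if_pos rfl, Nat.add_assoc]
      unfold docStart
      rw [h2, List.getD_eq_getElem _ _ (show x.2 + i < (docs x.1).length by omega),
        Nat.mod_eq_of_lt (hchar _ _ (List.getElem_mem _)), Suffix.str,
        List.getD_eq_getElem _ _ (by simp; omega)]
      simp

/-! ### Correctness and cost of a query -/

variable {docs : Fin c → List ℕ} {w N L : ℕ}

/-- A document contains a pattern exactly if one of its suffixes has a rank in the range of the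
pattern. Equal leaves mean equal documents, so both ranges speak of the same document. -/
theorem Index.mem_hits_iff (I : Index docs w N L) {p q : List ℕ}
    {l r l' r' : ℕ} (hl : ∀ (i : ℕ) (hi : i < I.t.ids.length), l ≤ i ∧ i < r ↔ p <+: I.t.ids[i].str)
    (hl' : ∀ (i : ℕ) (hi : i < I.t.ids.length), l' ≤ i ∧ i < r' ↔ q <+: I.t.ids[i].str)
    (hr : r ≤ N) (hr' : r' ≤ N) (y : ℕ) :
    y ∈ hits (Hit I.lf l r l' r') (Nat.size N) 1 ↔
      ∃ i ∈ matching docs p q, docs i ≠ [] ∧ I.leaf i = y := by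
  have hlen := I.length
  have T := I.tree [] []
  have hu : ∀ r < N, Under (Nat.size N) 1 (I.lf r) := fun r hr => by
    have h := T.lf_mem r hr
    rw [under_iff (j := Nat.size N) (by simp)]
    rw [pow_succ] at h
    exact Nat.div_eq_of_lt_le (by omega) (by omega)
  rw [mem_hits (H := Nat.size N) (by simp)]
  have hne : ∀ x : Suffix docs, docs x.1 ≠ [] := fun x h => by
    have := x.2.2
    have h0 : (docs x.1).length = 0 := by rw [h]; rfl
    omega
  constructor
  · rintro ⟨-, ⟨x, h1, h2, h3⟩, x', h4, h5, h6⟩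
    have g := (hl x (by omega)).1 ⟨h1, h2⟩
    have g' := (hl' x' (by omega)).1 ⟨h4, h5⟩
    rw [I.lf_eq x (by omega)] at h3
    rw [I.lf_eq x' (by omega)] at h6
    have e := I.leaf_inj _ _ (hne _) (hne _) (h3.trans h6.symm)
    refine ⟨(I.t.ids[x]'(by omega)).1, ?_, hne _, h3⟩
    simp only [matching, Finset.mem_filter, Finset.mem_univ, true_and]
    refine ⟨(infix_iff_suffix docs _ (hne _) p).2 ⟨_, g⟩, ?_⟩
    rw [e]
    exact (infix_iff_suffix docs _ (hne _) q).2 ⟨_, g'⟩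
  · rintro ⟨i, hi, hdi, rfl⟩
    simp only [matching, Finset.mem_filter, Finset.mem_univ, true_and] at hi
    obtain ⟨k, hk⟩ := (infix_iff_suffix docs i hdi p).1 hi.1
    obtain ⟨k', hk'⟩ := (infix_iff_suffix docs i hdi q).1 hi.2
    obtain ⟨x, hx, ex⟩ := List.getElem_of_mem (I.mem ⟨i, k⟩)
    obtain ⟨x', hx', ex'⟩ := List.getElem_of_mem (I.mem ⟨i, k'⟩)
    have e : I.lf x = I.leaf i := by rw [I.lf_eq x hx, ex]
    have e' : I.lf x' = I.leaf i := by rw [I.lf_eq x' hx', ex']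
    have g := (hl x hx).2 (by rw [ex]; exact hk)
    have g' := (hl' x' hx').2 (by rw [ex']; exact hk')
    exact ⟨e ▸ hu x (by omega), ⟨x, g.1, g.2, e⟩, x', g'.1, g'.2, e'⟩

theorem ne_nil_of_mem_matching {p q : List ℕ} (hpq : ¬ (p = [] ∧ q = [])) {i : Fin c}
    (hi : i ∈ matching docs p q) : docs i ≠ [] := by
  intro h
  simp only [matching, Finset.mem_filter, Finset.mem_univ, true_and, h, List.infix_nil] at hi
  exact hpq hi

/-- A query lists the matching documents. -/
theorem Index.output (I : Index docs w N L) {p q : List ℕ} {out : List ℕ} {n : ℕ}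
    (h : QueryPost ⟨w, L, p, q, I.A⟩ N (Nat.size N) I.lf Suffix.str I.t c out n) :
    out.Nodup ∧ (∀ j : ℕ, j ∈ out ↔ ∃ i ∈ matching docs p q, (i : ℕ) = j) ∧
      (n ≤ 3 * (matching docs p q).card + 10 ∨
        ∃ K : ℕ → Prop, (hits K (Nat.size N) 1).length = (matching docs p q).card ∧
          n ≤ 9 * (p.length + q.length) + 10 * Nat.size N + 50 + treeCost K (Nat.size N)
            (fun v => (10 * (8 * Nat.size N + 30)) * bs (cnt (Nat.size N) I.lf v N))
            (Nat.size N) 1) := by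
  classical
  rcases h with ⟨⟨hp, hq⟩, rfl, hn⟩ | ⟨hpq, l, r, l', r', h1, h2, h3, h4, rfl, hn⟩
  · simp only at hp hq
    subst hp hq
    have hm : matching docs [] [] = Finset.univ := by ext; simp [matching]
    rw [hm]
    refine ⟨List.nodup_range, fun j => ?_, .inl (by simpa using hn)⟩
    simp only [List.mem_range, Finset.mem_univ, true_and]
    exact ⟨fun hj => ⟨⟨j, hj⟩, rfl⟩, fun ⟨i, hi⟩ => hi ▸ i.2⟩
  · simp only at hpq h1 h2 hn
    have hmem := I.mem_hits_iff h1 h2 h3 h4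
    have hnd := hits_nodup (Hit I.lf l r l' r') (Nat.size N) 1
    refine ⟨?_, fun j => ?_, .inr ⟨Hit I.lf l r l' r', ?_, hn.trans ?_⟩⟩
    · refine hnd.map_on fun x hx y hy hxy => ?_
      obtain ⟨i, -, hi, rfl⟩ := (hmem x).1 hx
      obtain ⟨i', -, hi', rfl⟩ := (hmem y).1 hy
      simp only [I.docId i hi, I.docId i' hi'] at hxy
      rw [Fin.ext hxy]
    · simp only [List.mem_map]
      constructor
      · rintro ⟨y, hy, rfl⟩
        obtain ⟨i, hm, hi, rfl⟩ := (hmem y).1 hy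
        exact ⟨i, hm, (I.docId i hi).symm⟩
      · rintro ⟨i, hm, rfl⟩
        have hi := ne_nil_of_mem_matching hpq hm
        exact ⟨I.leaf i, (hmem _).2 ⟨i, hm, hi, rfl⟩, I.docId i hi⟩
    -- The number of hits equals the output size, as matching documents correspond injectively to
    -- their leaves.
    · rw [← List.toFinset_card_of_nodup hnd]
      have : (hits (Hit I.lf l r l' r') (Nat.size N) 1).toFinset =
          (matching docs p q).image I.leaf := by
        ext y
        rw [List.mem_toFinset, hmem, Finset.mem_image]
        constructor
        · rintro ⟨i, hm, -, hi⟩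
          exact ⟨i, hm, hi⟩
        · rintro ⟨i, hm, hi⟩
          exact ⟨i, hm, ne_nil_of_mem_matching hpq hm, hi⟩
      rw [this, Finset.card_image_of_injOn]
      intro i hi j hj hij
      exact I.leaf_inj i j (ne_nil_of_mem_matching hpq hi) (ne_nil_of_mem_matching hpq hj) hij
    · have := I.steps p
      have := I.steps q
      refine Nat.add_le_add_right ?_ _
      omega

theorem size_le_logb {N : ℕ} (h : 2 ≤ N) :
    (Nat.size N : ℝ) ≤ 2 * Real.logb 2 N ∧ 1 ≤ Real.logb 2 N := by
  have h1 : (Nat.log 2 N : ℝ) ≤ Real.logb 2 N := by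
    exact_mod_cast Real.natLog_le_logb N 2
  have h2 : Nat.size N ≤ Nat.log 2 N + 1 := by
    rw [Nat.size_le]
    exact Nat.lt_pow_succ_log_self (by norm_num) N
  have h3 : 1 ≤ Nat.log 2 N := Nat.le_log_of_pow_le (by norm_num) (by simpa using h)
  have h2' : (Nat.size N : ℝ) ≤ Nat.log 2 N + 1 := by exact_mod_cast h2
  have h3' : (1 : ℝ) ≤ Nat.log 2 N := by exact_mod_cast h3
  constructor <;> linarith

/-- The cost of a query in closed form. -/
theorem query_cost_le {N n a k : ℕ} {lf : ℕ → ℕ} (h2 : 2 ≤ N)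
    (h : n ≤ 3 * k + 10 ∨ ∃ K : ℕ → Prop, (hits K (Nat.size N) 1).length = k ∧
      n ≤ 9 * a + 10 * Nat.size N + 50 + treeCost K (Nat.size N)
        (fun v => (10 * (8 * Nat.size N + 30)) * bs (cnt (Nat.size N) lf v N)) (Nat.size N) 1) :
    (n : ℝ) ≤ 9300 * (a + (√(N * Real.logb 2 N * max 1 (k : ℝ)) + k) * Real.logb 2 N ^ 2) ∧
      1 ≤ (√(N * Real.logb 2 N * max 1 (k : ℝ)) + k) * Real.logb 2 N ^ 2 := by
  obtain ⟨hs, hlg⟩ := size_le_logb h2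
  have hN : (2 : ℝ) ≤ N := by exact_mod_cast h2
  have hk : (0 : ℝ) ≤ k := by positivity
  have ha : (0 : ℝ) ≤ a := by positivity
  set lg := Real.logb 2 N with hlgdef
  set R := √(N * lg * max 1 (k : ℝ)) with hR
  have hmax : (1 : ℝ) ≤ max 1 (k : ℝ) := le_max_left _ _
  have hNlg : (N : ℝ) ≤ N * lg := by nlinarith
  have r1 : √(N : ℝ) ≤ R := Real.sqrt_le_sqrt (by nlinarith)
  have r2 : √(k * N : ℝ) ≤ R := Real.sqrt_le_sqrt (by
    have : (k : ℝ) ≤ max 1 (k : ℝ) := le_max_right _ _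
    nlinarith)
  have r3 : 1 ≤ R := by
    rw [hR, Real.one_le_sqrt]; nlinarith
  have hlg2 : lg ≤ lg ^ 2 := by nlinarith
  have hRl : R ≤ R * lg ^ 2 := by nlinarith
  have hkl : (k : ℝ) ≤ k * lg ^ 2 := by nlinarith
  have hRll : lg ≤ R * lg ^ 2 := by nlinarith
  rw [add_mul]
  refine ⟨?_, by linarith⟩
  rcases h with h | ⟨K, hK, h⟩
  · have h' : (n : ℝ) ≤ 3 * k + 10 := by exact_mod_cast h
    linarith
  · have h' : (n : ℝ) ≤ 9 * a + 10 * Nat.size N + 50 + treeCost K (Nat.size N)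
        (fun v => (10 * (8 * Nat.size N + 30)) * bs (cnt (Nat.size N) lf v N)) (Nat.size N) 1 := by
      exact_mod_cast h
    have htc := treeCost_le (K := K) (H := Nat.size N) (N := N) (D := 10 * (8 * Nat.size N + 30))
      (lf := lf) (Nat.size N) 1 le_rfl (by simp)
    rw [hK] at htc
    set TC := (treeCost K (Nat.size N)
        (fun v => (10 * (8 * Nat.size N + 30)) * bs (cnt (Nat.size N) lf v N)) (Nat.size N) 1 : ℝ)
    -- The weight of the root: at most `N` suffixes, and `2 ^ Nat.size N ≤ 2 * N`.
    have hm : (cnt (Nat.size N) lf 1 N : ℝ) + 2 ^ Nat.size N ≤ 4 * N := by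
      have h3 : 0 < Nat.size N := Nat.size_pos.2 (by omega)
      have h4 : 2 ^ (Nat.size N - 1) ≤ N := Nat.lt_size.1 (by omega)
      have h5 : 2 ^ Nat.size N = 2 * 2 ^ (Nat.size N - 1) := by
        rw [← pow_succ']; congr 1; omega
      have h6 : cnt (Nat.size N) lf 1 N ≤ N := cnt_le
      have : cnt (Nat.size N) lf 1 N + 2 ^ Nat.size N ≤ 4 * N := by omega
      exact_mod_cast this
    have q4 : √(4 : ℝ) = 2 := by
      rw [show (4 : ℝ) = 2 ^ 2 by norm_num]; exact Real.sqrt_sq (by norm_num)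
    have m1 : √((cnt (Nat.size N) lf 1 N : ℝ) + 2 ^ Nat.size N) ≤ 2 * R := by
      refine (Real.sqrt_le_sqrt hm).trans ?_
      rw [Real.sqrt_mul (by norm_num), q4]
      linarith
    have m2 : √(k * ((cnt (Nat.size N) lf 1 N : ℝ) + 2 ^ Nat.size N)) ≤ 2 * R := by
      refine (Real.sqrt_le_sqrt (mul_le_mul_of_nonneg_left hm hk)).trans ?_
      rw [show (k : ℝ) * (4 * N) = 4 * (k * N) by ring, Real.sqrt_mul (by norm_num), q4]
      linarith
    -- Here `Nat.size N ≤ 2 * lg` and `1 ≤ lg` give `160 * lg + 300 * lg`.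
    have hD : ((10 * (8 * Nat.size N + 30) : ℕ) : ℝ) ≤ 460 * lg := by
      push_cast; linarith
    have hin : √((cnt (Nat.size N) lf 1 N : ℝ) + 2 ^ Nat.size N) + 2 * (Nat.size N : ℝ) *
        √(k * ((cnt (Nat.size N) lf 1 N : ℝ) + 2 ^ Nat.size N)) ≤ 10 * (R * lg) := by
      have : 2 * (Nat.size N : ℝ) * √(k * ((cnt (Nat.size N) lf 1 N : ℝ) + 2 ^ Nat.size N)) ≤
          2 * (2 * lg) * (2 * R) := by gcongr
      nlinarith
    have hTC : TC ≤ 2 * (460 * lg) * (10 * (R * lg)) := by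
      refine htc.trans ?_
      gcongr
    have : 2 * (460 * lg) * (10 * (R * lg)) = 9200 * (R * lg ^ 2) := by ring
    have h10 : (10 : ℝ) * Nat.size N + 50 ≤ 70 * lg := by linarith
    linarith

end DocumentListing

theorem mainTheorem6 :
    ∃ (P : WordRAM.Prog) (κ : ℕ) (C : ℝ),
      ∀ (w c N : ℕ) (docs : Fin c → List ℕ),
        N = DocumentListing.totalLength docs → 2 ≤ N →
        N ^ κ ≤ 2 ^ w → c < 2 ^ w → (∀ i, ∀ x ∈ docs i, x < 2 ^ w) →
        ∃ (S : ℕ) (M : ℕ → ℕ),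
          (S : ℝ) ≤ C * (N * Real.logb 2 N) ∧
          (∀ a, M a < 2 ^ w) ∧
          ∀ p q : List ℕ,
            p.length < 2 ^ w → q.length < 2 ^ w →
            (∀ x ∈ p, x < 2 ^ w) → (∀ x ∈ q, x < 2 ^ w) →
            ∃ t : ℕ,
              DocumentListing.Answers P w S M docs p q t ∧
              (t : ℝ) ≤ C * (p.length + q.length +
                (Real.sqrt (N * Real.logb 2 N *
                    max 1 ((DocumentListing.matching docs p q).card : ℝ)) +
                  ((DocumentListing.matching docs p q).card : ℝ)) *
                Real.logb 2 N ^ 2) := by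
  -- The memory has at most `1280 * N * (2 * N)` cells, below `2 ^ 12 * N ^ 2`, and `2 ^ 12 ≤ N ^
  -- 12` since `N ≥ 2`; hence 14. The factor 10000 covers 9300 steps per unit of time and `1280 * 3`
  -- cells per unit of space; `query.factor` is the cost of compilation.
  refine ⟨WordRAM.queryProg, 14, 10000 * (WordRAM.query.factor + 1), ?_⟩
  intro w c N docs hN h2 hw hc hchar
  have hsize : Nat.size N ≤ N := Nat.size_le.2 Nat.lt_two_pow_self
  have hw' : 32 * (40 * (N * (Nat.size N + 1))) ≤ 2 ^ w := by
    refine le_trans ?_ hw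
    have h12 : 2 ^ 12 ≤ N ^ 12 := Nat.pow_le_pow_left h2 12
    calc _ ≤ 32 * (40 * (N * (N + N))) := by gcongr; omega
      _ ≤ 2 ^ 12 * (N ^ 2) := by ring_nf; omega
      _ ≤ N ^ 12 * N ^ 2 := Nat.mul_le_mul_right _ h12
      _ = N ^ 14 := by ring
  obtain ⟨hs, hlg⟩ := DocumentListing.size_le_logb h2
  obtain ⟨I⟩ := DocumentListing.exists_index docs hN h2 hw' hc hchar
  set L := 40 * (N * (Nat.size N + 1)) with hL
  refine ⟨32 * L, fun a => I.A (a % 32) (a / 32), ?_, fun a => I.A_lt _ _, ?_⟩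
  · have hN' : (2 : ℝ) ≤ N := by exact_mod_cast h2
    have hF : (0 : ℝ) ≤ WordRAM.query.factor := by positivity
    have e1 : (N : ℝ) * (Nat.size N + 1) ≤ N * (3 * Real.logb 2 N) :=
      mul_le_mul_of_nonneg_left (by linarith) (by linarith)
    have e2 : (0 : ℝ) ≤ N * Real.logb 2 N := by positivity
    rw [hL]
    push_cast
    nlinarith [mul_nonneg hF e2]
  intro p q hp hq _ _
  have T := I.tree p q
  obtain ⟨t, n, s, hrun, hmem, hpost, ht⟩ := WordRAM.run_queryProg ⟨w, L, p, q, I.A⟩ T.hL T.h32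
    (fun ρ h0 h1 => WordRAM.wp_query T I.valid I.nodup I.length (I.repr p q) hp hq h0 h1
      I.count hc)
  obtain ⟨hnd, hout, hn⟩ := I.output hpost
  refine ⟨t, ⟨s, hrun, hmem, hnd, hout⟩, ?_⟩
  obtain ⟨hcost, hone⟩ := DocumentListing.query_cost_le h2 hn
  have ht' : (t : ℝ) ≤ 1 + WordRAM.query.factor * n := by exact_mod_cast ht
  have hF : (0 : ℝ) ≤ WordRAM.query.factor := by positivity
  push_cast at hcost
  have h3 := mul_le_mul_of_nonneg_left hcost hF
  have hpq : (0 : ℝ) ≤ (p.length : ℝ) + q.length := by positivity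
  generalize (√(N * Real.logb 2 N * max 1 ((DocumentListing.matching docs p q).card : ℝ)) +
    ((DocumentListing.matching docs p q).card : ℝ)) * Real.logb 2 N ^ 2 = Z at *
  nlinarith [mul_nonneg hF (add_nonneg hpq (zero_le_one.trans hone))]
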